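/- Let $\Bbbk$ be a commutative ring and $n,r\ge 0$. **Degenerate affine Hecke algebra.** $AH_r$ is the $\Bbbk$-algebra generated by commuting elements $x_1,\dots,x_r$ and the symmetric group $S_r$ (with basic transpositions $s_i=(i\;i{+}1)$, products of permutations being composed as functions), subject to $s_ix_i=x_{i+1}s_i+1$, $x_is_i=s_ix_{i+1}+1$ and $x_is_j=s_jx_i$ for $i\ne j,j+1$. Let $P_r=\Bbbk[x_1,\dots,x_r]\subseteq AH_r$, and for a composition $\nu$ of $r$ let $S_\nu\le S_r$ be the parabolic subgroup and $P^\nu\subseteq P_r$ the subalgebra of $S_\nu$-invariants. **Degenerate affine Schur algebra.** Let $V$ be free over $\Bbbk$ with basis $v_1,\dots,v_n$; $S_r$ acts on the right of $V^{\otimes r}$ by permuting tensor positions: $(v_{i_1}\otimes\cdots\otimes v_{i_r})w=v_{i_{w(1)}}\otimes\cdots\otimes v_{i_{w(r)}}$. Set $AS(n,r)=\operatorname{End}_{AH_r}(V^{\otimes r}\otimes_{\Bbbk S_r}AH_r)$ (right module endomorphisms). Let $\Lambda(n,r)$ be the set of $\mu\in\mathbb N^n$ with $\mu_1+\dots+\mu_n=r$,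 and write $\mu_{<j}=\mu_1+\dots+\mu_{j-1}$, $\mu_{\le j}=\mu_{<j}+\mu_j$. For $\mu\in\Lambda(n,r)$ put $m_\mu=v_1^{\otimes\mu_1}\otimes\cdots\otimes v_n^{\otimes\mu_n}$. The vectors $m_\mu\otimes1$ generate $V^{\otimes r}\otimes_{\Bbbk S_r}AH_r$. **Basis elements.** Let $A$ be an $n\times n$ matrix over $\mathbb N$ with row sums $\lambda\in\Lambda(n,r)$ and column sums $\mu\in\Lambda(n,r)$; we write $A\in\mathrm{Mat}_{\lambda,\mu}$. Let $\mu(A)$ be the composition obtained by reading the entries of $A$ down columns, starting with the leftmost column. Cut $1,\dots,r$ into consecutive blocks $B_{i,j}$ with $|B_{i,j}|=a_{i,j}$, taken in this order. Let $d_A\in S_r$ be the permutation that is increasing on each $B_{i,j}$ and maps the $B_{i,j}$ to consecutive intervals that come in the order of the entries of $A$ read along rows, starting with the top row. For $f\in P^{\mu(A)}$ let $\xi_{A,f}\in AS(n,r)$ be the unique element with $$\xi_{A,f}(m_\mu\otimes 1)=\sum_{y\in(S_{\mu(A)}\backslash S_\mu)_{\min}}m_\lambda\otimes d_A\,f\,y,\qquad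 \xi_{A,f}(m_\nu\otimes1)=0\ \text{ for }\nu\ne\mu,$$ where $(S_{\mu(A)}\backslash S_\mu)_{\min}$ is the set of minimal length representatives of the right cosets $S_{\mu(A)}y$ in $S_\mu$. For a power series $f=\sum_{d\ge0}f_du^{-d}$ with all $f_d\in P^{\mu(A)}$ put $\xi_{A,f}=\sum_d\xi_{A,f_d}u^{-d}$. **Yangian and Drinfeld homomorphism.** $Y(\mathfrak{gl}_n)$ is the $\Bbbk$-algebra with generators $T^{(d)}_{i,j}$ ($1\le i,j\le n$, $d\ge1$) and relations $$[T_{i,j}^{(a)},T_{k,l}^{(b)}]=\sum_{c=0}^{\min(a,b)-1}\Big(T_{i,l}^{(a+b-1-c)}T_{k,j}^{(c)}-T_{i,l}^{(c)}T_{k,j}^{(a+b-1-c)}\Big)\qquad(a,b\ge1),$$ where $T^{(0)}_{i,j}=\delta_{i,j}$. Put $T_{i,j}(u)=\sum_{d\ge0}T_{i,j}^{(d)}u^{-d}$. The Drinfeld homomorphism $D_{n,r}:Y(\mathfrak{gl}_n)\to AS(n,r)$ is induced by the action of $Y(\mathfrak{gl}_n)$ on $V^{\otimes r}\otimes AH_r$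 in which $T_{i,j}(u)$ acts as $$\sum_{i=i_0,i_1,\dots,i_r=j}\ \prod_{p=1}^{r}\Big(\delta_{i_{p-1},i_p}+\frac{e^{[p]}_{i_{p-1},i_p}}{u-x_p}\Big).$$ Here the sum is over $i_1,\dots,i_{r-1}\in\{1,\dots,n\}$, $e_{a,b}^{[p]}$ is the matrix unit acting on the $p$th tensor factor, $x_p$ acts by left multiplication on $AH_r$, and $\frac1{u-x}=\sum_{d\ge0}x^du^{-d-1}$. (For $r=0$ the sum is read as $\delta_{i,j}$.) **Theorem.** For $1\le i,j\le n$, $$D_{n,r}\big(T_{i,j}(u)\big)=\sum_{\substack{t\ge1\\1\le j_1<\cdots<j_t=j\\ i\ge j_1}}\ \sum_{\substack{\mu\in\Lambda(n,r)\\ \mu_{j_1}>0\text{ if }i\ne j_1\\ \mu_{j_2},\dots,\mu_{j_t}>0}}\xi_{A,f},$$ where, for the sequence $i\ge j_1<\cdots<j_t=j$ and the composition $\mu$ indexing the summand, $A$ and $f$ are as follows. The matrix $$A=\operatorname{diag}(\mu_1,\dots,\mu_n)+(e_{i,j_1}-e_{j_1,j_1})+\sum_{k=2}^t(e_{j_{k-1},j_k}-e_{j_k,j_k})$$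 has entries in $\mathbb N$, row sums $\mu+\varepsilon_i-\varepsilon_j$ (where $\varepsilon_i$ is the $i$th standard basis vector of $\mathbb Z^n$) and column sums $\mu$. With $a_h=\mu_{<h}+1$ and $b_h=\mu_{\le h}$ for $1\le h\le n$, the series $f$ is the expansion in powers of $u^{-1}$ of $$\begin{cases}\displaystyle\Big[\prod_{p=a_{j_1}}^{b_{j_1}-1}\Big(1+\frac1{u-x_p}\Big)\Big]\frac1{u-x_{b_{j_1}}}\prod_{k=2}^t\frac1{u-x_{a_{j_k}}}&\text{if }i>j_1,\\[3mm]\displaystyle\Big[\prod_{p=a_{j_1}}^{b_{j_1}}\Big(1+\frac1{u-x_p}\Big)\Big]\prod_{k=2}^t\frac1{u-x_{a_{j_k}}}&\text{if }i=j_1,\end{cases}$$ and its coefficients belong to $P^{\mu(A)}$. -/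

import Mathlib

namespace DrinfeldSchur

/-! ### algebra -/
section RTT
variable {E : Type*} [Ring E] {n : ℕ}

/-- The defining relations of the Yangian, in difference form. -/
def DiffRTT (t : ℕ → Matrix (Fin n) (Fin n) E) : Prop :=
  t 0 = 1 ∧ ∀ (a b : ℕ) (i j k l : Fin n),
    (t (a + 1) i j * t b k l - t b k l * t (a + 1) i j)
      - (t a i j * t (b + 1) k l - t (b + 1) k l * t a i j)
      = t a k j * t b i l - t b k j * t a i l

theorem DiffRTT.mr {t : ℕ → Matrix (Fin n) (Fin n) E} (h : DiffRTT t) (a b : ℕ)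
    (i j k l : Fin n) :
    t a i j * t b k l - t b k l * t a i j
      = ∑ c ∈ Finset.range (min a b),
        (t (a + b - 1 - c) i l * t c k j - t c i l * t (a + b - 1 - c) k j) := by
  obtain ⟨h0, h⟩ := h
  -- first the form obtained by descending in the second index
  have key : ∀ (b a : ℕ) (i j k l : Fin n), 
      t a i j * t b k l - t b k l * t a i j
      = ∑ c ∈ Finset.range b,
        (t (a + b - 1 - c) i l * t c k j - t c i l * t (a + b - 1 - c) k j) := by
    intro b
    induction b with
    | zero => 
      intro a i j k l
      simp only [h0, Matrix.one_apply, Finset.range_zero, Finset.sum_empty]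
      split_ifs <;> simp
    | succ b ih =>
      intro a i j k l
      have h1 := h b a k l i j
      have h2 := ih (a+1) i j k l
      rw [Finset.sum_range_succ]
      have e1 : a + 1 + b - 1 = a + (b+1) - 1 := by omega
      have e2 : a + (b + 1) - 1 - b = a := by omega
      rw [e1] at h2
      rw [← h2, e2]
      rw [← sub_eq_zero] at h1 ⊢
      rw [← neg_eq_zero, ← h1]
      abel
  rcases le_total b a with hab | hab
  · rw [min_eq_right hab]; exact key b a i j k l
  · rw [min_eq_left hab, key b a i j k l, ← Finset.sum_range_add_sum_Ico _ hab, add_eq_left,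
      Finset.sum_sub_distrib, sub_eq_zero]
    refine Finset.sum_nbij' (fun c => a + b - 1 - c) (fun c => a + b - 1 - c) ?_ ?_ ?_ ?_ ?_
    · intro c hc; simp only [Finset.mem_Ico] at hc ⊢; omega
    · intro c hc; simp only [Finset.mem_Ico] at hc ⊢; omega
    · intro c hc; simp only [Finset.mem_Ico] at hc ⊢; omega
    · intro c hc; simp only [Finset.mem_Ico] at hc ⊢; omega
    · intro c hc
      simp only [Finset.mem_Ico] at hc
      have : a + b - 1 - (a + b - 1 - c) = c := by omega
      rw [this]

open PowerSeries

/-- First-variable and second-variable copies of a power series. -/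
noncomputable def inX : E⟦X⟧ →+* E⟦X⟧⟦X⟧ := C
noncomputable def inY : E⟦X⟧ →+* E⟦X⟧⟦X⟧ := PowerSeries.map C

theorem coeff_XY (f g : E⟦X⟧) (a b : ℕ) :
    coeff a (coeff b (inX f * inY g)) = coeff a f * coeff b g := by
  simp [inX, inY, coeff_C_mul, coeff_mul_C]

theorem coeff_YX (f g : E⟦X⟧) (a b : ℕ) :
    coeff a (coeff b (inY g * inX f)) = coeff b g * coeff a f := by
  simp [inX, inY, coeff_C_mul, coeff_mul_C]

def CoeffCommute (f g : E⟦X⟧) : Prop := ∀ a b, Commute (coeff a f) (coeff b g)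

theorem CoeffCommute.inYX {f g : E⟦X⟧} (h : CoeffCommute f g) : inY g * inX f = inX f * inY g := by
  ext b a
  rw [coeff_XY, coeff_YX]
  exact ((h a b).eq).symm

theorem CoeffCommute.symm {f g : E⟦X⟧} (h : CoeffCommute f g) : CoeffCommute g f :=
  fun a b => (h b a).symm

theorem CoeffCommute.mul {f g g' : E⟦X⟧} (h : CoeffCommute f g) (h' : CoeffCommute f g') :
    CoeffCommute f (g * g') := by
  intro a b
  rw [coeff_mul]
  exact Commute.sum_right _ _ _ fun p _ => (h a _).mul_right (h' a _)

theorem CoeffCommute.sum {ι : Type*} {s : Finset ι} {f : E⟦X⟧} {g : ι → E⟦X⟧}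
    (h : ∀ i ∈ s, CoeffCommute f (g i)) : CoeffCommute f (∑ i ∈ s, g i) := by
  intro a b
  rw [map_sum]
  exact Commute.sum_right _ _ _ fun p hp => h p hp a b

/-- The RTT relation for a matrix of power series. -/
def SeriesRTT (A : Matrix (Fin n) (Fin n) E⟦X⟧) : Prop :=
  ∀ i j k l : Fin n,
    (X - C X) * (inX (A i j) * inY (A k l) - inY (A k l) * inX (A i j)) =
      X * C X * (inX (A k j) * inY (A i l) - inY (A k j) * inX (A i l))

noncomputable def coeffs (A : Matrix (Fin n) (Fin n) E⟦X⟧) (d : ℕ) : Matrix (Fin n) (Fin n) E :=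
  fun i j => coeff d (A i j)

theorem seriesRTT_iff {A : Matrix (Fin n) (Fin n) E⟦X⟧} (h0 : coeffs A 0 = 1) :
    SeriesRTT A ↔ DiffRTT (coeffs A) := by
  have h0' : ∀ i j, coeff 0 (A i j) = (1 : Matrix (Fin n) (Fin n) E) i j := by
    intro i j; rw [← h0]; rfl
  have hc : ∀ i j (e : E), Commute ((1 : Matrix (Fin n) (Fin n) E) i j) e := by
    intro i j e
    rw [Matrix.one_apply]; split_ifs
    · exact Commute.one_left e
    · exact Commute.zero_left e
  have eqv : ∀ i j k l : Fin n, 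
    ((X - C X) * (inX (A i j) * inY (A k l) - inY (A k l) * inX (A i j)) =
      X * C X * (inX (A k j) * inY (A i l) - inY (A k j) * inX (A i l))) ↔ 
      ∀ a b, (coeff (a+1) (A i j) * coeff b (A k l) - coeff b (A k l) * coeff (a+1) (A i j))
       - (coeff a (A i j) * coeff (b+1) (A k l) - coeff (b+1) (A k l) * coeff a (A i j)) =
        coeff a (A k j) * coeff b (A i l) - coeff b (A k j) * coeff a (A i l) := by
    intro i j k l
    constructor
    · intro h a b
      have := congrArg (fun f => coeff (a+1) (coeff (b+1) f)) h
      simp only [sub_mul, mul_assoc, map_sub, coeff_succ_X_mul, coeff_C_mul, coeff_XY, coeff_YX] at this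
      rw [← neg_inj, ← sub_eq_zero] at this ⊢
      rw [← this]
    · intro h
      ext b a
      simp only [sub_mul, mul_assoc, map_sub]
      rcases b with _ | b <;> rcases a with _ | a <;>
        simp only [coeff_succ_X_mul, coeff_C_mul, coeff_XY, coeff_YX, coeff_zero_X_mul, map_zero,
          h0', sub_zero, zero_sub, mul_sub, map_sub]
      · rw [neg_sub]; exact sub_eq_zero.2 (hc k l _).eq
      · exact sub_eq_zero.2 (hc i j _).eq
      · exact h a b
  constructor
  · intro h
    exact ⟨h0, fun a b i j k l => (eqv i j k l).1 (h i j k l) a b⟩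
  · intro h i j k l
    exact (eqv i j k l).2 fun a b => h.2 a b i j k l

theorem rtt_mul_aux {R : Type*} [Ring R] {z w : R} (hz : ∀ r, z * r = r * z)
    (hw : ∀ r, w * r = r * w) {a a' b b' : Matrix (Fin n) (Fin n) R}
    (ha : ∀ i j k l, z * (a i j * a' k l - a' k l * a i j) = w * (a k j * a' i l - a' k j * a i l))
    (hb : ∀ i j k l, z * (b i j * b' k l - b' k l * b i j) = w * (b k j * b' i l - b' k j * b i l))
    (hab' : ∀ i j k l, b' i j * a k l = a k l * b' i j)
    (ha'b : ∀ i j k l, b i j * a' k l = a' k l * b i j) (i j k l : Fin n) :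
    z * ((a * b) i j * (a' * b') k l - (a' * b') k l * (a * b) i j) =
      w * ((a * b) k j * (a' * b') i l - (a' * b') k j * (a * b) i l) := by
  have e1 : ∀ i j k l, (a * b) i j * (a' * b') k l
      = ∑ m, ∑ p, (a i m * a' k p) * (b m j * b' p l) := by
    intro i j k l
    rw [Matrix.mul_apply, Matrix.mul_apply, Finset.sum_mul_sum]
    refine Finset.sum_congr rfl fun m _ => Finset.sum_congr rfl fun p _ => ?_
    calc a i m * b m j * (a' k p * b' p l) = a i m * (b m j * a' k p) * b' p l := by
          simp only [mul_assoc]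
      _ = _ := by rw [ha'b]; simp only [mul_assoc]
  have e2 : ∀ i j k l, (a' * b') k l * (a * b) i j
      = ∑ m, ∑ p, (a' k p * a i m) * (b' p l * b m j) := by
    intro i j k l
    rw [Matrix.mul_apply, Matrix.mul_apply, Finset.sum_mul_sum, Finset.sum_comm]
    refine Finset.sum_congr rfl fun m _ => Finset.sum_congr rfl fun p _ => ?_
    calc a' k p * b' p l * (a i m * b m j) = a' k p * (b' p l * a i m) * b m j := by
          simp only [mul_assoc]
      _ = _ := by rw [hab']; simp only [mul_assoc]
  have e3 : ∑ m, ∑ p, (a' k m * a i p) * (b m j * b' p l)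
      = ∑ m, ∑ p, (a' k p * a i m) * (b p j * b' m l) := Finset.sum_comm
  have lhs : z * ((a * b) i j * (a' * b') k l - (a' * b') k l * (a * b) i j)
      = ∑ m, ∑ p, (z * (a i m * a' k p - a' k p * a i m) * (b m j * b' p l)
        + (a' k p * a i m) * (z * (b m j * b' p l - b' p l * b m j))) := by
    rw [e1, e2, ← Finset.sum_sub_distrib, Finset.mul_sum]
    refine Finset.sum_congr rfl fun m _ => ?_
    rw [← Finset.sum_sub_distrib, Finset.mul_sum]
    refine Finset.sum_congr rfl fun p _ => ?_
    rw [← mul_assoc (a' k p * a i m) z, ← hz (a' k p * a i m)]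
    noncomm_ring
  have rhs : w * ((a * b) k j * (a' * b') i l - (a' * b') k j * (a * b) i l)
      = ∑ m, ∑ p, (w * (a k m * a' i p * (b m j * b' p l))
        - w * (a' k p * a i m * (b' p j * b m l))) := by
    rw [e1, e2, ← Finset.sum_sub_distrib, Finset.mul_sum]
    refine Finset.sum_congr rfl fun m _ => ?_
    rw [← Finset.sum_sub_distrib, Finset.mul_sum]
    refine Finset.sum_congr rfl fun p _ => ?_
    rw [mul_sub]
  have e4 : ∑ m, ∑ p, (w * ((a' k p * a i m) * (b p j * b' m l))
      - w * ((a' k m * a i p) * (b m j * b' p l))) = 0 := by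
    simp only [Finset.sum_sub_distrib, ← Finset.mul_sum]
    rw [e3, sub_self]
  rw [lhs, rhs, ← sub_eq_zero, ← e4, ← Finset.sum_sub_distrib]
  refine Finset.sum_congr rfl fun m _ => ?_
  rw [← Finset.sum_sub_distrib]
  refine Finset.sum_congr rfl fun p _ => ?_
  rw [ha, hb, ← mul_assoc (a' k p * a i m) w, ← hw (a' k p * a i m)]
  noncomm_ring

theorem SeriesRTT.mul {A B : Matrix (Fin n) (Fin n) E⟦X⟧} (hA : SeriesRTT A) (hB : SeriesRTT B)
    (hc : ∀ i j k l, CoeffCommute (A i j) (B k l)) : SeriesRTT (A * B) := by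
  have hX : ∀ r : E⟦X⟧⟦X⟧, X * r = r * X := fun r => X_mul
  have hCX : ∀ r : E⟦X⟧⟦X⟧, C X * r = r * C X := by
    intro r
    ext1 b
    rw [coeff_C_mul, coeff_mul_C, X_mul]
  have hx : ∀ i j, inX ((A * B) i j) = ((A.map inX) * (B.map inX)) i j := by
    intro i j; simp [Matrix.mul_apply]
  have hy : ∀ i j, inY ((A * B) i j) = ((A.map inY) * (B.map inY)) i j := by
    intro i j; simp [Matrix.mul_apply]
  intro i j k l
  simp only [hx, hy]
  refine rtt_mul_aux (z := X - C X) (w := X * C X) ?_ ?_ hA hB ?_ ?_ i j k l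
  · intro r; rw [sub_mul, mul_sub, hX, hCX]
  · intro r; rw [mul_assoc, hCX, ← mul_assoc, hX, mul_assoc]
  · intro i j k l; exact (hc k l i j).inYX
  · intro i j k l; exact (hc k l i j).symm.inYX.symm

theorem one_commute {A : Matrix (Fin n) (Fin n) E⟦X⟧} :
    ∀ i j k l, CoeffCommute (A i j) ((1 : Matrix (Fin n) (Fin n) E⟦X⟧) k l) := by
  intro i j k l a b
  rw [Matrix.one_apply]
  split_ifs
  · rw [coeff_one]; split_ifs
    · exact Commute.one_right _
    · exact Commute.zero_right _
  · rw [map_zero]; exact Commute.zero_right _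

theorem SeriesRTT.one : SeriesRTT (1 : Matrix (Fin n) (Fin n) E⟦X⟧) := by
  have : coeffs (1 : Matrix (Fin n) (Fin n) E⟦X⟧) 0 = 1 := by
    ext i j
    simp only [coeffs, Matrix.one_apply]; split_ifs <;> simp
  have hs : ∀ d, coeffs (1 : Matrix (Fin n) (Fin n) E⟦X⟧) (d + 1) = 0 := by
    intro d
    ext i j
    simp only [coeffs, Matrix.one_apply]; split_ifs <;> simp [coeff_one]
  rw [seriesRTT_iff this]
  refine ⟨this, fun a b i j k l => ?_⟩
  rw [hs, hs]
  rcases a with _ | a <;> rcases b with _ | b <;> simp only [hs, this, Matrix.one_apply] <;>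
    simp

theorem listProd_commute {A : Matrix (Fin n) (Fin n) E⟦X⟧} (L : List (Matrix (Fin n) (Fin n) E⟦X⟧))
    (h : ∀ B ∈ L, ∀ i j k l, CoeffCommute (A i j) (B k l)) :
    ∀ i j k l, CoeffCommute (A i j) (L.prod k l) := by
  induction L with
  | nil => simpa using one_commute
  | cons B L ih =>
    intro i j k l
    rw [List.prod_cons, Matrix.mul_apply]
    refine CoeffCommute.sum fun m _ => CoeffCommute.mul ?_ ?_
    · exact h B (by simp) i j k m
    · exact ih (fun B hB => h B (by simp [hB])) i j m l

theorem SeriesRTT.listProd (L : List (Matrix (Fin n) (Fin n) E⟦X⟧)) (h : ∀ B ∈ L, SeriesRTT B)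
    (hc : L.Pairwise fun A B => ∀ i j k l, CoeffCommute (A i j) (B k l)) : SeriesRTT L.prod := by
  induction L with
  | nil => simpa using SeriesRTT.one
  | cons B L ih =>
    rw [List.prod_cons]
    rw [List.pairwise_cons] at hc
    exact (h B (by simp)).mul (ih (fun B hB => h B (by simp [hB])) hc.2) (listProd_commute L hc.1)

theorem coeffs_zero_listProd (L : List (Matrix (Fin n) (Fin n) E⟦X⟧))
    (h : ∀ B ∈ L, coeffs B 0 = 1) : coeffs L.prod 0 = 1 := by
  induction L with
  | nil =>
    ext i j
    simp only [coeffs, List.prod_nil, Matrix.one_apply]; split_ifs <;> simp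
  | cons B L ih =>
    have h1 := h B (by simp)
    have h2 := ih (fun B hB => h B (by simp [hB]))
    have : coeffs (B * L.prod) 0 = coeffs B 0 * coeffs L.prod 0 := by
      ext i j
      simp [coeffs, Matrix.mul_apply]
    rw [List.prod_cons, this, h1, h2, mul_one]

/-- The power series `1 / (u - x)` in `u⁻¹`: the coefficient of `u^{-d-1}` is `x ^ d`. -/
noncomputable def invSub {R : Type*} [Semiring R] (x : R) : R⟦X⟧ := X * mk fun d => x ^ d

/-- The `L`-operator `1 + Q / (u - x)`. -/
noncomputable def LOp (e : Fin n → Fin n → E) (x : E) : Matrix (Fin n) (Fin n) E⟦X⟧ :=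
  fun i j => (if i = j then 1 else 0) + C (e i j) * invSub x

theorem coeffs_LOp_zero (e : Fin n → Fin n → E) (x : E) : coeffs (LOp e x) 0 = 1 := by
  ext i j
  simp only [coeffs, LOp, invSub, Matrix.one_apply, map_add, coeff_C_mul, coeff_zero_X_mul]
  split_ifs <;> simp

theorem coeffs_LOp_succ (e : Fin n → Fin n → E) (x : E) (d : ℕ) (i j : Fin n) :
    coeffs (LOp e x) (d + 1) i j = e i j * x ^ d := by
  simp only [coeffs, LOp, invSub, map_add, coeff_C_mul, coeff_succ_X_mul, coeff_mk]
  split_ifs <;> simp [coeff_one]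

theorem SeriesRTT.LOp {e : Fin n → Fin n → E} {x : E}
    (he : ∀ i j k l, e i j * e k l = if j = k then e i l else 0)
    (hx : ∀ i j, x * e i j = e i j * x) : SeriesRTT (LOp e x) := by
  have hx' : ∀ d i j, x ^ d * e i j = e i j * x ^ d := by
    intro d i j
    exact ((show Commute x (e i j) from hx i j).pow_left d).eq
  have hm : ∀ i j k l a b, e i j * x ^ a * (e k l * x ^ b)
      = if j = k then e i l * x ^ (a + b) else 0 := by
    intro i j k l a b
    rw [mul_assoc, ← mul_assoc (x ^ a), hx', mul_assoc, ← mul_assoc (e i j), he, ← pow_add]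
    split_ifs <;> simp
  rw [seriesRTT_iff (coeffs_LOp_zero e x)]
  refine ⟨coeffs_LOp_zero e x, fun a b i j k l => ?_⟩
  rcases a with _ | a <;> rcases b with _ | b <;>
    simp only [coeffs_LOp_zero, coeffs_LOp_succ, hm, Matrix.one_apply]
  · split_ifs <;> simp
  · split_ifs <;> grind
  · split_ifs <;> grind
  · have e1 : a + 1 + b = a + (b + 1) := by omega
    have e2 : b + (a + 1) = a + (b + 1) := by omega
    have e3 : b + 1 + a = a + (b + 1) := by omega
    have e4 : b + a = a + b := by omega
    rw [e1, e2, e3, e4]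
    split_ifs <;> grind

end RTT


section Comb

theorem perm_apply_inv {α : Type*} (e : Equiv.Perm α) (x : α) : e (e⁻¹ x) = x := e.apply_symm_apply x

variable {r : ℕ}

section block
variable {ι : Type*} [Fintype ι] [LinearOrder ι]

theorem blockLabel_nonempty {ν : ι → ℕ} (hν : ∑ a, ν a = r) (p : Fin r) :
    (Finset.univ.filter fun a => (p : ℕ) < ∑ b ∈ Finset.univ.filter (· ≤ a), ν b).Nonempty := by
  have hne : (Finset.univ : Finset ι).Nonempty := by
    rw [Finset.nonempty_iff_ne_empty]
    intro h
    rw [h, Finset.sum_empty] at hν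
    exact absurd p.2 (by omega)
  refine ⟨Finset.univ.max' hne, ?_⟩
  have : Finset.univ.filter (· ≤ Finset.univ.max' hne) = Finset.univ := by
    rw [Finset.filter_eq_self]
    intro a ha
    exact Finset.le_max' _ _ ha
  rw [Finset.mem_filter, this, hν]
  exact ⟨Finset.mem_univ _, p.2⟩

/-- For a composition `ν` of `r` with parts indexed by a finite linear order, cut `0, …, r - 1`
into consecutive blocks of sizes `ν a`, in increasing order of `a`; this is the label of the block
that contains `p`, i.e. the least `a` with `p < ∑_{b ≤ a} ν b`. -/
def blockLabel (ν : ι → ℕ) (hν : ∑ a, ν a = r) (p : Fin r) : ι :=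
  (Finset.univ.filter fun a => (p : ℕ) < ∑ b ∈ Finset.univ.filter (· ≤ a), ν b).min'
    (blockLabel_nonempty hν p)

theorem blockLabel_le_iff {ν : ι → ℕ} (hν : ∑ a, ν a = r) (p : Fin r) (a : ι) :
    blockLabel ν hν p ≤ a ↔ (p : ℕ) < ∑ b ∈ Finset.univ.filter (· ≤ a), ν b := by
  unfold blockLabel
  constructor
  · intro h
    have h1 := Finset.min'_mem _ (blockLabel_nonempty hν p)
    rw [Finset.mem_filter] at h1
    refine h1.2.trans_le (Finset.sum_le_sum_of_subset ?_)
    intro b hb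
    simp only [Finset.mem_filter, Finset.mem_univ, true_and] at hb ⊢
    exact hb.trans h
  · intro h
    exact Finset.min'_le _ _ (by simpa using h)

theorem blockLabel_mono {ν : ι → ℕ} (hν : ∑ a, ν a = r) : Monotone (blockLabel ν hν) := by
  intro p q hpq
  rw [blockLabel_le_iff]
  exact lt_of_le_of_lt hpq ((blockLabel_le_iff hν q _).1 le_rfl)

/-- A monotone labelling is determined by its fibre sizes. -/
theorem eq_blockLabel {ν : ι → ℕ} (hν : ∑ a, ν a = r) {g : Fin r → ι} (hg : Monotone g)
    (hc : ∀ a, (Finset.univ.filter fun p => g p = a).card = ν a) : g = blockLabel ν hν := by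
  have key : ∀ p a, g p ≤ a ↔ blockLabel ν hν p ≤ a := by
    intro p a
    rw [blockLabel_le_iff, ← Tuple.lt_card_le_iff_apply_le_of_monotone (a := a) hg]
    have : ∑ b ∈ Finset.univ.filter (· ≤ a), ν b
        = (Finset.univ.filter fun i => g i ≤ a).card := by
      rw [Finset.card_eq_sum_card_fiberwise (f := g)
        (t := Finset.univ.filter (· ≤ a))]
      · refine Finset.sum_congr rfl fun b hb => ?_
        rw [← hc b, Finset.filter_filter]
        congr 1
        ext p
        simp only [Finset.mem_filter, Finset.mem_univ, true_and] at hb ⊢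
        constructor
        · intro h; exact ⟨h ▸ hb, h⟩
        · intro h; exact h.2
      · intro p hp
        simpa using hp
    rw [this]
  funext p
  exact le_antisymm ((key p _).2 le_rfl) ((key p _).1 le_rfl)

theorem card_blockLabel {ν : ι → ℕ} (hν : ∑ a, ν a = r) (a : ι) :
    (Finset.univ.filter fun p => blockLabel ν hν p = a).card = ν a := by
  have h1 : ∀ a, ∑ b ∈ Finset.univ.filter (· ≤ a),
      (Finset.univ.filter fun p => blockLabel ν hν p = b).card
        = ∑ b ∈ Finset.univ.filter (· ≤ a), ν b := by
    intro a
    have hle : ∑ b ∈ Finset.univ.filter (· ≤ a), ν b ≤ r := by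
      conv_rhs => rw [← hν]
      exact Finset.sum_le_sum_of_subset (Finset.subset_univ _)
    have h2 : (Finset.univ.filter fun p => blockLabel ν hν p ≤ a).card
        = ∑ b ∈ Finset.univ.filter (· ≤ a), ν b := by
      simp only [blockLabel_le_iff]
      rw [Fin.card_filter_val_lt, min_eq_right hle]
    rw [← h2, Finset.card_eq_sum_card_fiberwise (f := blockLabel ν hν)
        (t := Finset.univ.filter (· ≤ a))]
    · refine Finset.sum_congr rfl fun b hb => ?_
      rw [Finset.filter_filter]
      congr 1
      ext p
      simp only [Finset.mem_filter, Finset.mem_univ, true_and] at hb ⊢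
      constructor
      · intro h; exact ⟨h ▸ hb, h⟩
      · intro h; exact h.2
    · intro p hp
      simpa using hp
  induction a using WellFoundedLT.induction with
  | ind a ih =>
    have h2 := h1 a
    have h3 : Finset.univ.filter (· ≤ a) = insert a (Finset.univ.filter (· < a)) := by
      ext b; simp [le_iff_eq_or_lt]
    rw [h3, Finset.sum_insert (by simp), Finset.sum_insert (by simp)] at h2
    have h4 : ∑ b ∈ Finset.univ.filter (· < a),
        (Finset.univ.filter fun p => blockLabel ν hν p = b).card
          = ∑ b ∈ Finset.univ.filter (· < a), ν b := by
      refine Finset.sum_congr rfl fun b hb => ih b (by simpa using hb)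
    omega

end block

section perm
variable {ι : Type*}

/-- The permutations that preserve a labelling of `0, …, r - 1`. -/
def stab (c : Fin r → ι) : Subgroup (Equiv.Perm (Fin r)) where
  carrier := {w | ∀ p, c (w p) = c p}
  one_mem' := fun p => rfl
  mul_mem' := fun {v w} hv hw p => by rw [Equiv.Perm.mul_apply, hv, hw]
  inv_mem' := fun {w} hw p => by
    have := hw (w⁻¹ p)
    rw [perm_apply_inv] at this
    exact this.symm

theorem mem_stab {c : Fin r → ι} {w : Equiv.Perm (Fin r)} : w ∈ stab c ↔ ∀ p, c (w p) = c p :=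
  Iff.rfl

theorem mem_stab' {c : Fin r → ι} {w : Equiv.Perm (Fin r)} : w ∈ stab c ↔ c ∘ w = c := by
  rw [mem_stab, funext_iff]; rfl

variable [LinearOrder ι]

/-- The usual length function on the symmetric group: the number of inversions. -/
def len (w : Equiv.Perm (Fin r)) : ℕ :=
  (Finset.univ.filter fun pq : Fin r × Fin r => pq.1 < pq.2 ∧ w pq.2 < w pq.1).card

/-- `y` has minimal length in the right coset `(stab c) y`. -/
def IsMinRep (c : Fin r → ι) (y : Equiv.Perm (Fin r)) : Prop :=
  ∀ w ∈ stab c, len y ≤ len (w * y)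

def rep (c : Fin r → ι) (y : Equiv.Perm (Fin r)) : Equiv.Perm (Fin r) := (Tuple.sort (c ∘ y))⁻¹

theorem comp_rep {c : Fin r → ι} (hc : Monotone c) (y : Equiv.Perm (Fin r)) :
    c ∘ rep c y = c ∘ y := by
  have h1 : (c ∘ y) ∘ Tuple.sort (c ∘ y) = c := by
    rw [Tuple.comp_perm_comp_sort_eq_comp_sort, Tuple.sort_eq_refl_iff_monotone.2 hc]
    rfl
  funext p
  have := congrFun h1 ((Tuple.sort (c ∘ y))⁻¹ p)
  simp only [Function.comp_apply, perm_apply_inv] at this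
  exact this.symm

theorem rep_mul_inv_mem {c : Fin r → ι} (hc : Monotone c) (y : Equiv.Perm (Fin r)) :
    rep c y * y⁻¹ ∈ stab c := by
  rw [mem_stab]
  intro p
  have := congrFun (comp_rep hc y) (y⁻¹ p)
  simpa using this

theorem rep_mul {c : Fin r → ι} {w : Equiv.Perm (Fin r)} (hw : w ∈ stab c)
    (y : Equiv.Perm (Fin r)) : rep c (w * y) = rep c y := by
  have : c ∘ (w * y : Equiv.Perm (Fin r)) = c ∘ y := by
    funext p; exact hw (y p)
  rw [rep, rep, this]

/-- inversions between different blocks, and inside a block -/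
def crossInv (c : Fin r → ι) : ℕ :=
  (Finset.univ.filter fun pq : Fin r × Fin r => pq.1 < pq.2 ∧ c pq.2 < c pq.1).card

def intraInv (c : Fin r → ι) (y : Equiv.Perm (Fin r)) : ℕ :=
  (Finset.univ.filter fun pq : Fin r × Fin r => pq.1 < pq.2 ∧ y pq.2 < y pq.1 ∧
    c (y pq.1) = c (y pq.2)).card

theorem len_eq {c : Fin r → ι} (hc : Monotone c) (y : Equiv.Perm (Fin r)) :
    len y = crossInv (c ∘ y) + intraInv c y := by
  rw [len, crossInv, intraInv, ← Finset.card_union_of_disjoint]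
  · congr 1
    ext ⟨p, q⟩
    simp only [Finset.mem_filter, Finset.mem_univ, true_and, Finset.mem_union, Function.comp_apply]
    constructor
    · rintro ⟨h1, h2⟩
      rcases (hc h2.le).lt_or_eq with h | h
      · exact Or.inl ⟨h1, h⟩
      · exact Or.inr ⟨h1, h2, h.symm⟩
    · rintro (⟨h1, h2⟩ | ⟨h1, h2, h3⟩)
      · exact ⟨h1, hc.reflect_lt h2⟩
      · exact ⟨h1, h2⟩
  · rw [Finset.disjoint_left]
    rintro ⟨p, q⟩ h1 h2
    simp only [Finset.mem_filter, Finset.mem_univ, true_and, Function.comp_apply] at h1 h2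
    exact h1.2.ne' h2.2.2

theorem intraInv_rep {c : Fin r → ι} (hc : Monotone c) (y : Equiv.Perm (Fin r)) :
    intraInv c (rep c y) = 0 := by
  rw [intraInv, Finset.card_eq_zero, Finset.filter_eq_empty_iff]
  rintro ⟨p, q⟩ - ⟨h1, h2, h3⟩
  have hs := (Tuple.eq_sort_iff (f := c ∘ y) (σ := Tuple.sort (c ∘ y))).1 rfl
  have h4 := hs.2 (rep c y q) (rep c y p) h2 (by
    have e1 := congrFun (comp_rep hc y) p
    have e2 := congrFun (comp_rep hc y) q
    simp only [Function.comp_apply] at e1 e2 h3 ⊢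
    simp only [rep, perm_apply_inv]
    rw [← e1, ← e2]; exact h3.symm)
  simp only [rep, perm_apply_inv] at h4
  exact absurd h1 (not_lt.2 h4.le)

theorem eq_rep_of_intraInv {c : Fin r → ι} (hc : Monotone c) {y : Equiv.Perm (Fin r)}
    (h : intraInv c y = 0) : rep c y = y := by
  rw [rep, inv_eq_iff_eq_inv]
  symm
  rw [Tuple.eq_sort_iff]
  constructor
  · have : (c ∘ y) ∘ (y⁻¹ : Equiv.Perm (Fin r)) = c := by funext p; simp
    rw [this]; exact hc
  · intro i j hij hcij
    by_contra hlt
    have hne : y⁻¹ j ≠ y⁻¹ i := fun h => hij.ne' (y⁻¹.injective h)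
    have hlt' : y⁻¹ j < y⁻¹ i := lt_of_le_of_ne (not_lt.1 hlt) hne
    rw [intraInv, Finset.card_eq_zero, Finset.filter_eq_empty_iff] at h
    refine h (Finset.mem_univ (y⁻¹ j, y⁻¹ i)) ⟨hlt', ?_, ?_⟩
    · simpa using hij
    · exact hcij.symm

theorem isMinRep_iff {c : Fin r → ι} (hc : Monotone c) (y : Equiv.Perm (Fin r)) :
    IsMinRep c y ↔ rep c y = y := by
  constructor
  · intro h
    apply eq_rep_of_intraInv hc
    have h1 := h _ (rep_mul_inv_mem hc y)
    rw [inv_mul_cancel_right, len_eq hc, len_eq hc (rep c y), comp_rep hc, intraInv_rep hc] at h1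
    omega
  · intro h w hw
    have e : c ∘ (w * y : Equiv.Perm (Fin r)) = c ∘ y := by
      funext p; exact hw (y p)
    rw [len_eq hc, len_eq hc (w * y), e, ← h, intraInv_rep hc]
    omega

theorem rep_rep {c : Fin r → ι} (hc : Monotone c) (y : Equiv.Perm (Fin r)) :
    rep c (rep c y) = rep c y := eq_rep_of_intraInv hc (intraInv_rep hc y)

open Classical in
/-- `(stab c \ stab c₀)_min`: the minimal length representatives of right cosets. -/
noncomputable def minReps {κ : Type*} (c : Fin r → ι) (c₀ : Fin r → κ) :
    Finset (Equiv.Perm (Fin r)) :=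
  Finset.univ.filter fun y => y ∈ stab c₀ ∧ IsMinRep c y

theorem sum_minReps {κ : Type*} {M : Type*} [AddCommMonoid M]
    {c : Fin r → ι} {c₀ : Fin r → κ} (hc : Monotone c)
    (hle : stab c ≤ stab c₀) (F : Equiv.Perm (Fin r) → M) (hF : ∀ w ∈ stab c, ∀ y, F (w * y) = F y)
    {g : Equiv.Perm (Fin r)} (hg : g ∈ stab c₀) :
    ∑ y ∈ minReps c c₀, F (y * g) = ∑ y ∈ minReps c c₀, F y := by
  have hm : ∀ y, y ∈ minReps c c₀ ↔ y ∈ stab c₀ ∧ rep c y = y := by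
    intro y
    simp only [minReps, Finset.mem_filter, isMinRep_iff hc, Finset.mem_univ, true_and]
  have hmem : ∀ y ∈ stab c₀, rep c y ∈ stab c₀ := by
    intro y hy
    have := (stab c₀).mul_mem (hle (rep_mul_inv_mem hc y)) hy
    simpa using this
  have hrr : ∀ y g, rep c (rep c y * g) = rep c (y * g) := by
    intro y g
    have := rep_mul (rep_mul_inv_mem hc y) (y * g)
    rw [← this]; congr 1; group
  refine Finset.sum_nbij' (fun y => rep c (y * g)) (fun y => rep c (y * g⁻¹)) ?_ ?_ ?_ ?_ ?_
  · intro y hy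
    rw [hm] at hy ⊢
    exact ⟨hmem _ ((stab c₀).mul_mem hy.1 hg), rep_rep hc _⟩
  · intro y hy
    rw [hm] at hy ⊢
    exact ⟨hmem _ ((stab c₀).mul_mem hy.1 ((stab c₀).inv_mem hg)), rep_rep hc _⟩
  · intro y hy
    rw [hm] at hy
    simp only [hrr, mul_inv_cancel_right, hy.2]
  · intro y hy
    rw [hm] at hy
    simp only [hrr, inv_mul_cancel_right, hy.2]
  · intro y hy
    have := hF _ (rep_mul_inv_mem hc (y * g)) (y * g)
    rw [← this]; congr 1; group

/-- Young subgroups are generated by the adjacent transpositions that they contain. -/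
theorem stab_induction {c : Fin r → ι} (hc : Monotone c) (P : Equiv.Perm (Fin r) → Prop)
    (h1 : P 1)
    (hs : ∀ (p q : Fin r), (p : ℕ) + 1 = q → Equiv.swap p q ∈ stab c → ∀ w ∈ stab c,
      P w → P (w * Equiv.swap p q)) :
    ∀ w ∈ stab c, P w := by
  let m : Equiv.Perm (Fin r) → ℕ := fun w => ∑ p : Fin r, (p : ℕ) * (w p : ℕ)
  have hb : ∀ w, m w ≤ r * (r * r) := by
    intro w
    refine (Finset.sum_le_card_nsmul _ _ (r * r) fun p _ => ?_).trans (by simp)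
    exact Nat.mul_le_mul p.2.le (w p).2.le
  suffices H : ∀ N, ∀ w ∈ stab c, r * (r * r) - m w = N → P w from fun w hw => H _ w hw rfl
  intro N
  induction N using Nat.strong_induction_on with
  | _ N ih =>
    intro w hw hN
    by_cases hmono : ∀ p q : Fin r, (p : ℕ) + 1 = q → w p < w q
    · have hmon : StrictMono w := by
        rcases r with _ | r
        · intro p; exact p.elim0
        · rw [Fin.strictMono_iff_lt_succ]
          intro i
          exact hmono _ _ (by simp)
      have : w = 1 := by
        exact (Equiv.Perm.monotone_iff w).1 hmon.monotone
      rw [this]; exact h1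
    · push Not at hmono
      obtain ⟨p, q, hpq, hle⟩ := hmono
      have hpq' : p < q := by rw [Fin.lt_def]; omega
      have hlt : w q < w p := lt_of_le_of_ne hle fun h => hpq'.ne' (w.injective h)
      have hcpq : c p = c q := by
        apply le_antisymm (hc hpq'.le)
        have := hc hlt.le
        rwa [hw, hw] at this
      have hsw : Equiv.swap p q ∈ stab c := by
        intro x
        by_cases hx : x = p
        · subst hx; rw [Equiv.swap_apply_left]; exact hcpq.symm
        · by_cases hx' : x = q
          · subst hx'; rw [Equiv.swap_apply_right]; exact hcpq
          · rw [Equiv.swap_apply_of_ne_of_ne hx hx']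
      have hw' : w * Equiv.swap p q ∈ stab c := (stab c).mul_mem hw hsw
      have hmm : m w < m (w * Equiv.swap p q) := by
        have hS : ∀ v : Equiv.Perm (Fin r), m v = (p : ℕ) * (v p : ℕ) + ((q : ℕ) * (v q : ℕ) +
            ∑ x ∈ (Finset.univ.erase p).erase q, (x : ℕ) * (v x : ℕ)) := by
          intro v
          rw [Finset.add_sum_erase _ (fun x : Fin r => (x : ℕ) * (v x : ℕ))
            (by simp [hpq'.ne']), Finset.add_sum_erase _ (fun x : Fin r => (x : ℕ) * (v x : ℕ))
            (Finset.mem_univ p)]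
        rw [hS, hS]
        have : ∑ x ∈ (Finset.univ.erase p).erase q, (x : ℕ) * ((w * Equiv.swap p q) x : ℕ)
            = ∑ x ∈ (Finset.univ.erase p).erase q, (x : ℕ) * (w x : ℕ) := by
          refine Finset.sum_congr rfl fun x hx => ?_
          simp only [Finset.mem_erase, Finset.mem_univ, and_true] at hx
          rw [Equiv.Perm.mul_apply, Equiv.swap_apply_of_ne_of_ne hx.2 hx.1]
        rw [this]
        simp only [Equiv.Perm.mul_apply, Equiv.swap_apply_left, Equiv.swap_apply_right]
        rw [Fin.lt_def] at hlt
        rw [← hpq]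
        nlinarith
      have := ih _ (by have := hb (w * Equiv.swap p q); omega) _ hw' rfl
      have h2 := hs p q hpq hsw _ hw' this
      rwa [mul_assoc, Equiv.swap_mul_self, mul_one] at h2

end perm

end Comb
section AHsec
variable (k : Type*) [CommRing k] (r : ℕ)

/-- Generators of the degenerate affine Hecke algebra: `x_1, …, x_r` and the elements of `S_r`. -/
abbrev AHGen := Fin r ⊕ Equiv.Perm (Fin r)

/-- The relations of the degenerate affine Hecke algebra. The first two say that the elements of
the symmetric group multiply as in its group algebra; in the others `q = p + 1`, so that `swap p q`
is a basic transposition. -/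
inductive AHRel : FreeAlgebra k (AHGen r) → FreeAlgebra k (AHGen r) → Prop
  | one : AHRel (FreeAlgebra.ι k (Sum.inr 1)) 1
  | mul (v w : Equiv.Perm (Fin r)) :
      AHRel (FreeAlgebra.ι k (Sum.inr (v * w)))
        (FreeAlgebra.ι k (Sum.inr v) * FreeAlgebra.ι k (Sum.inr w))
  | comm (p q : Fin r) :
      AHRel (FreeAlgebra.ι k (Sum.inl p) * FreeAlgebra.ι k (Sum.inl q))
        (FreeAlgebra.ι k (Sum.inl q) * FreeAlgebra.ι k (Sum.inl p))
  | s_x (p q : Fin r) (h : (p : ℕ) + 1 = q) :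
      AHRel (FreeAlgebra.ι k (Sum.inr (Equiv.swap p q)) * FreeAlgebra.ι k (Sum.inl p))
        (FreeAlgebra.ι k (Sum.inl q) * FreeAlgebra.ι k (Sum.inr (Equiv.swap p q)) + 1)
  | x_s (p q : Fin r) (h : (p : ℕ) + 1 = q) :
      AHRel (FreeAlgebra.ι k (Sum.inl p) * FreeAlgebra.ι k (Sum.inr (Equiv.swap p q)))
        (FreeAlgebra.ι k (Sum.inr (Equiv.swap p q)) * FreeAlgebra.ι k (Sum.inl q) + 1)
  | far (p q m : Fin r) (h : (p : ℕ) + 1 = q) (hp : m ≠ p) (hq : m ≠ q) :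
      AHRel (FreeAlgebra.ι k (Sum.inl m) * FreeAlgebra.ι k (Sum.inr (Equiv.swap p q)))
        (FreeAlgebra.ι k (Sum.inr (Equiv.swap p q)) * FreeAlgebra.ι k (Sum.inl m))

/-- The degenerate affine Hecke algebra `AH_r`. -/
def AH := RingQuot (AHRel k r)

noncomputable instance : Ring (AH k r) := inferInstanceAs (Ring (RingQuot (AHRel k r)))
noncomputable instance : Algebra k (AH k r) := inferInstanceAs (Algebra k (RingQuot (AHRel k r)))

variable {k r}

noncomputable def AH.mk : FreeAlgebra k (AHGen r) →ₐ[k] AH k r := RingQuot.mkAlgHom k (AHRel k r)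

theorem AH.mk_rel {a b : FreeAlgebra k (AHGen r)} (h : AHRel k r a b) :
    (AH.mk a : AH k r) = AH.mk b := RingQuot.mkAlgHom_rel k h

/-- The generators `x_p`. -/
noncomputable def AH.x (p : Fin r) : AH k r := AH.mk (FreeAlgebra.ι k (Sum.inl p))

/-- The symmetric group in `AH_r`. -/
noncomputable def AH.perm : Equiv.Perm (Fin r) →* AH k r where
  toFun w := AH.mk (FreeAlgebra.ι k (Sum.inr w))
  map_one' := by rw [AH.mk_rel AHRel.one, map_one]
  map_mul' v w := by rw [AH.mk_rel (AHRel.mul v w), map_mul]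

theorem AH.x_comm (p q : Fin r) : (AH.x p * AH.x q : AH k r) = AH.x q * AH.x p := by
  simpa [AH.x] using AH.mk_rel (AHRel.comm (k := k) p q)

theorem AH.s_x {p q : Fin r} (h : (p : ℕ) + 1 = q) :
    (AH.perm (Equiv.swap p q) * AH.x p : AH k r) = AH.x q * AH.perm (Equiv.swap p q) + 1 := by
  simpa [AH.x, AH.perm] using AH.mk_rel (AHRel.s_x (k := k) p q h)

theorem AH.x_s {p q : Fin r} (h : (p : ℕ) + 1 = q) :
    (AH.x p * AH.perm (Equiv.swap p q) : AH k r) = AH.perm (Equiv.swap p q) * AH.x q + 1 := by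
  simpa [AH.x, AH.perm] using AH.mk_rel (AHRel.x_s (k := k) p q h)

theorem AH.far {p q m : Fin r} (h : (p : ℕ) + 1 = q) (hp : m ≠ p) (hq : m ≠ q) :
    (AH.x m * AH.perm (Equiv.swap p q) : AH k r) = AH.perm (Equiv.swap p q) * AH.x m := by
  simpa [AH.x, AH.perm] using AH.mk_rel (AHRel.far (k := k) p q m h hp hq)

theorem AH.range_comm : ∀ a ∈ Set.range (AH.x : Fin r → AH k r),
    ∀ b ∈ Set.range (AH.x : Fin r → AH k r), a * b = b * a := by
  rintro _ ⟨p, rfl⟩ _ ⟨q, rfl⟩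
  exact AH.x_comm p q

/-- The map `P_r = k[x_1, …, x_r] → AH_r`. -/
noncomputable def AH.poly : MvPolynomial (Fin r) k →ₐ[k] AH k r :=
  letI : CommRing (Algebra.adjoin k (Set.range (AH.x : Fin r → AH k r))) :=
    { (inferInstance : Ring (Algebra.adjoin k (Set.range (AH.x : Fin r → AH k r)))) with
      mul_comm := (Algebra.isMulCommutative_adjoin k AH.range_comm).is_comm.comm }
  (Algebra.adjoin k (Set.range (AH.x : Fin r → AH k r))).val.comp
    (MvPolynomial.aeval fun p => ⟨AH.x p, Algebra.subset_adjoin ⟨p, rfl⟩⟩)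

theorem AH.poly_X (p : Fin r) : AH.poly (MvPolynomial.X p) = (AH.x p : AH k r) := by
  simp [AH.poly]

/-- The action of `w ∈ S_r` on `P_r` with `w(x_p) = x_{w(p)}`. -/
noncomputable def permPoly (w : Equiv.Perm (Fin r)) :
    MvPolynomial (Fin r) k →ₐ[k] MvPolynomial (Fin r) k := MvPolynomial.rename w

theorem AH.demazure {p q : Fin r} (h : (p : ℕ) + 1 = q) (f : MvPolynomial (Fin r) k) :
    ∃ g : MvPolynomial (Fin r) k,
      (AH.perm (Equiv.swap p q) * AH.poly f : AH k r)
        = AH.poly (permPoly (Equiv.swap p q) f) * AH.perm (Equiv.swap p q) + AH.poly g ∧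
      (MvPolynomial.X p - MvPolynomial.X q) * g = f - permPoly (Equiv.swap p q) f := by
  induction f using MvPolynomial.induction_on with
  | C a =>
    refine ⟨0, ?_, ?_⟩
    · have : (MvPolynomial.C a : MvPolynomial (Fin r) k) = algebraMap k _ a := rfl
      rw [this, AlgHom.commutes, AlgHom.commutes, AlgHom.commutes, map_zero, add_zero]
      exact (Algebra.commutes _ _).symm
    · simp [permPoly]
  | add f1 f2 h1 h2 =>
    obtain ⟨g1, a1, b1⟩ := h1
    obtain ⟨g2, a2, b2⟩ := h2
    refine ⟨g1 + g2, ?_, ?_⟩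
    · simp only [map_add, mul_add, add_mul, a1, a2]; abel
    · rw [mul_add, b1, b2, map_add]; ring
  | mul_X f m hf =>
    obtain ⟨g1, a1, b1⟩ := hf
    have hX : ∃ g : MvPolynomial (Fin r) k,
      (AH.perm (Equiv.swap p q) * AH.poly (MvPolynomial.X m) : AH k r)
        = AH.poly (permPoly (Equiv.swap p q) (MvPolynomial.X m)) * AH.perm (Equiv.swap p q)
          + AH.poly g ∧
      (MvPolynomial.X p - MvPolynomial.X q) * g
        = MvPolynomial.X m - permPoly (Equiv.swap p q) (MvPolynomial.X m) := by
      simp only [permPoly, MvPolynomial.rename_X, AH.poly_X]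
      by_cases hp : m = p
      · subst hp
        refine ⟨1, ?_, ?_⟩
        · rw [Equiv.swap_apply_left, AH.s_x h, map_one]
        · simp
      by_cases hq : m = q
      · subst hq
        refine ⟨-1, ?_, ?_⟩
        · rw [Equiv.swap_apply_right, AH.x_s h, map_neg, map_one]; simp
        · simp
      · refine ⟨0, ?_, ?_⟩
        · rw [Equiv.swap_apply_of_ne_of_ne hp hq, AH.far h hp hq]; simp
        · rw [Equiv.swap_apply_of_ne_of_ne hp hq]; simp
    obtain ⟨g2, a2, b2⟩ := hX
    refine ⟨permPoly (Equiv.swap p q) f * g2 + g1 * MvPolynomial.X m, ?_, ?_⟩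
    · calc (AH.perm (Equiv.swap p q) * AH.poly (f * MvPolynomial.X m) : AH k r)
          = (AH.perm (Equiv.swap p q) * AH.poly f) * AH.poly (MvPolynomial.X m) := by
            rw [map_mul, mul_assoc]
        _ = AH.poly (permPoly (Equiv.swap p q) f) *
              (AH.perm (Equiv.swap p q) * AH.poly (MvPolynomial.X m))
              + AH.poly g1 * AH.poly (MvPolynomial.X m) := by
            rw [a1, add_mul, mul_assoc]
        _ = _ := by
            rw [a2]
            simp only [map_mul, map_add, mul_add, mul_assoc, add_assoc]
    · rw [map_mul]
      linear_combination (permPoly (Equiv.swap p q) f) * b2 + MvPolynomial.X m * b1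

theorem X_sub_X_mul_eq_zero {p q : Fin r} (h : p ≠ q) {g : MvPolynomial (Fin r) k}
    (hg : (MvPolynomial.X p - MvPolynomial.X q) * g = 0) : g = 0 := by
  let φ : MvPolynomial (Fin r) k →ₐ[k] MvPolynomial (Fin r) k :=
    MvPolynomial.aeval fun m => if m = p then MvPolynomial.X p + MvPolynomial.X q
      else MvPolynomial.X m
  let ψ : MvPolynomial (Fin r) k →ₐ[k] MvPolynomial (Fin r) k :=
    MvPolynomial.aeval fun m => if m = p then MvPolynomial.X p - MvPolynomial.X q
      else MvPolynomial.X m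
  have hφ : ψ.comp φ = AlgHom.id k _ := by
    ext m : 1
    by_cases hm : m = p
    · subst hm; simp [φ, ψ, h.symm]
    · simp [φ, ψ, hm]
  have h1 := congrArg φ hg
  rw [map_mul, map_zero, map_sub] at h1
  have h2 : φ (MvPolynomial.X p) - φ (MvPolynomial.X q) = MvPolynomial.X p := by
    simp [φ, h.symm]
  rw [h2] at h1
  replace h1 : φ g = 0 :=
    (MvPolynomial.isRegular_X (R := k) (n := p)).left (by simpa using h1)
  have := congrArg ψ h1
  rw [map_zero, ← AlgHom.comp_apply, hφ] at this
  exact this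

theorem AH.perm_comm_of_invariant {ι : Type*} [LinearOrder ι] {c : Fin r → ι} (hc : Monotone c)
    {f : MvPolynomial (Fin r) k} (hf : ∀ w ∈ stab c, permPoly w f = f) :
    ∀ w ∈ stab c, (AH.perm w * AH.poly f : AH k r) = AH.poly f * AH.perm w := by
  refine stab_induction hc _ ?_ ?_
  · simp
  · intro p q hpq hs w hw ih
    obtain ⟨g, h1, h2⟩ := AH.demazure hpq f
    rw [hf _ hs, sub_self] at h2
    rw [hf _ hs, X_sub_X_mul_eq_zero (by rintro rfl; omega) h2, map_zero, add_zero] at h1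
    rw [map_mul, mul_assoc, h1, ← mul_assoc, ih, mul_assoc]

end AHsec
section Yang
variable (k : Type*) [CommRing k] (n : ℕ)

/-- The elements `T_{i,j}^{(d)}` of the free algebra on `T_{i,j}^{(d)}` with `d ≥ 1`, including
`T_{i,j}^{(0)} = δ_{i,j}`. The generator `(i, j, d)` stands for `T_{i,j}^{(d+1)}`. -/
noncomputable def freeT (i j : Fin n) : ℕ → FreeAlgebra k (Fin n × Fin n × ℕ)
  | 0 => if i = j then 1 else 0
  | d + 1 => FreeAlgebra.ι k (i, j, d)

/-- The RTT relations. -/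
inductive YangianRel : FreeAlgebra k (Fin n × Fin n × ℕ) → FreeAlgebra k (Fin n × Fin n × ℕ) → Prop
  | rtt (i j p q : Fin n) (a b : ℕ) (ha : 1 ≤ a) (hb : 1 ≤ b) :
      YangianRel
        (freeT k n i j a * freeT k n p q b - freeT k n p q b * freeT k n i j a)
        (∑ c ∈ Finset.range (min a b),
          (freeT k n i q (a + b - 1 - c) * freeT k n p j c
            - freeT k n i q c * freeT k n p j (a + b - 1 - c)))

/-- The Yangian `Y(gl_n)`. -/
def Yangian := RingQuot (YangianRel k n)

noncomputable instance : Ring (Yangian k n) := inferInstanceAs (Ring (RingQuot (YangianRel k n)))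
noncomputable instance : Algebra k (Yangian k n) :=
  inferInstanceAs (Algebra k (RingQuot (YangianRel k n)))

variable {n}

/-- The RTT generators `T_{i,j}^{(d)}` of the Yangian, with `T_{i,j}^{(0)} = δ_{i,j}`. -/
noncomputable def Yangian.T (i j : Fin n) (d : ℕ) : Yangian k n :=
  RingQuot.mkAlgHom k (YangianRel k n) (freeT k n i j d)

variable {k}

/-- The homomorphism out of the Yangian defined by a sequence of matrices that satisfies the
RTT relations. -/
noncomputable def Yangian.lift {E : Type*} [Ring E] [Algebra k E]
    (t : ℕ → Matrix (Fin n) (Fin n) E) (ht : DiffRTT t) : Yangian k n →ₐ[k] E :=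
  RingQuot.liftAlgHom k ⟨FreeAlgebra.lift k fun g => t (g.2.2 + 1) g.1 g.2.1, by
    have hT : ∀ i j d, FreeAlgebra.lift k
        (fun g : Fin n × Fin n × ℕ => t (g.2.2 + 1) g.1 g.2.1) (freeT k n i j d) = t d i j := by
      intro i j d
      rcases d with _ | d
      · rw [freeT, ht.1, Matrix.one_apply]; split_ifs <;> simp
      · rw [freeT, FreeAlgebra.lift_ι_apply]
    rintro _ _ ⟨i, j, p, q, a, b, ha, hb⟩
    simp only [map_sub, map_mul, map_sum, hT]
    exact ht.mr a b i j p q⟩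

theorem Yangian.lift_T {E : Type*} [Ring E] [Algebra k E]
    (t : ℕ → Matrix (Fin n) (Fin n) E) (ht : DiffRTT t) (i j : Fin n) (d : ℕ) :
    Yangian.lift (k := k) t ht (Yangian.T k i j d) = t d i j := by
  refine (RingQuot.liftAlgHom_mkAlgHom_apply k _ _ _).trans ?_
  rcases d with _ | d
  · rw [freeT, ht.1, Matrix.one_apply]; split_ifs <;> simp
  · rw [freeT, FreeAlgebra.lift_ι_apply]

theorem Yangian.induction {P : Yangian k n → Prop} (hk : ∀ a : k, P (algebraMap k _ a))
    (hT : ∀ i j d, P (Yangian.T k i j d)) (hadd : ∀ a b, P a → P b → P (a + b))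
    (hmul : ∀ a b, P a → P b → P (a * b)) (y : Yangian k n) : P y := by
  obtain ⟨a, rfl⟩ := RingQuot.mkAlgHom_surjective k (YangianRel k n) y
  induction a using FreeAlgebra.induction with
  | grade0 c => rw [AlgHom.commutes]; exact hk c
  | grade1 g => exact hT g.1 g.2.1 (g.2.2 + 1)
  | mul a b ha hb => rw [map_mul]; exact hmul _ _ ha hb
  | add a b ha hb => rw [map_add]; exact hadd _ _ ha hb

end Yang

section Tens
open PowerSeries
variable (k : Type*) [CommRing k] (n r : ℕ)

/-- `V^{⊗ r} ⊗ AH_r`, where `V^{⊗ r}` is the free module on the monomials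
`v_i = v_{i_1} ⊗ ⋯ ⊗ v_{i_r}`: the tensor `∑ v_i ⊗ h_i` is the function `i ↦ h_i`. It is a right
module over `AH_r`, i.e. a module over the opposite ring. -/
abbrev TensorAH := (Fin r → Fin n) → AH k r

variable {k n r}

/-- The tensor `v_i ⊗ h`. -/
noncomputable def ten (i : Fin r → Fin n) (h : AH k r) : TensorAH k n r := Pi.single i h

variable (k n r)

/-- The kernel of `V^{⊗ r} ⊗ AH_r → V^{⊗ r} ⊗_{k S_r} AH_r`, spanned by the
`v_i w ⊗ h - v_i ⊗ w h`, where `w ∈ S_r` acts on tensors by `v_i w = v_{(i_{w(1)}, …, i_{w(r)})}`. -/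
noncomputable def balanced : Submodule (AH k r)ᵐᵒᵖ (TensorAH k n r) :=
  Submodule.span _ {φ | ∃ (i : Fin r → Fin n) (w : Equiv.Perm (Fin r)) (h : AH k r),
    φ = ten (i ∘ w) h - ten i (AH.perm w * h)}

/-- The induced tensor space `V^{⊗ r} ⊗_{k S_r} AH_r`. -/
abbrev InducedTensor := TensorAH k n r ⧸ balanced k n r

/-- The degenerate affine Schur algebra `AS(n, r)`. -/
abbrev AS := Module.End (AH k r)ᵐᵒᵖ (InducedTensor k n r)

/-- The endomorphism ring of `V^{⊗ r} ⊗ AH_r` as a right `AH_r`-module, which is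
`End(V)^{⊗ r} ⊗ AH_r`. -/
abbrev EndTensor := Module.End (AH k r)ᵐᵒᵖ (TensorAH k n r)


variable {k n r}

/-- Elements of `AH_r` acting by left multiplication on the factor `AH_r`. -/
noncomputable def lmul : AH k r →ₐ[k] EndTensor k n r where
  toFun a :=
    { toFun := fun φ i => a * φ i
      map_add' := fun φ ψ => by funext i; simp [mul_add]
      map_smul' := fun c φ => by funext i; simp [mul_assoc] }
  map_one' := by ext φ i; simp
  map_mul' a b := by ext φ i; simp [mul_assoc]
  map_zero' := by ext φ i; simp
  map_add' a b := by ext φ i; simp [add_mul]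
  commutes' c := by
    ext φ i
    simp [Algebra.algebraMap_eq_smul_one]

/-- The matrix unit `e_{i,j}` acting on the `p`th tensor position. -/
noncomputable def eOp (p : Fin r) (i j : Fin n) : EndTensor k n r where
  toFun φ := fun m => if m p = i then φ (Function.update m p j) else 0
  map_add' φ ψ := by funext m; simp only [Pi.add_apply]; split_ifs <;> simp
  map_smul' c φ := by funext m; simp only [Pi.smul_apply, RingHom.id_apply]; split_ifs <;> simp

theorem lmul_ten (a h : AH k r) (m : Fin r → Fin n) : lmul a (ten m h) = ten m (a * h) := by
  funext m'
  simp only [lmul, ten, AlgHom.coe_mk, RingHom.coe_mk, MonoidHom.coe_mk, OneHom.coe_mk,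
    LinearMap.coe_mk, AddHom.coe_mk, Pi.single_apply]
  split_ifs <;> simp

theorem eOp_ten (p : Fin r) (i j : Fin n) (m : Fin r → Fin n) (h : AH k r) :
    eOp p i j (ten m h) = if m p = j then ten (Function.update m p i) h else 0 := by
  funext m'
  simp only [eOp, ten, LinearMap.coe_mk, AddHom.coe_mk, Pi.single_apply]
  by_cases h1 : m' p = i
  · by_cases h2 : m p = j
    · rw [if_pos h1, if_pos h2, Pi.single_apply]
      congr 1
      rw [Function.update_eq_iff, eq_iff_iff, Function.eq_update_iff, h1, h2]
      simp
    · rw [if_pos h1, if_neg h2, if_neg]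
      · rfl
      · intro h3; apply h2; rw [← h3]; simp
  · rw [if_neg h1]
    split_ifs with h2
    · rw [Pi.single_apply, if_neg]
      intro h3; apply h1; rw [h3]; simp
    · rfl

theorem endTensor_ext {f g : EndTensor k n r} (h : ∀ m a, f (ten m a) = g (ten m a)) : f = g := by
  refine LinearMap.pi_ext ?_
  intro i x
  exact h i x

/-- The tensor flip of two positions, more generally the right action of `w` on `V^{⊗ r}`. -/
noncomputable def pOp (w : Equiv.Perm (Fin r)) : EndTensor k n r where
  toFun φ := fun m => φ (m ∘ (w⁻¹ : Equiv.Perm (Fin r)))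
  map_add' _ _ := rfl
  map_smul' _ _ := rfl

theorem pOp_ten (w : Equiv.Perm (Fin r)) (m : Fin r → Fin n) (h : AH k r) :
    pOp w (ten m h) = ten (m ∘ w) h := by
  funext m'
  simp only [pOp, ten, LinearMap.coe_mk, AddHom.coe_mk, Pi.single_apply]
  congr 1
  rw [eq_iff_iff]
  constructor
  · rintro rfl; funext x; simp
  · rintro rfl; funext x; simp

theorem lmul_eOp (a : AH k r) (p : Fin r) (i j : Fin n) :
    lmul a * eOp p i j = eOp p i j * lmul a := by
  refine endTensor_ext fun m h => ?_
  rw [Module.End.mul_apply, Module.End.mul_apply, lmul_ten, eOp_ten, eOp_ten]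
  split_ifs
  · rw [lmul_ten]
  · rw [map_zero]

theorem lmul_pOp (a : AH k r) (w : Equiv.Perm (Fin r)) :
    (lmul a * pOp w : EndTensor k n r) = pOp w * lmul a := by
  refine endTensor_ext fun m h => ?_
  rw [Module.End.mul_apply, Module.End.mul_apply, lmul_ten, pOp_ten, pOp_ten, lmul_ten]

theorem eOp_mul_eOp_same (p : Fin r) (i j l m : Fin n) :
    (eOp p i j * eOp p l m : EndTensor k n r) = if j = l then eOp p i m else 0 := by
  refine endTensor_ext fun x h => ?_
  rw [Module.End.mul_apply, eOp_ten]
  by_cases h1 : x p = m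
  · rw [if_pos h1, eOp_ten, Function.update_self]
    by_cases h2 : j = l
    · rw [if_pos h2.symm, if_pos h2, eOp_ten, if_pos h1, Function.update_idem]
    · rw [if_neg (Ne.symm h2), if_neg h2]; rfl
  · rw [if_neg h1, map_zero]
    split_ifs
    · rw [eOp_ten, if_neg h1]
    · rfl

theorem eOp_comm {p q : Fin r} (hpq : p ≠ q) (i j l m : Fin n) :
    (eOp p i j * eOp q l m : EndTensor k n r) = eOp q l m * eOp p i j := by
  refine endTensor_ext fun x h => ?_
  rw [Module.End.mul_apply, Module.End.mul_apply, eOp_ten, eOp_ten]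
  by_cases h1 : x p = j <;> by_cases h2 : x q = m
  · rw [if_pos h1, if_pos h2, eOp_ten, eOp_ten, Function.update_of_ne hpq,
      Function.update_of_ne hpq.symm, if_pos h1, if_pos h2, Function.update_comm hpq]
  · rw [if_pos h1, if_neg h2, eOp_ten, Function.update_of_ne hpq.symm, if_neg h2, map_zero]
  · rw [if_neg h1, if_pos h2, eOp_ten, Function.update_of_ne hpq, if_neg h1, map_zero]
  · rw [if_neg h1, if_neg h2, map_zero, map_zero]

theorem pOp_eOp (w : Equiv.Perm (Fin r)) (p : Fin r) (i j : Fin n) :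
    (pOp w * eOp (w p) i j : EndTensor k n r) = eOp p i j * pOp w := by
  refine endTensor_ext fun x h => ?_
  rw [Module.End.mul_apply, Module.End.mul_apply, pOp_ten, eOp_ten, eOp_ten]
  simp only [Function.comp_apply]
  split_ifs
  · rw [pOp_ten]
    congr 1
    funext y
    simp only [Function.comp_apply, Function.update_apply, EmbeddingLike.apply_eq_iff_eq]
  · rw [map_zero]

theorem sum_eOp_eOp {p q : Fin r} (hpq : p ≠ q) (i j : Fin n) :
    (∑ m, eOp p i m * eOp q m j : EndTensor k n r) = eOp p i j * pOp (Equiv.swap p q) := by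
  refine endTensor_ext fun x h => ?_
  rw [LinearMap.sum_apply, Module.End.mul_apply, pOp_ten, eOp_ten, Function.comp_apply,
    Equiv.swap_apply_left]
  have h1 : ∀ m, (eOp p i m * eOp q m j : EndTensor k n r) (ten x h)
      = if m = x p then (if x q = j then ten (Function.update (Function.update x q m) p i) h else 0)
        else 0 := by
    intro m
    rw [Module.End.mul_apply, eOp_ten]
    by_cases h1 : x q = j
    · rw [if_pos h1, if_pos h1, eOp_ten, Function.update_of_ne hpq]
      simp only [eq_comm]
    · rw [if_neg h1, if_neg h1, map_zero, ite_self]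
  rw [Finset.sum_congr rfl fun m _ => h1 m, Finset.sum_ite_eq' Finset.univ,
    if_pos (Finset.mem_univ _)]
  congr 2
  funext y
  simp only [Function.update_apply, Function.comp_apply]
  by_cases hy : y = p
  · rw [if_pos hy, if_pos hy]
  · rw [if_neg hy, if_neg hy]
    by_cases hy' : y = q
    · rw [if_pos hy', hy', Equiv.swap_apply_right]
    · rw [if_neg hy', Equiv.swap_apply_of_ne_of_ne hy hy']

variable (k n r)

/-- The operator `1 + Q^{[1,p+1]} / (u - x_p)`. -/
noncomputable def factor (p : Fin r) : Matrix (Fin n) (Fin n) (EndTensor k n r)⟦X⟧ :=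
  LOp (eOp p) (lmul (AH.x p))

/-- The product `(1 + Q^{[1,2]}/(u - x_1)) ⋯ (1 + Q^{[1,r+1]}/(u - x_r))`, as a matrix of power
series in `u⁻¹` with coefficients in `End(V)^{⊗ r} ⊗ AH_r`. -/
noncomputable def monodromy : Matrix (Fin n) (Fin n) (EndTensor k n r)⟦X⟧ :=
  (List.ofFn (factor k n r)).prod

variable {k n r}

theorem LOp_coeffCommute {E : Type*} [Ring E] {e e' : Fin n → Fin n → E} {x x' : E}
    (h1 : ∀ i j l m, Commute (e i j) (e' l m)) (h2 : ∀ i j, Commute (e i j) x')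
    (h3 : ∀ i j, Commute x (e' i j)) (h4 : Commute x x') (i j l m : Fin n) :
    CoeffCommute (LOp e x i j) (LOp e' x' l m) := by
  intro a b
  change Commute (coeffs (LOp e x) a i j) (coeffs (LOp e' x') b l m)
  have h0 : ∀ i j (z : E), Commute ((1 : Matrix (Fin n) (Fin n) E) i j) z := by
    intro i j z
    rw [Matrix.one_apply]; split_ifs
    · exact Commute.one_left z
    · exact Commute.zero_left z
  rcases a with _ | a
  · rw [coeffs_LOp_zero]; exact h0 _ _ _
  rcases b with _ | b
  · rw [coeffs_LOp_zero]; exact (h0 _ _ _).symm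
  rw [coeffs_LOp_succ, coeffs_LOp_succ]
  exact ((h1 _ _ _ _).mul_right ((h2 _ _).pow_right _)).mul_left
    (((h3 _ _).pow_left _).mul_right (h4.pow_pow _ _))

theorem monodromy_rtt : DiffRTT (coeffs (monodromy k n r)) := by
  have h0 : coeffs (monodromy k n r) 0 = 1 := by
    refine coeffs_zero_listProd _ ?_
    intro B hB
    obtain ⟨p, rfl⟩ := (List.mem_ofFn' _ _).1 hB
    exact coeffs_LOp_zero _ _
  rw [← seriesRTT_iff h0]
  refine SeriesRTT.listProd _ ?_ ?_
  · intro B hB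
    obtain ⟨p, rfl⟩ := (List.mem_ofFn' _ _).1 hB
    exact SeriesRTT.LOp (eOp_mul_eOp_same p) (fun i j => lmul_eOp _ p i j)
  · rw [List.pairwise_ofFn]
    intro p q hpq
    refine LOp_coeffCommute (fun i j l m => eOp_comm hpq.ne i j l m)
      (fun i j => (lmul_eOp _ p i j).symm) (fun i j => lmul_eOp _ q i j) ?_
    rw [commute_iff_eq, ← map_mul, ← map_mul, AH.x_comm]

variable (k n r)

/-- The homomorphism `Y(gl_n) → End(V)^{⊗ r} ⊗ AH_r` defined by the matrix `monodromy`. -/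
noncomputable def drinfeldTilde : Yangian k n →ₐ[k] EndTensor k n r :=
  Yangian.lift (coeffs (monodromy k n r)) monodromy_rtt

variable {k n r}

theorem invSub_eq {R : Type*} [Ring R] (x : R) : invSub x = X + C x * (X * invSub x) := by
  ext d
  rcases d with _ | d
  · simp [invSub]
  · rw [map_add, coeff_C_mul, coeff_succ_X_mul]
    rcases d with _ | d
    · simp [invSub]
    · simp only [invSub, coeff_succ_X_mul, coeff_mk, coeff_X, pow_succ']; simp

theorem invSub_eq' {R : Type*} [Ring R] (x : R) : invSub x = X + invSub x * (X * C x) := by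
  ext d
  rcases d with _ | d
  · simp [invSub]
  · rw [map_add, ← mul_assoc, coeff_mul_C, coeff_succ_mul_X]
    rcases d with _ | d
    · simp [invSub]
    · simp only [invSub, coeff_succ_X_mul, coeff_mk, coeff_X, pow_succ]; simp

/-- How a basic transposition moves past `1 / (u - x)`. -/
theorem s_invSub {R : Type*} [Ring R] {s a b : R} (h : s * a = b * s + 1) :
    C s * invSub a = invSub b * C s + invSub b * invSub a := by
  have h' : C s * C a = C b * C s + 1 := by rw [← map_mul, h]; simp
  have ea := invSub_eq a
  have eb := invSub_eq' b
  have hX : ∀ f : R⟦X⟧, X * f = f * X := fun f => X_mul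
  apply X_mul_cancel
  have key : invSub b * (C s * C a - C b * C s - 1) * invSub a * X = 0 := by
    rw [h']; simp
  have e1 : C a * invSub a * X = invSub a - X := by
    rw [mul_assoc, ← hX]
    nth_rewrite 2 [ea]
    simp
  have e2 : invSub b * C b * X = invSub b - X := by
    nth_rewrite 2 [eb]
    rw [hX (C b), ← mul_assoc]; simp
  have e3 : invSub b * C s * (C a * invSub a * X) - (invSub b * C b * X) * C s * invSub a
      - X * (invSub b * invSub a) = 0 := by
    rw [← key, mul_assoc (invSub b * C b), hX (C s), hX (invSub b * invSub a),
      mul_assoc (invSub b * C b), mul_assoc (C s), hX (invSub a)]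
    noncomm_ring
  rw [e1, e2] at e3
  rw [← sub_eq_zero, ← e3, mul_add X, hX (invSub b * C s)]
  noncomm_ring

/-- The computation behind the compatibility of two adjacent factors with the symmetric group. -/
theorem local_aux {R : Type*} [Ring R] {P s Q1 Q2 y1 y2 : R}
    (hy : y1 * y2 = y2 * y1) (_h11 : y1 * Q1 = Q1 * y1) (h12 : y1 * Q2 = Q2 * y1)
    (_h22 : y2 * Q2 = Q2 * y2) (hPy1 : y1 * P = P * y1) (hPy2 : y2 * P = P * y2)
    (hPP : P * P = 1) (hPQ : P * Q2 = Q1 * P) (hPQ' : P * Q1 = Q2 * P) (hQQ : Q1 * Q2 = Q1 * P)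
    (hs1 : s * Q1 = Q1 * s) (hs2 : s * Q2 = Q2 * s)
    (hsy : y1 * s = s * y2 + y1 * y2) (hsy' : y2 * s = s * y1 - y2 * y1) :
    (1 + Q1 * y1) * (1 + Q2 * y2) * (P - s)
      = (P - s) * (1 + Q2 * y1 + Q1 * y2 + Q1 * Q2 * (y1 * y2)) := by
  have hyys : y1 * y2 * s = s * (y1 * y2) := by
    rw [mul_assoc, hsy', mul_sub, ← mul_assoc, hsy, ← hy]
    simp only [add_mul, mul_assoc, hy]
    rw [← mul_assoc y1 y2 y1, hy, mul_assoc]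
    abel
  have e0 : (1 + Q1 * y1) * (1 + Q2 * y2) = 1 + Q1 * y1 + Q2 * y2 + Q1 * Q2 * (y1 * y2) := by
    have : Q1 * y1 * (Q2 * y2) = Q1 * Q2 * (y1 * y2) := by
      rw [mul_assoc, ← mul_assoc y1, h12]; simp only [mul_assoc]
    rw [mul_add, add_mul, add_mul, this]; simp only [mul_one, one_mul]; abel
  have e1 : Q1 * y1 * P = P * (Q2 * y1) := by
    rw [mul_assoc, hPy1, ← mul_assoc, ← hPQ, mul_assoc]
  have e2 : Q2 * y2 * P = P * (Q1 * y2) := by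
    rw [mul_assoc, hPy2, ← mul_assoc, ← hPQ', mul_assoc]
  have e3 : Q1 * Q2 * (y1 * y2) * P = Q1 * (y1 * y2) := by
    rw [hQQ, mul_assoc, mul_assoc y1, hPy2, ← mul_assoc y1, hPy1, mul_assoc P, mul_assoc,
      ← mul_assoc P, hPP, one_mul]
  have e4 : P * (Q1 * Q2 * (y1 * y2)) = Q2 * (y1 * y2) := by
    rw [hQQ, ← mul_assoc P, ← mul_assoc P, hPQ', mul_assoc Q2, hPP, mul_one]
  have f1 : Q1 * y1 * s = s * (Q1 * y2) + Q1 * (y1 * y2) := by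
    rw [mul_assoc, hsy, mul_add, ← mul_assoc, ← hs1, mul_assoc]
  have f2 : Q2 * y2 * s = s * (Q2 * y1) - Q2 * (y1 * y2) := by
    rw [mul_assoc, hsy', mul_sub, ← mul_assoc, ← hs2, mul_assoc, hy]
  have f3 : Q1 * Q2 * (y1 * y2) * s = s * (Q1 * Q2 * (y1 * y2)) := by
    rw [mul_assoc, hyys, ← mul_assoc, mul_assoc Q1, ← hs2, ← mul_assoc Q1, ← hs1]
    simp only [mul_assoc]
  rw [e0, mul_sub]
  simp only [add_mul, sub_mul, mul_add, e1, e2, e3, e4, f1, f2, f3, one_mul, mul_one]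
  abel

theorem invSub_lmul_comm {R : Type*} [Ring R] {a b : R} (h : a * b = b * a) :
    invSub a * invSub b = invSub b * invSub a := by
  have hc : ∀ c d, Commute (coeff c (invSub a)) (coeff d (invSub b)) := by
    intro c d
    rcases c with _ | c
    · simp [invSub]
    rcases d with _ | d
    · simp [invSub]
    simp only [invSub, coeff_succ_X_mul, coeff_mk]
    exact Commute.pow_pow h c d
  ext m
  rw [coeff_mul, coeff_mul, ← Finset.Nat.sum_antidiagonal_swap]
  exact Finset.sum_congr rfl fun p _ => (hc _ _).eq

theorem invSub_C_comm {R : Type*} [Ring R] {a b : R} (h : a * b = b * a) :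
    invSub a * C b = C b * invSub a := by
  ext m
  rw [coeff_mul_C, coeff_C_mul]
  rcases m with _ | m
  · simp [invSub]
  · simp only [invSub, coeff_succ_X_mul, coeff_mk]
    exact (Commute.pow_left h m).eq

/-- The operator `v_i ⊗ h ↦ v_i s ⊗ h - v_i ⊗ s h` for `s = swap p q` -/
noncomputable def defect (p q : Fin r) : EndTensor k n r :=
  pOp (Equiv.swap p q) - lmul (AH.perm (Equiv.swap p q))

theorem LOp_eq {E : Type*} [Ring E] (e : Fin n → Fin n → E) (x : E) :
    LOp e x = 1 + (Matrix.of fun i j => C (e i j)) * Matrix.scalar (Fin n) (invSub x) := by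
  ext1 i j
  simp [LOp, Matrix.one_apply, Matrix.scalar_apply, Matrix.mul_diagonal]

theorem of_scalar_comm {R : Type*} [Ring R] {M N : Matrix (Fin n) (Fin n) R} {a : R}
    (h : ∀ i j, a * M i j = N i j * a) :
    Matrix.scalar (Fin n) a * M = N * Matrix.scalar (Fin n) a := by
  ext1 i j
  simp [Matrix.scalar_apply, h]

theorem s_invSub_neg {R : Type*} [Ring R] {s a b : R} (h : a * s = s * b + 1) :
    invSub a * C s = C s * invSub b + invSub a * invSub b := by
  have h1 : -s * b = a * -s + 1 := by rw [neg_mul, mul_neg, h]; abel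
  have h2 := s_invSub h1
  rw [map_neg, neg_mul, mul_neg] at h2
  rw [← sub_eq_zero] at h2 ⊢
  rw [← h2]; abel

theorem defect_local {p q : Fin r} (hpq : (p : ℕ) + 1 = q) :
    ∃ Y, factor k n r p * factor k n r q * Matrix.scalar (Fin n) (C (defect p q))
      = Matrix.scalar (Fin n) (C (defect p q)) * Y := by
  have hne : p ≠ q := by rintro rfl; omega
  set S : EndTensor k n r := lmul (AH.perm (Equiv.swap p q)) with hS
  set P : EndTensor k n r := pOp (Equiv.swap p q) with hP
  have hPP : P * P = 1 := by
    refine endTensor_ext fun m h => ?_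
    rw [Module.End.mul_apply, hP, pOp_ten, pOp_ten, Module.End.one_apply]
    congr 1
    funext x
    simp
  have hd : C (defect p q) = C P - C S := by rw [defect, map_sub]
  have hxP : ∀ m : Fin r, lmul (AH.x m) * P = P * lmul (AH.x m) := fun m => lmul_pOp _ _
  have hsx : S * lmul (AH.x p) = lmul (AH.x q) * S + 1 := by
    rw [hS, ← map_mul, AH.s_x hpq, map_add, map_mul, map_one]
  have hsx' : lmul (AH.x p) * S = S * lmul (AH.x q) + 1 := by
    rw [hS, ← map_mul, AH.x_s hpq, map_add, map_mul, map_one]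
  have hsy := s_invSub hsx
  have hsy' := s_invSub_neg hsx'
  have hPe : ∀ i j, P * eOp p i j = eOp q i j * P := by
    intro i j
    have := pOp_eOp (k := k) (Equiv.swap p q) q i j
    rwa [Equiv.swap_apply_right] at this
  have hPe' : ∀ i j, P * eOp q i j = eOp p i j * P := by
    intro i j
    have := pOp_eOp (k := k) (Equiv.swap p q) p i j
    rwa [Equiv.swap_apply_left] at this
  rw [factor, factor, LOp_eq, LOp_eq, hd, map_sub]
  refine ⟨_, local_aux ?_ ?_ ?_ ?_ ?_ ?_ ?_ ?_ ?_ ?_ ?_ ?_ ?_ ?_⟩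
  · rw [← map_mul, ← map_mul, invSub_lmul_comm]
    rw [← map_mul, ← map_mul, AH.x_comm]
  · exact of_scalar_comm fun i j => invSub_C_comm (lmul_eOp _ _ _ _)
  · exact of_scalar_comm fun i j => invSub_C_comm (lmul_eOp _ _ _ _)
  · exact of_scalar_comm fun i j => invSub_C_comm (lmul_eOp _ _ _ _)
  · rw [← map_mul, ← map_mul, invSub_C_comm (hxP _)]
  · rw [← map_mul, ← map_mul, invSub_C_comm (hxP _)]
  · rw [← map_mul, ← map_mul, hPP, map_one, map_one]
  · refine of_scalar_comm fun i j => ?_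
    rw [Matrix.of_apply, Matrix.of_apply, ← map_mul, hPe', map_mul]
  · refine of_scalar_comm fun i j => ?_
    rw [Matrix.of_apply, Matrix.of_apply, ← map_mul, hPe, map_mul]
  · ext1 i j
    rw [Matrix.mul_apply, Matrix.scalar_apply, Matrix.mul_diagonal]
    simp only [Matrix.of_apply, ← map_mul, ← map_sum]
    rw [sum_eOp_eOp hne]
  · refine of_scalar_comm fun i j => ?_
    rw [Matrix.of_apply, ← map_mul, ← map_mul, hS, lmul_eOp]
  · refine of_scalar_comm fun i j => ?_
    rw [Matrix.of_apply, ← map_mul, ← map_mul, hS, lmul_eOp]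
  · rw [← map_mul, ← map_mul, ← map_mul, ← map_add, hsy']
  · rw [← map_mul, ← map_mul, ← map_mul, ← map_sub, hsy, add_sub_cancel_right]

theorem defect_far {p q m : Fin r} (hpq : (p : ℕ) + 1 = q) (hp : m ≠ p) (hq : m ≠ q) :
    factor k n r m * Matrix.scalar (Fin n) (C (defect p q))
      = Matrix.scalar (Fin n) (C (defect p q)) * factor k n r m := by
  have h1 : ∀ i j, defect p q * eOp m i j = eOp m i j * (defect p q : EndTensor k n r) := by
    intro i j
    have := pOp_eOp (k := k) (Equiv.swap p q) m i j
    rw [Equiv.swap_apply_of_ne_of_ne hp hq] at this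
    rw [defect, sub_mul, mul_sub, this, lmul_eOp]
  have h2 : lmul (AH.x m) * defect p q = (defect p q : EndTensor k n r) * lmul (AH.x m) := by
    rw [defect, sub_mul, mul_sub, lmul_pOp, ← map_mul, ← map_mul, AH.far hpq hp hq]
  symm
  rw [factor]
  refine of_scalar_comm fun i j => ?_
  have h3 := invSub_C_comm h2
  rw [LOp, mul_add, add_mul, mul_assoc, h3, ← mul_assoc, ← mul_assoc, ← map_mul, ← map_mul, h1]
  congr 1
  split_ifs <;> simp

theorem list_comm_prod {R : Type*} [Monoid R] {d : R} (L : List R) (h : ∀ B ∈ L, B * d = d * B) :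
    L.prod * d = d * L.prod := by
  induction L with
  | nil => simp
  | cons B L ih =>
    rw [List.prod_cons, mul_assoc, ih fun B hB => h B (by simp [hB]), ← mul_assoc,
      h B (by simp), mul_assoc]

theorem defect_monodromy {p q : Fin r} (hpq : (p : ℕ) + 1 = q) :
    ∃ Y, monodromy k n r * Matrix.scalar (Fin n) (C (defect p q))
      = Matrix.scalar (Fin n) (C (defect p q)) * Y := by
  set d := Matrix.scalar (Fin n) (C (defect p q : EndTensor k n r)) with hd
  set L := List.ofFn (factor k n r) with hL
  have hlen : L.length = r := by rw [hL, List.length_ofFn]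
  have hp : (p : ℕ) < L.length := by rw [hlen]; exact p.2
  have hq : (p : ℕ) + 1 < L.length := by rw [hlen, hpq]; exact q.2
  have hsplit : L = L.take p ++ factor k n r p :: factor k n r q :: L.drop (p + 2) := by
    have g1 : L[(p : ℕ)] = factor k n r p := by simp only [hL, List.getElem_ofFn]
    have g2 : L[(p : ℕ) + 1] = factor k n r q := by simp only [hL, List.getElem_ofFn, hpq]
    conv_lhs => rw [← List.take_append_drop p L, List.drop_eq_getElem_cons hp,
      List.drop_eq_getElem_cons hq, g1, g2]
  obtain ⟨Y, hY⟩ := defect_local (k := k) (n := n) hpq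
  rw [← hd] at hY
  have h1 : (L.take p).prod * d = d * (L.take p).prod := by
    refine list_comm_prod _ fun B hB => ?_
    obtain ⟨m, hm, rfl⟩ := List.mem_take_iff_getElem.1 hB
    simp only [hL, List.getElem_ofFn]
    refine defect_far hpq ?_ ?_ <;> rw [Ne, Fin.ext_iff] <;> simp only [] <;> omega
  have h2 : (L.drop (p + 2)).prod * d = d * (L.drop (p + 2)).prod := by
    refine list_comm_prod _ fun B hB => ?_
    obtain ⟨m, hm, rfl⟩ := List.mem_drop_iff_getElem.1 hB
    simp only [hL, List.getElem_ofFn]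
    refine defect_far hpq ?_ ?_ <;> rw [Ne, Fin.ext_iff] <;> simp only [] <;> omega
  refine ⟨(L.take p).prod * (Y * (L.drop (p + 2)).prod), ?_⟩
  have hprod : L.prod = (L.take p).prod *
      (factor k n r p * (factor k n r q * (L.drop (p + 2)).prod)) := by
    conv_lhs => rw [hsplit, List.prod_append, List.prod_cons, List.prod_cons]
  rw [monodromy, ← hL, hprod]
  calc (L.take p).prod * (factor k n r p * (factor k n r q * (L.drop (p + 2)).prod)) * d
      = (L.take p).prod * (factor k n r p * factor k n r q * ((L.drop (p + 2)).prod * d)) := by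
        simp only [mul_assoc]
    _ = (L.take p).prod * ((factor k n r p * factor k n r q * d) * (L.drop (p + 2)).prod) := by
        rw [h2]; simp only [mul_assoc]
    _ = ((L.take p).prod * d) * (Y * (L.drop (p + 2)).prod) := by
        rw [hY]; simp only [mul_assoc]
    _ = _ := by rw [h1]; simp only [mul_assoc]

theorem ten_sub_mem (i : Fin r → Fin n) (w : Equiv.Perm (Fin r)) (h : AH k r) :
    ten (i ∘ w) h - ten i (AH.perm w * h) ∈ balanced k n r :=
  Submodule.subset_span ⟨i, w, h, rfl⟩

theorem sum_ten (φ : TensorAH k n r) : φ = ∑ i, ten i (φ i) := by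
  classical
  exact (Finset.univ_sum_single φ).symm

theorem defect_mem (p q : Fin r) (φ : TensorAH k n r) : defect p q φ ∈ balanced k n r := by
  rw [sum_ten φ, map_sum]
  refine Submodule.sum_mem _ fun i _ => ?_
  rw [defect, LinearMap.sub_apply, pOp_ten, lmul_ten]
  exact ten_sub_mem i _ _

/-- The coefficients of the monodromy matrix preserve the kernel of
`V^{⊗ r} ⊗ AH_r → V^{⊗ r} ⊗_{k S_r} AH_r`. -/
theorem monodromy_preserves (i j : Fin n) (d : ℕ) :
    balanced k n r ≤ (balanced k n r).comap (coeffs (monodromy k n r) d i j) := by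
  have hdef : ∀ (p q : Fin r), (p : ℕ) + 1 = q → ∀ φ : TensorAH k n r,
      coeffs (monodromy k n r) d i j (defect p q φ) ∈ balanced k n r := by
    intro p q hpq φ
    obtain ⟨Y, hY⟩ := defect_monodromy (k := k) (n := n) hpq
    have h1 := congrArg (fun M => coeff d (M i j)) hY
    simp only [Matrix.scalar_apply, Matrix.mul_diagonal, Matrix.diagonal_mul, coeff_mul_C,
      coeff_C_mul] at h1
    have h2 := congrArg (fun f => f φ) h1
    simp only [Module.End.mul_apply] at h2
    rw [coeffs, h2]
    exact defect_mem p q _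
  have key : ∀ w : Equiv.Perm (Fin r), ∀ (m : Fin r → Fin n) (h : AH k r),
      coeffs (monodromy k n r) d i j (ten (m ∘ w) h - ten m (AH.perm w * h)) ∈ balanced k n r := by
    intro w
    refine stab_induction (c := fun _ : Fin r => (0 : ℕ)) (fun _ _ _ => le_rfl)
      (fun w => ∀ (m : Fin r → Fin n) (h : AH k r),
        coeffs (monodromy k n r) d i j (ten (m ∘ w) h - ten m (AH.perm w * h)) ∈ balanced k n r)
      ?_ ?_ w (fun _ => rfl)
    · intro m h
      have : ten (m ∘ (1 : Equiv.Perm (Fin r))) h - ten m (AH.perm 1 * h) = 0 := by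
        rw [map_one, one_mul, sub_eq_zero]; rfl
      rw [this, map_zero]; exact Submodule.zero_mem _
    · intro p q hpq _ w _ ih m h
      have e : ten (m ∘ (w * Equiv.swap p q : Equiv.Perm (Fin r))) h
          - ten m (AH.perm (w * Equiv.swap p q) * h)
          = defect p q (ten (m ∘ w) h)
            + (ten (m ∘ w) (AH.perm (Equiv.swap p q) * h)
                - ten m (AH.perm w * (AH.perm (Equiv.swap p q) * h))) := by
        rw [defect, LinearMap.sub_apply, pOp_ten, lmul_ten, map_mul, mul_assoc]
        simp only [Equiv.Perm.coe_mul, Function.comp_assoc]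
        abel
      rw [e, map_add]
      exact Submodule.add_mem _ (hdef p q hpq _) (ih _ _)
  rw [balanced, Submodule.span_le]
  rintro _ ⟨m, w, h, rfl⟩
  exact key w m h

variable (k n r)

/-- The endomorphisms of `V^{⊗ r} ⊗ AH_r` that induce an endomorphism of
`V^{⊗ r} ⊗_{k S_r} AH_r`. -/
def preserving : Subalgebra k (EndTensor k n r) where
  carrier := {f | balanced k n r ≤ (balanced k n r).comap f}
  mul_mem' := fun {f g} hf hg x hx => hf (hg hx)
  add_mem' := fun {f g} hf hg x hx =>
    show f x + g x ∈ balanced k n r from Submodule.add_mem _ (hf hx) (hg hx)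
  algebraMap_mem' := fun a x hx => by
    rw [Submodule.mem_comap, Module.algebraMap_end_apply]
    have : a • x = (MulOpposite.op (algebraMap k (AH k r) a)) • x := by
      funext i
      simp [Algebra.smul_def, Algebra.commutes]
    rw [this]
    exact Submodule.smul_mem _ _ hx

/-- The induced endomorphism of `V^{⊗ r} ⊗_{k S_r} AH_r`. -/
noncomputable def induced : preserving k n r →ₐ[k] AS k n r where
  toFun f := (balanced k n r).mapQ (balanced k n r) f.1 (show balanced k n r ≤ _ from f.2)
  map_one' := by ext; rfl
  map_mul' f g := by ext; rfl
  map_zero' := by ext; rfl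
  map_add' f g := by ext; rfl
  commutes' a := by ext; rfl

theorem drinfeldTilde_mem (y : Yangian k n) : drinfeldTilde k n r y ∈ preserving k n r := by
  induction y using Yangian.induction with
  | hk a => rw [AlgHom.commutes]; exact (preserving k n r).algebraMap_mem a
  | hT i j d => rw [drinfeldTilde, Yangian.lift_T (k := k)]; exact monodromy_preserves i j d
  | hadd a b ha hb => rw [map_add]; exact (preserving k n r).add_mem ha hb
  | hmul a b ha hb => rw [map_mul]; exact (preserving k n r).mul_mem ha hb

/-- The Drinfeld homomorphism `D_{n,r} : Y(gl_n) → AS(n, r)`, i.e. the action of `Y(gl_n)` on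
`V^{⊗ r} ⊗_{k S_r} AH_r` induced by its action on `V^{⊗ r} ⊗ AH_r`. -/
noncomputable def drinfeld : Yangian k n →ₐ[k] AS k n r :=
  (induced k n r).comp ((drinfeldTilde k n r).codRestrict (preserving k n r)
    (drinfeldTilde_mem k n r))

end Tens

section Schur
variable {k : Type*} [CommRing k] {n r : ℕ}

/-- The row sums of a matrix. -/
def rowSum (A : Matrix (Fin n) (Fin n) ℕ) (i : Fin n) : ℕ := ∑ j, A i j

/-- The column sums of a matrix. -/
def colSum (A : Matrix (Fin n) (Fin n) ℕ) (j : Fin n) : ℕ := ∑ i, A i j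

theorem sum_rowSum {A : Matrix (Fin n) (Fin n) ℕ} (hA : ∑ i, ∑ j, A i j = r) :
    ∑ i, rowSum A i = r := hA

theorem sum_colSum {A : Matrix (Fin n) (Fin n) ℕ} (hA : ∑ i, ∑ j, A i j = r) :
    ∑ j, colSum A j = r := by
  rw [← hA]
  exact Finset.sum_comm' (by simp)

theorem sum_entries {A : Matrix (Fin n) (Fin n) ℕ} (hA : ∑ i, ∑ j, A i j = r) :
    ∑ x : Fin n ×ₗ Fin n, A (ofLex x).2 (ofLex x).1 = r := by
  rw [← sum_colSum hA]
  exact Fintype.sum_prod_type' (fun j i => A i j)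

/-- The propagating strings of the double coset diagram of `A`, seen from the bottom. At the bottom
of the diagram there are `r` parallel thin strings; `p` belongs to the propagating string of
thickness `A i j` for `(j, i) = colBlock A hA p`. These blocks come in the lexicographic order of
`(j, i)`, i.e. their sizes are the entries of `A` read down the columns, starting with the leftmost
column. So `stab (colBlock A hA)` is the parabolic subgroup `S_{μ(A)}`. -/
def colBlock (A : Matrix (Fin n) (Fin n) ℕ) (hA : ∑ i, ∑ j, A i j = r) :
    Fin r → Fin n ×ₗ Fin n :=
  blockLabel (fun x => A (ofLex x).2 (ofLex x).1) (sum_entries hA)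

/-- The pair `(i, j)` if `p` belongs to the propagating string of thickness `A i j`. -/
def rowKey (A : Matrix (Fin n) (Fin n) ℕ) (hA : ∑ i, ∑ j, A i j = r) (p : Fin r) :
    Fin n ×ₗ Fin n :=
  toLex ((ofLex (colBlock A hA p)).2, (ofLex (colBlock A hA p)).1)

/-- The minimal length double coset representative `d_A`. It sends the position of a thin string at
the bottom of the double coset diagram of `A` to its position at the top, where the propagating
strings come in the lexicographic order of `(i, j)`, and the thin strings of one propagating string
stay parallel. (`Tuple.sort` is the stable sort.) -/
def dA (A : Matrix (Fin n) (Fin n) ℕ) (hA : ∑ i, ∑ j, A i j = r) : Equiv.Perm (Fin r) :=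
  (Tuple.sort (rowKey A hA))⁻¹

theorem colBlock_mono (A : Matrix (Fin n) (Fin n) ℕ) (hA : ∑ i, ∑ j, A i j = r) :
    Monotone (colBlock A hA) := blockLabel_mono _

theorem card_colBlock (A : Matrix (Fin n) (Fin n) ℕ) (hA : ∑ i, ∑ j, A i j = r) (i j : Fin n) :
    (Finset.univ.filter fun p => colBlock A hA p = toLex (j, i)).card = A i j :=
  card_blockLabel (sum_entries hA) (toLex (j, i))

theorem col_colBlock (A : Matrix (Fin n) (Fin n) ℕ) (hA : ∑ i, ∑ j, A i j = r) :
    (fun p => (ofLex (colBlock A hA p)).1) = blockLabel (colSum A) (sum_colSum hA) := by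
  refine eq_blockLabel _ ?_ ?_
  · intro p q hpq
    exact Prod.Lex.monotone_fst _ _ (colBlock_mono A hA hpq)
  · intro j
    rw [colSum, Finset.card_eq_sum_card_fiberwise (f := fun p => (ofLex (colBlock A hA p)).2)
      (t := Finset.univ) (by intro p _; simp)]
    refine Finset.sum_congr rfl fun i _ => ?_
    rw [← card_colBlock A hA i j, Finset.filter_filter]
    congr 1
    ext p
    simp only [Finset.mem_filter, Finset.mem_univ, true_and]
    rw [← ofLex_inj (b := toLex (j, i)), Prod.ext_iff]
    rfl

theorem row_dA (A : Matrix (Fin n) (Fin n) ℕ) (hA : ∑ i, ∑ j, A i j = r) (p : Fin r) :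
    blockLabel (rowSum A) (sum_rowSum hA) (dA A hA p) = (ofLex (colBlock A hA p)).2 := by
  have h : (fun q => (ofLex (rowKey A hA (Tuple.sort (rowKey A hA) q))).1)
      = blockLabel (rowSum A) (sum_rowSum hA) := by
    refine eq_blockLabel _ ?_ ?_
    · intro p q hpq
      exact Prod.Lex.monotone_fst _ _ (Tuple.monotone_sort (rowKey A hA) hpq)
    · intro i
      have h1 : (Finset.univ.filter fun q =>
            (ofLex (rowKey A hA (Tuple.sort (rowKey A hA) q))).1 = i).card
          = (Finset.univ.filter fun q => (ofLex (colBlock A hA q)).2 = i).card :=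
        Finset.card_equiv (Tuple.sort (rowKey A hA)) (by intro q; simp only [Finset.mem_filter, Finset.mem_univ, true_and]; rfl)
      rw [h1, rowSum, Finset.card_eq_sum_card_fiberwise
        (f := fun p => (ofLex (colBlock A hA p)).1) (t := Finset.univ) (by intro p _; simp)]
      refine Finset.sum_congr rfl fun j _ => ?_
      rw [← card_colBlock A hA i j, Finset.filter_filter]
      congr 1
      ext p
      simp only [Finset.mem_filter, Finset.mem_univ, true_and]
      rw [← ofLex_inj (b := toLex (j, i)), Prod.ext_iff, and_comm]
      rfl
  rw [← h, dA]
  change (ofLex (rowKey A hA (Tuple.sort (rowKey A hA) ((Tuple.sort (rowKey A hA))⁻¹ p)))).1 = _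
  rw [perm_apply_inv]
  rfl

theorem stab_colBlock_le (A : Matrix (Fin n) (Fin n) ℕ) (hA : ∑ i, ∑ j, A i j = r) :
    stab (colBlock A hA) ≤ stab (blockLabel (colSum A) (sum_colSum hA)) := by
  intro w hw p
  rw [← col_colBlock A hA]
  simp only [hw p]

theorem row_dA_mul (A : Matrix (Fin n) (Fin n) ℕ) (hA : ∑ i, ∑ j, A i j = r)
    {w : Equiv.Perm (Fin r)} (hw : w ∈ stab (colBlock A hA)) :
    blockLabel (rowSum A) (sum_rowSum hA) ∘ (dA A hA * w : Equiv.Perm (Fin r))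
      = blockLabel (rowSum A) (sum_rowSum hA) ∘ dA A hA := by
  funext p
  rw [Function.comp_apply, Function.comp_apply, Equiv.Perm.mul_apply, row_dA, row_dA, hw p]

/-- The projection `v_i ⊗ h ↦ v_i ⊗ h` from `V^{⊗ r} ⊗ AH_r` to `V^{⊗ r} ⊗_{k S_r} AH_r`. -/
noncomputable def bten (i : Fin r → Fin n) (h : AH k r) : InducedTensor k n r :=
  (balanced k n r).mkQ (ten i h)

theorem bten_comp (i : Fin r → Fin n) (w : Equiv.Perm (Fin r)) (h : AH k r) :
    bten (i ∘ w) h = bten i (AH.perm w * h) := by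
  rw [bten, bten, ← sub_eq_zero, ← map_sub, Submodule.mkQ_apply, Submodule.Quotient.mk_eq_zero]
  exact ten_sub_mem i w h

theorem op_smul_bten (a : AH k r) (i : Fin r → Fin n) (h : AH k r) :
    MulOpposite.op a • bten i h = bten i (h * a) := by
  rw [bten, bten, ← map_smul]
  congr 1
  funext m
  simp only [ten, Pi.smul_apply, Pi.single_apply, MulOpposite.smul_eq_mul_unop,
    MulOpposite.unop_op]
  split_ifs <;> simp

/-- The element `∑_y m_λ ⊗ d_A f y`, where `y` runs over `(S_{μ(A)} \ S_μ)_min`; here `λ` and `μ`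
are the row and column sums of `A`, and `m_λ = v_{(1^{λ_1}, 2^{λ_2}, …)}`. -/
noncomputable def xiImage (A : Matrix (Fin n) (Fin n) ℕ) (hA : ∑ i, ∑ j, A i j = r)
    (f : MvPolynomial (Fin r) k) : InducedTensor k n r :=
  ∑ y ∈ minReps (colBlock A hA) (blockLabel (colSum A) (sum_colSum hA)),
    bten (blockLabel (rowSum A) (sum_rowSum hA)) (AH.perm (dA A hA) * AH.poly f * AH.perm y)

/-- `f` belongs to the ring `P^{μ(A)}` of polynomials invariant under `S_{μ(A)}`. -/
def IsInvariant (A : Matrix (Fin n) (Fin n) ℕ) (hA : ∑ i, ∑ j, A i j = r)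
    (f : MvPolynomial (Fin r) k) : Prop :=
  ∀ w ∈ stab (colBlock A hA), permPoly w f = f

theorem xiImage_smul {A : Matrix (Fin n) (Fin n) ℕ} {hA : ∑ i, ∑ j, A i j = r}
    {f : MvPolynomial (Fin r) k} (hf : IsInvariant A hA f) {g : Equiv.Perm (Fin r)}
    (hg : g ∈ stab (blockLabel (colSum A) (sum_colSum hA))) :
    MulOpposite.op (AH.perm g : AH k r) • xiImage A hA f = xiImage A hA f := by
  rw [xiImage, Finset.smul_sum]
  simp only [op_smul_bten, mul_assoc, ← map_mul]
  refine sum_minReps (colBlock_mono A hA) (stab_colBlock_le A hA)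
    (fun y => bten (k := k) (blockLabel (rowSum A) (sum_rowSum hA))
      (AH.perm (dA A hA) * (AH.poly f * AH.perm y))) ?_ hg
  intro w hw y
  have h1 : (AH.perm (dA A hA) * (AH.poly f * AH.perm (w * y)) : AH k r)
      = AH.perm (dA A hA * w) * (AH.poly f * AH.perm y) := by
    rw [map_mul, map_mul, ← mul_assoc (AH.poly f),
      ← AH.perm_comm_of_invariant (colBlock_mono A hA) hf w hw]
    simp only [mul_assoc]
  simp only [h1]
  rw [← bten_comp, row_dA_mul A hA hw, bten_comp]

/-- The homomorphism of right `AH_r`-modules with `v_i ⊗ h ↦ φ i h`. -/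
noncomputable def ofColumns {M : Type*} [AddCommGroup M] [Module (AH k r)ᵐᵒᵖ M]
    (z : (Fin r → Fin n) → M) : TensorAH k n r →ₗ[(AH k r)ᵐᵒᵖ] M where
  toFun φ := ∑ i, MulOpposite.op (φ i) • z i
  map_add' φ ψ := by
    rw [← Finset.sum_add_distrib]
    exact Finset.sum_congr rfl fun i _ => by rw [Pi.add_apply, MulOpposite.op_add, add_smul]
  map_smul' a φ := by
    rw [RingHom.id_apply, Finset.smul_sum]
    exact Finset.sum_congr rfl fun i _ => by
      rw [smul_smul, Pi.smul_apply, MulOpposite.smul_eq_mul_unop, MulOpposite.op_mul,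
        MulOpposite.op_unop]

theorem ofColumns_ten {M : Type*} [AddCommGroup M] [Module (AH k r)ᵐᵒᵖ M]
    (z : (Fin r → Fin n) → M) (i : Fin r → Fin n) (h : AH k r) :
    ofColumns z (ten i h) = MulOpposite.op h • z i := by
  classical
  change ∑ m, MulOpposite.op ((ten i h : TensorAH k n r) m) • z m = _
  rw [Finset.sum_eq_single i]
  · rw [ten, Pi.single_eq_same]
  · intro m _ hm
    rw [ten, Pi.single_eq_of_ne hm, MulOpposite.op_zero, zero_smul]
  · intro h; exact absurd (Finset.mem_univ _) h

/-- The image of `v_i ⊗ 1` under `ξ_{A,f}`. Write `i = i^μ ∘ g` with `g ∈ S_r` if `i` is a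
rearrangement of `i^μ = (1^{μ_1}, 2^{μ_2}, …)`. Then `v_i ⊗ 1 = m_μ ⊗ g`. -/
noncomputable def xiColumn (A : Matrix (Fin n) (Fin n) ℕ) (hA : ∑ i, ∑ j, A i j = r)
    (f : MvPolynomial (Fin r) k) (i : Fin r → Fin n) : InducedTensor k n r :=
  if i ∘ Tuple.sort i = blockLabel (colSum A) (sum_colSum hA) then
    MulOpposite.op (AH.perm (Tuple.sort i)⁻¹ : AH k r) • xiImage A hA f
  else 0

theorem xiColumn_comp {A : Matrix (Fin n) (Fin n) ℕ} {hA : ∑ i, ∑ j, A i j = r}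
    {f : MvPolynomial (Fin r) k} (hf : IsInvariant A hA f) (i : Fin r → Fin n)
    (w : Equiv.Perm (Fin r)) :
    xiColumn A hA f (i ∘ w) = MulOpposite.op (AH.perm w : AH k r) • xiColumn A hA f i := by
  have hs : (i ∘ w) ∘ Tuple.sort (i ∘ w) = i ∘ Tuple.sort i := by
    exact Tuple.comp_perm_comp_sort_eq_comp_sort
  rw [xiColumn, xiColumn, hs]
  split_ifs with h
  · rw [smul_smul, ← MulOpposite.op_mul, ← map_mul]
    have h1 : (Tuple.sort (i ∘ w))⁻¹
        = ((Tuple.sort (i ∘ w))⁻¹ * w⁻¹ * Tuple.sort i) * ((Tuple.sort i)⁻¹ * w) := by group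
    rw [h1, map_mul, MulOpposite.op_mul, mul_smul, xiImage_smul hf]
    intro p
    have h2 := congrFun (hs.trans h) ((Tuple.sort (i ∘ w))⁻¹ (w⁻¹ (Tuple.sort i p)))
    have h3 := congrFun h p
    simp only [Function.comp_apply, perm_apply_inv] at h2 h3
    simp only [Equiv.Perm.mul_apply]
    rw [← h2, h3]
  · rw [smul_zero]

theorem balanced_le_ker {A : Matrix (Fin n) (Fin n) ℕ} {hA : ∑ i, ∑ j, A i j = r}
    {f : MvPolynomial (Fin r) k} (hf : IsInvariant A hA f) :
    balanced k n r ≤ LinearMap.ker (ofColumns (xiColumn A hA f)) := by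
  refine Submodule.span_le.2 ?_
  rintro _ ⟨i, w, h, rfl⟩
  change ofColumns (xiColumn A hA f) _ = 0
  rw [map_sub, ofColumns_ten, ofColumns_ten, xiColumn_comp hf, smul_smul, ← MulOpposite.op_mul,
    sub_self]

/-- The homomorphism `ξ_{A,f}`, which sends `m_μ ⊗ 1 ↦ ∑_y m_λ ⊗ d_A f y` and kills
`m_ν ⊗ 1` for `ν ≠ μ`. -/
noncomputable def xiHom (A : Matrix (Fin n) (Fin n) ℕ) (hA : ∑ i, ∑ j, A i j = r)
    (f : MvPolynomial (Fin r) k) (hf : IsInvariant A hA f) : AS k n r :=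
  (balanced k n r).liftQ (ofColumns (xiColumn A hA f)) (balanced_le_ker hf)

theorem xiHom_bten (A : Matrix (Fin n) (Fin n) ℕ) (hA : ∑ i, ∑ j, A i j = r)
    (f : MvPolynomial (Fin r) k) (hf : IsInvariant A hA f) (ν : Fin n → ℕ) (hν : ∑ a, ν a = r) :
    xiHom A hA f hf (bten (blockLabel ν hν) 1) = if ν = colSum A then xiImage A hA f else 0 := by
  have h0 : xiHom A hA f hf (bten (blockLabel ν hν) 1) = xiColumn A hA f (blockLabel ν hν) := by
    rw [bten, xiHom, Submodule.mkQ_apply, Submodule.liftQ_apply, ofColumns_ten, MulOpposite.op_one,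
      one_smul]
  have hs : Tuple.sort (blockLabel ν hν) = 1 :=
    Tuple.sort_eq_refl_iff_monotone.2 (blockLabel_mono hν)
  rw [h0, xiColumn, hs, inv_one, map_one, MulOpposite.op_one, one_smul]
  congr 1
  rw [eq_iff_iff]
  constructor
  · intro h
    funext a
    rw [← card_blockLabel hν a, ← card_blockLabel (sum_colSum hA) a, ← h]
    rfl
  · rintro rfl; rfl

open Classical in
/-- The element `ξ_{A,f}` of `AS(n, r)`, for a matrix `A` with entry sum `r` and a polynomial
`f ∈ P^{μ(A)}`. (In all other cases the value is irrelevant, we put it equal to `0`.) -/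
noncomputable def xi (A : Matrix (Fin n) (Fin n) ℕ) (f : MvPolynomial (Fin r) k) : AS k n r :=
  if h : ∃ hA : ∑ i, ∑ j, A i j = r, IsInvariant A hA f then xiHom A h.1 f h.2 else 0

end Schur

section Formula
variable (k : Type*) [CommRing k] {n : ℕ} (r : ℕ)

/-- The generating series `T_{i,j}(u) = ∑_d T_{i,j}^{(d)} u^{-d}`, as a power series in `u⁻¹`. -/
noncomputable def TSeries (i j : Fin n) : PowerSeries (Yangian k n) :=
  PowerSeries.mk fun d => Yangian.T k i j d

/-- The variable `x_p` of `P_r = k[x_1, …, x_r]`, for a number `p` with `1 ≤ p ≤ r`. (The value for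
other `p` is irrelevant.) -/
noncomputable def xv (p : ℕ) : MvPolynomial (Fin r) k :=
  if h : 1 ≤ p ∧ p ≤ r then MvPolynomial.X ⟨p - 1, by omega⟩ else 0

variable {k r}

/-- `ξ_{A,f}` for a power series `f` in `u⁻¹` with coefficients in `P^{μ(A)}`. -/
noncomputable def xiSeries (A : Matrix (Fin n) (Fin n) ℕ)
    (f : PowerSeries (MvPolynomial (Fin r) k)) : PowerSeries (AS k n r) :=
  PowerSeries.mk fun d => xi A (PowerSeries.coeff d f)

/-- The sequences `i ≥ j_1 < ⋯ < j_t = j`, where `t = s + 1` and `c l` stands for `j_{l+1}`. -/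
def chains (i j : Fin n) (s : ℕ) : Finset (Fin (s + 1) → Fin n) :=
  Finset.univ.filter fun c => (∀ l m, l < m → c l < c m) ∧ c (Fin.last s) = j ∧ c 0 ≤ i

variable (r) in
/-- The compositions `μ ∈ Λ(n, r)` with `μ_{j_1} > 0` if `i ≠ j_1`, and `μ_{j_2}, …, μ_{j_t} > 0`. -/
def admissible (i : Fin n) {s : ℕ} (c : Fin (s + 1) → Fin n) : Finset (Fin n → ℕ) :=
  (Finset.piAntidiag Finset.univ r).filter fun μ =>
    (i ≠ c 0 → 0 < μ (c 0)) ∧ ∀ l : Fin s, 0 < μ (c l.succ)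

/-- The matrix `diag(μ_1, …, μ_n) + (e_{i,j_1} - e_{j_1,j_1}) + ∑_{l=2}^t (e_{j_{l-1},j_l} -
e_{j_l,j_l})`. -/
def chainMatrix (i : Fin n) {s : ℕ} (c : Fin (s + 1) → Fin n) (μ : Fin n → ℕ) :
    Matrix (Fin n) (Fin n) ℤ :=
  Matrix.diagonal (fun a => (μ a : ℤ))
    + (Matrix.single i (c 0) 1 - Matrix.single (c 0) (c 0) 1)
    + ∑ l : Fin s, (Matrix.single (c l.castSucc) (c l.succ) 1
        - Matrix.single (c l.succ) (c l.succ) 1)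

/-- `a_j = μ_{<j} + 1`. -/
def blockStart (μ : Fin n → ℕ) (j : Fin n) : ℕ := (∑ a ∈ Finset.univ.filter (· < j), μ a) + 1

/-- `b_j = μ_{≤j}`. -/
def blockEnd (μ : Fin n → ℕ) (j : Fin n) : ℕ := ∑ a ∈ Finset.univ.filter (· ≤ j), μ a

variable (k r) in
/-- The expansion in powers of `u⁻¹` of the rational function
`∏_{p=a_{j_1}}^{b_{j_1}-1} (1 + 1/(u-x_p)) ⋅ 1/(u-x_{b_{j_1}}) ⋅ ∏_{l=2}^t 1/(u-x_{a_{j_l}})`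
if `i ≠ j_1`, and of
`∏_{p=a_{j_1}}^{b_{j_1}} (1 + 1/(u-x_p)) ⋅ ∏_{l=2}^t 1/(u-x_{a_{j_l}})` if `i = j_1`. -/
noncomputable def chainSeries (i : Fin n) {s : ℕ} (c : Fin (s + 1) → Fin n) (μ : Fin n → ℕ) :
    PowerSeries (MvPolynomial (Fin r) k) :=
  (if i = c 0 then
      ∏ p ∈ Finset.Icc (blockStart μ (c 0)) (blockEnd μ (c 0)), (1 + invSub (xv k r p))
    else
      (∏ p ∈ Finset.Ico (blockStart μ (c 0)) (blockEnd μ (c 0)), (1 + invSub (xv k r p)))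
        * invSub (xv k r (blockEnd μ (c 0))))
    * ∏ l : Fin s, invSub (xv k r (blockStart μ (c l.succ)))

end Formula

end DrinfeldSchur

open DrinfeldSchur

/-!
Write `m_μ` for the weakly increasing tensor of type `μ`, and `y_p` for the expansion of
`1 / (u - x_p)`. The vectors `m_μ ⊗ 1` generate the induced tensor space (`AS_ext`), so both sides
are compared on them.

*Action of the monodromy matrix.* The matrix is a product of factors, one for each position.
Applied to `m_μ`, the factors of the block with label `j` either preserve all labels of the block,
with coefficient `∏ (1 + y_p)`, or replace one label `j` by some `x ≠ j`, with coefficient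
`y_p * ∏ (1 + y_q)`, where `p` is the position of this label and `q` runs over the positions to the
right of `p` in the block (`evSeries_partialMonodromy_block`). The blocks in which a label is
replaced form a chain: the entry in row `i` and column `j` replaces one label `j_1` by `i` if
`i ≠ j_1`, and then one label `j_{l+1}` by `j_l` for each `l`. The recursion on the last entry `j`
of the chain is carried out in `evSeries_eq_sum_chains`.

*One block.* Modulo permutations that preserve the new tensor, the sum over the positions `p` of the
replaced label collapses (`sum_setAt`). For `x < j` it is equal to the tensor in which the first label
of the block is replaced, times `y_a * ∑ w`, where `a` is the first position and `w` runs over the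
cycles that move a position of the block to `a`. This follows by induction on the length of the
block from the relation `y_p s_p = s_p y_{p+1} + y_p y_{p+1}`, see `sum_cycle_mul`. For `j < x` the
last label is replaced. The product `∏ (1 + y_p)` over the block is symmetric, hence commutes with
the permutations of the block; after division by it the identity becomes the mirror image of the
first one, with `1 / (u - x_p)` replaced by `-1 / (u - x_p + 1)`.

*Comparison with `ξ_{A,f}`.* Replacing the first or the last labels of the blocks in this way gives
the tensor `m_λ d_A`: a position in the propagating string of thickness `A i j` has the label `j` in
`m_μ` and the label `i` in the new tensor (`colBlock_chainMatrix`). The products of the cycles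
represent the right cosets of `S_{μ(A)}` in `S_μ` (`exists_transversal`), so that their sum can
be replaced by the sum over the representatives of minimal length (`xiImage_chain`).
-/

namespace DrinfeldSchur

/-! ### Right transversals -/

section Transversal
variable {r : ℕ}

/-- `Y` is a right transversal of `H` in `G`, i.e. a set of representatives of the right cosets
`H g` with `g ∈ G`. -/
def IsTransversal {α : Type*} [Group α] (H G : Subgroup α) (Y : Finset α) : Prop :=
  (∀ y ∈ Y, y ∈ G) ∧ ∀ g ∈ G, ∃! y, y ∈ Y ∧ g * y⁻¹ ∈ H

theorem IsTransversal.eq_of_mul_inv_mem {α : Type*} [Group α] {H G : Subgroup α} {Y : Finset α}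
    (hY : IsTransversal H G Y) {y y' : α} (hy : y ∈ Y) (hy' : y' ∈ Y) (h : y * y'⁻¹ ∈ H) :
    y = y' :=
  (hY.2 y (hY.1 y hy)).unique ⟨hy, by simp⟩ ⟨hy', h⟩

theorem IsTransversal.sum_eq {α : Type*} [Group α] {H G : Subgroup α} {Y Y' : Finset α}
    (hY : IsTransversal H G Y) (hY' : IsTransversal H G Y') {M : Type*} [AddCommMonoid M]
    (F : α → M) (hF : ∀ w ∈ H, ∀ y, F (w * y) = F y) :
    ∑ y ∈ Y, F y = ∑ y ∈ Y', F y := by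
  have ex : ∀ y ∈ Y, ∃ y', y' ∈ Y' ∧ y * y'⁻¹ ∈ H := fun y hy => (hY'.2 y (hY.1 y hy)).exists
  choose! e he1 he2 using ex
  refine Finset.sum_bij (fun y _ => e y) he1 ?_ ?_ ?_
  · intro y hy y' hy' h
    refine hY.eq_of_mul_inv_mem hy hy' ?_
    have := H.mul_mem (he2 y hy) (H.inv_mem (he2 y' hy'))
    rw [h] at this
    simpa using this
  · intro y' hy'
    obtain ⟨y, hy, hyy⟩ := (hY.2 y' (hY'.1 y' hy')).exists
    refine ⟨y, hy, hY'.eq_of_mul_inv_mem (he1 y hy) hy' ?_⟩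
    have := H.inv_mem (H.mul_mem hyy (he2 y hy))
    simpa using this
  · intro y hy
    have := hF _ (he2 y hy) (e y)
    rw [← this, inv_mul_cancel_right]

theorem IsTransversal.mul {α : Type*} [Group α] [DecidableEq α] {H K G : Subgroup α}
    {Y Z : Finset α} (hHK : H ≤ K) (hKG : K ≤ G) (hY : IsTransversal H K Y)
    (hZ : IsTransversal K G Z) :
    IsTransversal H G (Finset.image₂ (· * ·) Y Z) := by
  constructor
  · intro x hx
    obtain ⟨y, hy, z, hz, rfl⟩ := Finset.mem_image₂.1 hx
    exact G.mul_mem (hKG (hY.1 y hy)) (hZ.1 z hz)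
  · intro g hg
    obtain ⟨z, ⟨hz, hgz⟩, uz⟩ := hZ.2 g hg
    obtain ⟨y, ⟨hy, hgy⟩, uy⟩ := hY.2 _ hgz
    refine ⟨y * z, ⟨Finset.mem_image₂_of_mem hy hz, by simpa [mul_assoc] using hgy⟩, ?_⟩
    rintro x ⟨hx, hgx⟩
    obtain ⟨y', hy', z', hz', rfl⟩ := Finset.mem_image₂.1 hx
    have h1 : z' = z := by
      refine uz z' ⟨hz', ?_⟩
      have := K.mul_mem (hHK hgx) (hY.1 y' hy')
      simpa [mul_assoc] using this
    subst h1
    have h2 : y' = y := uy y' ⟨hy', by simpa [mul_assoc] using hgx⟩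
    rw [h2]

theorem IsTransversal.sum_mul {α : Type*} [Group α] [DecidableEq α] {H K G : Subgroup α}
    {Y Z : Finset α} (hY : IsTransversal H K Y)
    (hZ : IsTransversal K G Z) {M : Type*} [AddCommMonoid M] (F : α → M) :
    ∑ x ∈ Finset.image₂ (· * ·) Y Z, F x = ∑ y ∈ Y, ∑ z ∈ Z, F (y * z) := by
  rw [← Finset.sum_product', ← Finset.image_uncurry_product, Finset.sum_image]
  · rfl
  · rintro ⟨y, z⟩ h ⟨y', z'⟩ h' heq
    simp only [Finset.coe_product, Set.mem_prod, Finset.mem_coe] at h h'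
    simp only [Function.uncurry_apply_pair] at heq
    have h1 : z = z' := by
      refine hZ.eq_of_mul_inv_mem h.2 h'.2 ?_
      have h3 : z * z'⁻¹ = y⁻¹ * y' := by
        rw [eq_inv_mul_iff_mul_eq, ← mul_assoc, heq, mul_inv_cancel_right]
      rw [h3]
      exact K.mul_mem (K.inv_mem (hY.1 y h.1)) (hY.1 y' h'.1)
    subst h1
    rw [mul_right_cancel heq]

theorem isTransversal_minReps {ι κ : Type*} [LinearOrder ι] {c : Fin r → ι} {c₀ : Fin r → κ}
    (hc : Monotone c) (hle : stab c ≤ stab c₀) :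
    IsTransversal (stab c) (stab c₀) (minReps c c₀) := by
  have hm : ∀ y, y ∈ minReps c c₀ ↔ y ∈ stab c₀ ∧ rep c y = y := by
    intro y
    simp only [minReps, Finset.mem_filter, isMinRep_iff hc, Finset.mem_univ, true_and]
  refine ⟨fun y hy => ((hm y).1 hy).1, fun g hg => ⟨rep c g, ⟨?_, ?_⟩, ?_⟩⟩
  · rw [hm]
    refine ⟨?_, rep_rep hc g⟩
    have := (stab c₀).mul_mem (hle (rep_mul_inv_mem hc g)) hg
    simpa using this
  · have := (stab c).inv_mem (rep_mul_inv_mem hc g)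
    simpa using this
  · rintro y ⟨hy, hgy⟩
    rw [hm] at hy
    rw [← hy.2]
    have := rep_mul hgy y
    rw [inv_mul_cancel_right] at this
    exact this.symm

end Transversal

/-! ### Blocks, marked positions and cycles -/

section Blocks
variable {n r : ℕ}

/-- The number of positions to the left of the block with label `j`. -/
def offset (μ : Fin n → ℕ) (j : Fin n) : ℕ := ∑ a ∈ Finset.univ.filter (· < j), μ a

theorem blockStart_eq (μ : Fin n → ℕ) (j : Fin n) : blockStart μ j = offset μ j + 1 := rfl

theorem blockEnd_eq (μ : Fin n → ℕ) (j : Fin n) : blockEnd μ j = offset μ j + μ j := by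
  have h3 : Finset.univ.filter (· ≤ j) = insert j (Finset.univ.filter (· < j)) := by
    ext b; simp [le_iff_eq_or_lt]
  rw [blockEnd, h3, Finset.sum_insert (by simp), offset, add_comm]

theorem offset_mono_of_lt (μ : Fin n → ℕ) {x j : Fin n} (h : x < j) :
    offset μ x + μ x ≤ offset μ j := by
  rw [← blockEnd_eq]
  refine Finset.sum_le_sum_of_subset ?_
  intro a ha
  simp only [Finset.mem_filter, Finset.mem_univ, true_and] at ha ⊢
  exact ha.trans_lt h

theorem offset_add_le {μ : Fin n → ℕ} (hμ : ∑ a, μ a = r) (j : Fin n) :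
    offset μ j + μ j ≤ r := by
  rw [← blockEnd_eq, ← hμ]
  exact Finset.sum_le_sum_of_subset (Finset.subset_univ _)

theorem blockLabel_le_iff' {μ : Fin n → ℕ} (hμ : ∑ a, μ a = r) (p : Fin r) (j : Fin n) :
    blockLabel μ hμ p ≤ j ↔ (p : ℕ) < offset μ j + μ j := by
  rw [← blockEnd_eq]; exact blockLabel_le_iff hμ p j

theorem le_blockLabel_iff {μ : Fin n → ℕ} (hμ : ∑ a, μ a = r) (p : Fin r) (j : Fin n) :
    j ≤ blockLabel μ hμ p ↔ offset μ j ≤ p := by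
  constructor
  · intro h
    by_contra! hlt
    have hne : (Finset.univ.filter (· < j)).Nonempty := by
      by_contra hne
      rw [Finset.not_nonempty_iff_eq_empty] at hne
      rw [offset, hne, Finset.sum_empty] at hlt
      omega
    have hmem := Finset.max'_mem _ hne
    set a := (Finset.univ.filter (· < j)).max' hne
    have haj : a < j := by simpa using hmem
    have hs : Finset.univ.filter (· < j) = Finset.univ.filter (· ≤ a) := by
      ext b
      simp only [Finset.mem_filter, Finset.mem_univ, true_and]
      exact ⟨fun hb => Finset.le_max' _ _ (by simpa using hb), fun hb => hb.trans_lt haj⟩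
    rw [offset, hs, ← blockLabel_le_iff hμ] at hlt
    exact absurd (h.trans hlt) (not_le.2 haj)
  · intro h
    by_contra! hlt
    have h1 := (blockLabel_le_iff' hμ p _).1 le_rfl
    have h2 := offset_mono_of_lt μ hlt
    omega

theorem blockLabel_eq_iff {μ : Fin n → ℕ} (hμ : ∑ a, μ a = r) (p : Fin r) (j : Fin n) :
    blockLabel μ hμ p = j ↔ offset μ j ≤ p ∧ (p : ℕ) < offset μ j + μ j := by
  rw [← blockLabel_le_iff' hμ, ← le_blockLabel_iff hμ, le_antisymm_iff, and_comm]

/-- The positions of the block with label `j`, counted from `0`, read from left to right if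
`x < j` and from right to left otherwise. -/
def pos (μ : Fin n → ℕ) (x j : Fin n) (l : ℕ) : ℕ :=
  if x < j then offset μ j + l else offset μ j + μ j - 1 - l

theorem pos_lt {μ : Fin n → ℕ} (hμ : ∑ a, μ a = r) (x : Fin n) {j : Fin n} {l : ℕ} (hl : l < μ j) :
    pos μ x j l < r := by
  have := offset_add_le hμ j
  rw [pos]; split_ifs <;> omega

theorem pos_inj {μ : Fin n → ℕ} {x j : Fin n} {l l' : ℕ} (hl : l < μ j) (hl' : l' < μ j)
    (h : pos μ x j l = pos μ x j l') : l = l' := by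
  simp only [pos] at h; split_ifs at h <;> omega

theorem blockLabel_pos {μ : Fin n → ℕ} (hμ : ∑ a, μ a = r) (x j : Fin n) {p : Fin r} {l : ℕ}
    (hl : l < μ j) (hp : (p : ℕ) = pos μ x j l) : blockLabel μ hμ p = j := by
  rw [blockLabel_eq_iff, hp, pos]; split_ifs <;> omega

theorem exists_pos {μ : Fin n → ℕ} (hμ : ∑ a, μ a = r) (x : Fin n) {j : Fin n} {p : Fin r}
    (hp : blockLabel μ hμ p = j) : ∃ l < μ j, (p : ℕ) = pos μ x j l := by
  rw [blockLabel_eq_iff] at hp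
  by_cases hx : x < j
  · exact ⟨p - offset μ j, by omega, by rw [pos, if_pos hx]; omega⟩
  · exact ⟨offset μ j + μ j - 1 - p, by omega, by rw [pos, if_neg hx]; omega⟩

/-- Replace the label at position `q` by `x`. -/
def setAt (q : ℕ) (x : Fin n) (ρ : Fin r → Fin n) : Fin r → Fin n :=
  fun p => if (p : ℕ) = q then x else ρ p

theorem setAt_eq_update (p : Fin r) (x : Fin n) (ρ : Fin r → Fin n) :
    setAt (p : ℕ) x ρ = Function.update ρ p x := by
  funext p'
  simp only [setAt, Function.update_apply, Fin.ext_iff]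

/-- Replace one label of the block with label `j` by `x`: the first one if `x < j`, and the last
one if `j < x`. -/
def upd (μ : Fin n → ℕ) (x j : Fin n) (ρ : Fin r → Fin n) : Fin r → Fin n :=
  fun p => if x ≠ j ∧ 0 < μ j ∧ (p : ℕ) = pos μ x j 0 then x else ρ p

theorem upd_self (μ : Fin n → ℕ) (j : Fin n) (ρ : Fin r → Fin n) : upd μ j j ρ = ρ := by
  funext p; simp [upd]

theorem upd_eq_setAt {μ : Fin n → ℕ} {x j : Fin n} (hx : x ≠ j) (hj : 0 < μ j)
    (ρ : Fin r → Fin n) : upd μ x j ρ = setAt (pos μ x j 0) x ρ := by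
  funext p; simp [upd, setAt, hx, hj]

theorem upd_of_ne {μ : Fin n → ℕ} (hμ : ∑ a, μ a = r) (x : Fin n) {j : Fin n} (ρ : Fin r → Fin n)
    {p : Fin r} (hp : blockLabel μ hμ p ≠ j) : upd μ x j ρ p = ρ p := by
  rw [upd, if_neg]
  rintro ⟨-, h1, h2⟩
  exact hp (blockLabel_pos hμ x j h1 h2)

/-- The transposition of the positions `a` and `b`. -/
def swapAt (r a b : ℕ) : Equiv.Perm (Fin r) :=
  if h : a < r ∧ b < r then Equiv.swap ⟨a, h.1⟩ ⟨b, h.2⟩ else 1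

/-- The cycle `(P 0  P 1) (P 1  P 2) ⋯ (P (k - 1)  P k)`, which maps `P k` to `P 0`. -/
def cyc (r : ℕ) (P : ℕ → ℕ) : ℕ → Equiv.Perm (Fin r)
  | 0 => 1
  | k + 1 => cyc r P k * swapAt r (P k) (P (k + 1))

theorem swapAt_of_ne {a b : ℕ} {p : Fin r} (ha : (p : ℕ) ≠ a) (hb : (p : ℕ) ≠ b) :
    swapAt r a b p = p := by
  rw [swapAt]; split_ifs with h
  · exact Equiv.swap_apply_of_ne_of_ne (by rwa [Ne, Fin.ext_iff]) (by rwa [Ne, Fin.ext_iff])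
  · rfl

theorem swapAt_mem_stab {ι : Type*} {c : Fin r → ι} {a b : ℕ}
    (h : ∀ p q : Fin r, (p : ℕ) = a → (q : ℕ) = b → c p = c q) : swapAt r a b ∈ stab c := by
  rw [swapAt]; split_ifs with hab
  · intro p
    have := h ⟨a, hab.1⟩ ⟨b, hab.2⟩ rfl rfl
    rw [Equiv.swap_apply_def]
    split_ifs with h1 h2
    · rw [h1, this]
    · rw [h2, this]
    · rfl
  · exact (stab c).one_mem

theorem cyc_mem_stab {ι : Type*} {c : Fin r → ι} {P : ℕ → ℕ} {L k : ℕ} (hk : k < L)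
    (h : ∀ l l', l < L → l' < L → ∀ p q : Fin r, (p : ℕ) = P l → (q : ℕ) = P l' → c p = c q) :
    cyc r P k ∈ stab c := by
  induction k with
  | zero => exact (stab c).one_mem
  | succ k ih =>
    exact (stab c).mul_mem (ih (by omega)) (swapAt_mem_stab (h k (k + 1) (by omega) hk))

theorem cyc_apply_of_ne {P : ℕ → ℕ} {k : ℕ} {p : Fin r} (h : ∀ l ≤ k, (p : ℕ) ≠ P l) :
    cyc r P k p = p := by
  induction k with
  | zero => rfl
  | succ k ih =>
    rw [cyc, Equiv.Perm.mul_apply, swapAt_of_ne (h k (by omega)) (h (k + 1) le_rfl)]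
    exact ih fun l hl => h l (by omega)

theorem cyc_apply {P : ℕ → ℕ} {k : ℕ} (hP : ∀ l ≤ k, P l < r) {p : Fin r} (hp : (p : ℕ) = P k) :
    (cyc r P k p : ℕ) = P 0 := by
  induction k generalizing p with
  | zero => exact hp
  | succ k ih =>
    have h1 : p = ⟨P (k + 1), hP _ le_rfl⟩ := Fin.ext hp
    rw [cyc, Equiv.Perm.mul_apply, swapAt, dif_pos ⟨hP k (by omega), hP _ le_rfl⟩, h1,
      Equiv.swap_apply_right]
    exact ih (fun l hl => hP l (by omega)) rfl

/-- The cycle on the block with label `j` that brings the `k`th position (in the order of `pos`) to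
the marked position and preserves the order of the others. -/
def blockCyc (r : ℕ) (μ : Fin n → ℕ) (x j : Fin n) (k : ℕ) : Equiv.Perm (Fin r) :=
  cyc r (pos μ x j) k

theorem blockCyc_mem_stab {ι : Type*} {c : Fin r → ι} {μ : Fin n → ℕ} (hμ : ∑ a, μ a = r)
    (x : Fin n) {j : Fin n} {k : ℕ} (hk : k < μ j)
    (h : ∀ p q, blockLabel μ hμ p = j → blockLabel μ hμ q = j → c p = c q) :
    blockCyc r μ x j k ∈ stab c :=
  cyc_mem_stab hk fun _ _ hl hl' _ _ hp hq =>
    h _ _ (blockLabel_pos hμ x j hl hp) (blockLabel_pos hμ x j hl' hq)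

theorem blockCyc_of_ne {μ : Fin n → ℕ} (hμ : ∑ a, μ a = r) (x : Fin n) {j : Fin n} {k : ℕ}
    (hk : k < μ j) {p : Fin r} (hp : blockLabel μ hμ p ≠ j) : blockCyc r μ x j k p = p :=
  cyc_apply_of_ne fun _ hl h => hp (blockLabel_pos hμ x j (by omega) h)

theorem blockCyc_eq_mark_iff {μ : Fin n → ℕ} (hμ : ∑ a, μ a = r) (x : Fin n) {j : Fin n} {k : ℕ}
    (hk : k < μ j) (p : Fin r) :
    (blockCyc r μ x j k p : ℕ) = pos μ x j 0 ↔ (p : ℕ) = pos μ x j k := by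
  have h1 : ∀ p : Fin r, (p : ℕ) = pos μ x j k → (blockCyc r μ x j k p : ℕ) = pos μ x j 0 :=
    fun p hp => cyc_apply (fun l hl => pos_lt hμ x (by omega)) hp
  refine ⟨fun h => ?_, h1 p⟩
  have h2 := h1 ⟨pos μ x j k, pos_lt hμ x hk⟩ rfl
  have h3 := (blockCyc r μ x j k).injective (Fin.ext (h.trans h2.symm))
  rw [h3]

/-- The labelling by the pairs of a label and its replacement, in the lexicographic order. -/
def pairLabel {α β : Type*} (m : Fin r → α) (ρ : Fin r → β) : Fin r → α ×ₗ β :=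
  fun p => toLex (m p, ρ p)

theorem mem_stab_pairLabel {α β : Type*} {m : Fin r → α} {ρ : Fin r → β}
    {w : Equiv.Perm (Fin r)} :
    w ∈ stab (pairLabel m ρ) ↔ ∀ p, m (w p) = m p ∧ ρ (w p) = ρ p := by
  rw [mem_stab]
  refine forall_congr' fun p => ?_
  rw [pairLabel, pairLabel, toLex_inj, Prod.mk_inj]

/-- Marking one position of a block on which the labelling is constant: the block cycles are a
transversal of the stabilizer of the new labelling in that of the old one. -/
theorem isTransversal_blockCyc {μ : Fin n → ℕ} (hμ : ∑ a, μ a = r) {x j : Fin n} (hx : x ≠ j)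
    (hj : 0 < μ j) {ρ : Fin r → Fin n} (hρ : ∀ p, blockLabel μ hμ p = j → ρ p = j) :
    IsTransversal (stab (pairLabel (blockLabel μ hμ) (upd μ x j ρ)))
      (stab (pairLabel (blockLabel μ hμ) ρ))
      ((Finset.range (μ j)).image (blockCyc r μ x j)) := by
  have hmem : ∀ k < μ j, blockCyc r μ x j k ∈ stab (pairLabel (blockLabel μ hμ) ρ) := by
    intro k hk
    refine blockCyc_mem_stab hμ x hk fun p q hp hq => ?_
    rw [pairLabel, pairLabel, hp, hq, hρ p hp, hρ q hq]
  constructor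
  · intro y hy
    obtain ⟨k, hk, rfl⟩ := Finset.mem_image.1 hy
    exact hmem k (Finset.mem_range.1 hk)
  · intro g hg
    -- `k` is the number of the position that `g` moves to the marked position
    set P0 : Fin r := ⟨pos μ x j 0, pos_lt hμ x hj⟩ with hP0
    have hm0 : blockLabel μ hμ P0 = j := blockLabel_pos hμ x j hj rfl
    have hmg : blockLabel μ hμ (g⁻¹ P0) = j := by
      have := (mem_stab_pairLabel.1 hg (g⁻¹ P0)).1
      rwa [perm_apply_inv, hm0, eq_comm] at this
    obtain ⟨k, hk, hkp⟩ := exists_pos hμ x hmg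
    have fix_iff : ∀ l < μ j, (g * (blockCyc r μ x j l)⁻¹) P0 = P0 ↔ k = l := by
      intro l hl
      rw [Equiv.Perm.mul_apply, ← Equiv.Perm.eq_inv_iff_eq (f := g), Equiv.Perm.inv_eq_iff_eq,
        Fin.ext_iff, eq_comm]
      change (blockCyc r μ x j l (g⁻¹ P0) : ℕ) = pos μ x j 0 ↔ _
      rw [blockCyc_eq_mark_iff hμ x hl, hkp]
      exact ⟨fun h => pos_inj hk hl h, fun h => by rw [h]⟩
    have upd_eq : ∀ p, p ≠ P0 → upd μ x j ρ p = ρ p := by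
      intro p hp
      rw [upd, if_neg]
      rintro ⟨-, -, h⟩
      exact hp (Fin.ext h)
    have upd_P0 : upd μ x j ρ P0 = x := by rw [upd, if_pos ⟨hx, hj, rfl⟩]
    refine ⟨blockCyc r μ x j k, ⟨Finset.mem_image_of_mem _ (Finset.mem_range.2 hk), ?_⟩, ?_⟩
    · have hv := (stab (pairLabel (blockLabel μ hμ) ρ)).mul_mem hg
        ((stab (pairLabel (blockLabel μ hμ) ρ)).inv_mem (hmem k hk))
      have hfix := (fix_iff k hk).2 rfl
      set v := g * (blockCyc r μ x j k)⁻¹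
      rw [mem_stab_pairLabel] at hv ⊢
      intro p
      refine ⟨(hv p).1, ?_⟩
      by_cases hp : p = P0
      · rw [hp, hfix]
      · have hvp : v p ≠ P0 := fun h => hp (v.injective (h.trans hfix.symm))
        rw [upd_eq _ hp, upd_eq _ hvp, (hv p).2]
    · rintro y ⟨hy, hgy⟩
      obtain ⟨l, hl, rfl⟩ := Finset.mem_image.1 hy
      rw [Finset.mem_range] at hl
      rw [(fix_iff l hl).1]
      by_contra hne
      have h1 := (mem_stab_pairLabel.1 hgy P0)
      rw [upd_P0, upd_eq _ hne, hρ _ (h1.1.trans hm0)] at h1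
      exact hx h1.2.symm

theorem stab_pairLabel_upd_le {μ : Fin n → ℕ} (hμ : ∑ a, μ a = r) (x j : Fin n)
    {ρ : Fin r → Fin n} (hρ : ∀ p, blockLabel μ hμ p = j → ρ p = j) :
    stab (pairLabel (blockLabel μ hμ) (upd μ x j ρ)) ≤ stab (pairLabel (blockLabel μ hμ) ρ) := by
  intro w hw
  rw [mem_stab_pairLabel] at hw ⊢
  intro p
  refine ⟨(hw p).1, ?_⟩
  by_cases hp : blockLabel μ hμ p = j
  · rw [hρ p hp, hρ _ ((hw p).1.trans hp)]
  · have h := (hw p).2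
    rwa [upd_of_ne hμ x ρ hp, upd_of_ne hμ x ρ (by rwa [(hw p).1])] at h

theorem blockCyc_injOn {μ : Fin n → ℕ} (hμ : ∑ a, μ a = r) (x j : Fin n) :
    Set.InjOn (blockCyc r μ x j) (Finset.range (μ j)) := by
  intro k hk l hl h
  simp only [Finset.coe_range, Set.mem_Iio] at hk hl
  have h1 := (blockCyc_eq_mark_iff hμ x hk ⟨pos μ x j k, pos_lt hμ x hk⟩).2 rfl
  rw [h, blockCyc_eq_mark_iff hμ x hl] at h1
  exact pos_inj hk hl h1

theorem setAt_pos_eq {μ : Fin n → ℕ} (hμ : ∑ a, μ a = r) {x j : Fin n} (hx : x ≠ j)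
    {ρ : Fin r → Fin n} (hρ : ∀ p, blockLabel μ hμ p = j → ρ p = j) {k : ℕ} (hk : k < μ j) :
    setAt (pos μ x j k) x ρ = upd μ x j ρ ∘ blockCyc r μ x j k := by
  funext p
  rw [Function.comp_apply, setAt, upd]
  have h1 : ρ (blockCyc r μ x j k p) = ρ p := by
    refine mem_stab.1 (blockCyc_mem_stab hμ x hk fun p q hp hq => ?_) p
    rw [hρ p hp, hρ q hq]
  simp only [blockCyc_eq_mark_iff hμ x hk, h1, ne_eq, hx, not_false_eq_true, true_and,
    show 0 < μ j by omega]

end Blocks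

/-! ### Moving a marked position through a block -/

section Telescoping

/-- Let `c k = s 0 ⋯ s (k - 1)`. If `y k` moves past `s k` as `1 / (u - x_k)` does in the degenerate
affine Hecke algebra, then
`∑ k, c k * y k * ∏ (1 + y l)`, with `l` from `k + 1` to `L - 1`, agrees with `y 0 * ∑ k, c k`
up to left multiplication by the elements `s l` with `1 ≤ l`. This is expressed by means of an
additive map `φ` that does not see these factors. -/
theorem sum_cycle_mul {P R A : Type*} [CommRing P] [Ring R] [AddCommGroup A] (ι : P →+* R)
    (φ : R →+ A) (L : ℕ) (y : ℕ → P) (s c : ℕ → R) (hc0 : c 0 = 1) (hc : ∀ k, c (k + 1) = c k * s k)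
    (hys : ∀ k, k + 1 < L → ι (y k) * s k = s k * ι (y (k + 1)) + ι (y k) * ι (y (k + 1)))
    (hy_far : ∀ k l, k < l → l + 1 < L → ι (y k) * s l = s l * ι (y k))
    (hs_far : ∀ k l, k + 1 < l → l + 1 < L → s k * s l = s l * s k)
    (hφ : ∀ l, 0 < l → l + 1 < L → ∀ h, φ (s l * h) = φ h) (h : R) :
    ∑ k ∈ Finset.range L, φ (c k * ι (y k * ∏ l ∈ Finset.Ico (k + 1) L, (1 + y l)) * h)
      = ∑ k ∈ Finset.range L, φ (ι (y 0) * c k * h) := by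
  -- `S K` is the sum on the left hand side for `L = K`, before `h` is multiplied
  set S : ℕ → R := fun K =>
    ∑ k ∈ Finset.range K, c k * ι (y k * ∏ l ∈ Finset.Ico (k + 1) K, (1 + y l)) with hS
  have hS1 : ∀ K, S (K + 1) = S K + (S K + c K) * ι (y K) := by
    intro K
    simp only [hS]
    rw [Finset.sum_range_succ, Finset.Ico_self, Finset.prod_empty, mul_one, add_mul, ← add_assoc,
      Finset.sum_mul, ← Finset.sum_add_distrib]
    congr 1
    refine Finset.sum_congr rfl fun k hk => ?_
    rw [Finset.prod_Ico_succ_top (by rw [Finset.mem_range] at hk; omega), ← mul_assoc, map_mul,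
      map_add, map_one]
    noncomm_ring
  have hcs : ∀ k l, k < l → l + 1 < L → c k * s l = s l * c k := by
    intro k l hkl hl
    induction k with
    | zero => rw [hc0, one_mul, mul_one]
    | succ k ih =>
      rw [hc, mul_assoc, hs_far k l hkl hl, ← mul_assoc, ih (by omega), mul_assoc]
  have hSs : ∀ K l, K ≤ l → l + 1 < L → S K * s l = s l * S K := by
    intro K l hKl hl
    induction K with
    | zero => simp [hS]
    | succ K ih =>
      have e1 := ih (by omega)
      have e2 := hcs K l (by omega) hl
      have e3 := hy_far K l (by omega) hl
      rw [hS1, add_mul, mul_assoc _ (ι (y K)), e3, ← mul_assoc _ (s l), add_mul, e1, e2,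
        mul_add, ← mul_add, mul_assoc]
  have key : ∀ K, K < L → ∀ h, φ ((S K + c K) * ι (y K) * h) = φ (ι (y 0) * c K * h) := by
    intro K
    induction K with
    | zero => intro _ h; simp [hS, hc0]
    | succ K ih =>
      intro hK h
      have e0 : φ (S K * s K * (ι (y (K + 1)) * h)) = φ (S K * (ι (y (K + 1)) * h)) := by
        rcases Nat.eq_zero_or_pos K with rfl | hpos
        · simp [hS]
        · rw [hSs K K le_rfl hK, mul_assoc, hφ K hpos hK]
      have e1 := ih (by omega) (s K * h)
      have e2 : (S K + c K) * ι (y K) * (s K * h)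
          = S K * s K * (ι (y (K + 1)) * h) + (c K * s K * ι (y (K + 1)) * h
            + (S K + c K) * ι (y K) * (ι (y (K + 1)) * h)) := by
        have : (S K + c K) * ι (y K) * (s K * h) = (S K + c K) * (ι (y K) * s K) * h := by
          simp only [mul_assoc]
        rw [this, hys K hK]
        noncomm_ring
      rw [hc, ← mul_assoc, mul_assoc _ (s K) h, ← e1, e2, map_add, e0, ← map_add, hS1]
      congr 1
      noncomm_ring
  have hfin : ∀ K, K ≤ L → φ (S K * h) = ∑ k ∈ Finset.range K, φ (ι (y 0) * c k * h) := by
    intro K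
    induction K with
    | zero => intro _; simp [hS]
    | succ K ih =>
      intro hK
      rw [hS1, add_mul, map_add, ih (by omega), key K (by omega), Finset.sum_range_succ]
  rw [← hfin L le_rfl, hS, Finset.sum_mul, map_sum]

end Telescoping

/-! ### Commutation in the degenerate affine Hecke algebra -/

section Commutation
variable {k : Type*} [CommRing k] {n r : ℕ}

/-- The labelling whose stabilizer consists of the permutations that preserve `m` and fix the
positions with labels in `B`. -/
def fixLabel {ι : Type*} [LinearOrder ι] (m : Fin r → ι) (B : Finset ι) : Fin r → ι ×ₗ ℕ :=
  fun p => toLex (m p, if m p ∈ B then p else 0)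

theorem mem_stab_fixLabel {ι : Type*} [LinearOrder ι] {m : Fin r → ι} {B : Finset ι}
    {w : Equiv.Perm (Fin r)} :
    w ∈ stab (fixLabel m B) ↔ w ∈ stab m ∧ ∀ p, m p ∈ B → w p = p := by
  simp only [mem_stab, fixLabel, toLex_inj, Prod.mk_inj]
  constructor
  · intro h
    refine ⟨fun p => (h p).1, fun p hp => ?_⟩
    have h2 := (h p).2
    rw [(h p).1, if_pos hp, if_pos hp] at h2
    exact Fin.ext h2
  · rintro ⟨h1, h2⟩ p
    refine ⟨h1 p, ?_⟩
    rw [h1]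
    split_ifs with hp
    · rw [h2 p hp]
    · rfl

theorem fixLabel_mono {ι : Type*} [LinearOrder ι] {m : Fin r → ι} (hm : Monotone m)
    (B : Finset ι) : Monotone (fixLabel m B) := by
  intro p q hpq
  rw [fixLabel, fixLabel, Prod.Lex.toLex_le_toLex]
  rcases (hm hpq).lt_or_eq with h | h
  · exact Or.inl h
  · refine Or.inr ⟨h, ?_⟩
    simp only [h]
    split_ifs
    · exact hpq
    · exact le_rfl

variable (k r) in
/-- The expansion of `1 / (u - x)` for the variable `x` at position `q`, counted from `0`. -/
noncomputable def posSeries (q : ℕ) : PowerSeries (MvPolynomial (Fin r) k) := invSub (xv k r (q + 1))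

theorem xv_succ (p : Fin r) : xv k r (p + 1) = MvPolynomial.X p := by
  rw [xv, dif_pos ⟨by omega, p.2⟩]
  rfl

theorem map_invSub {R S : Type*} [Ring R] [Ring S] (f : R →+* S) (x : R) :
    PowerSeries.map f (invSub x) = invSub (f x) := by
  ext d
  rcases d with _ | d
  · simp [invSub]
  · simp [invSub, PowerSeries.coeff_succ_X_mul]

/-- The map `P_r⟦u⁻¹⟧ → AH_r⟦u⁻¹⟧` induced by `P_r → AH_r`. -/
noncomputable def polySeries :
    PowerSeries (MvPolynomial (Fin r) k) →+* PowerSeries (AH k r) :=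
  PowerSeries.map (AH.poly : MvPolynomial (Fin r) k →ₐ[k] AH k r).toRingHom

theorem polySeries_posSeries (p : Fin r) :
    polySeries (posSeries k r p) = invSub (AH.x p) := by
  rw [polySeries, posSeries, map_invSub, xv_succ]
  congr 1
  exact AH.poly_X p

variable (k) in
/-- Invariance of the coefficients of a power series under the stabilizer of a labelling. -/
def SeriesInvariant {ι : Type*} (c : Fin r → ι) (f : PowerSeries (MvPolynomial (Fin r) k)) : Prop :=
  ∀ w ∈ stab c, PowerSeries.map (permPoly w).toRingHom f = f

theorem SeriesInvariant.coeff {ι : Type*} {c : Fin r → ι}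
    {f : PowerSeries (MvPolynomial (Fin r) k)} (hf : SeriesInvariant k c f) (d : ℕ) :
    ∀ w ∈ stab c, permPoly w (PowerSeries.coeff d f) = PowerSeries.coeff d f := by
  intro w hw
  conv_rhs => rw [← hf w hw]
  rw [PowerSeries.coeff_map]
  rfl

theorem SeriesInvariant.mul {ι : Type*} {c : Fin r → ι}
    {f g : PowerSeries (MvPolynomial (Fin r) k)} (hf : SeriesInvariant k c f)
    (hg : SeriesInvariant k c g) : SeriesInvariant k c (f * g) :=
  fun w hw => by rw [map_mul, hf w hw, hg w hw]

theorem SeriesInvariant.add {ι : Type*} {c : Fin r → ι}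
    {f g : PowerSeries (MvPolynomial (Fin r) k)} (hf : SeriesInvariant k c f)
    (hg : SeriesInvariant k c g) : SeriesInvariant k c (f + g) :=
  fun w hw => by rw [map_add, hf w hw, hg w hw]

theorem SeriesInvariant.one {ι : Type*} {c : Fin r → ι} : SeriesInvariant k c 1 :=
  fun w _ => by rw [map_one]

theorem SeriesInvariant.prod {ι κ : Type*} {c : Fin r → ι} {t : Finset κ}
    {f : κ → PowerSeries (MvPolynomial (Fin r) k)} (hf : ∀ i ∈ t, SeriesInvariant k c (f i)) :
    SeriesInvariant k c (∏ i ∈ t, f i) :=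
  fun w hw => by rw [map_prod]; exact Finset.prod_congr rfl fun i hi => hf i hi w hw

theorem SeriesInvariant.mono {ι κ : Type*} {c : Fin r → ι} {c' : Fin r → κ}
    {f : PowerSeries (MvPolynomial (Fin r) k)} (hf : SeriesInvariant k c f)
    (h : stab c' ≤ stab c) : SeriesInvariant k c' f :=
  fun w hw => hf w (h hw)

theorem map_permPoly_invSub (w : Equiv.Perm (Fin r)) (p : Fin r) :
    PowerSeries.map (permPoly w).toRingHom (invSub (MvPolynomial.X p : MvPolynomial (Fin r) k))
      = invSub (MvPolynomial.X (w p)) := by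
  rw [map_invSub]
  congr 1
  exact MvPolynomial.rename_X _ _

theorem seriesInvariant_invSub {ι : Type*} {c : Fin r → ι} {p : Fin r}
    (h : ∀ w ∈ stab c, w p = p) :
    SeriesInvariant k c (invSub (MvPolynomial.X p)) := by
  intro w hw
  rw [map_permPoly_invSub, h w hw]

theorem seriesInvariant_prod {ι : Type*} {c : Fin r → ι} {t : Finset (Fin r)}
    (h : ∀ w ∈ stab c, ∀ p ∈ t, w p ∈ t) :
    SeriesInvariant k c (∏ p ∈ t, (1 + invSub (MvPolynomial.X p))) := by
  intro w hw
  rw [map_prod]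
  simp only [map_add, map_one, map_permPoly_invSub]
  refine Finset.prod_nbij' (fun p => w p) (fun p => w⁻¹ p) (h w hw) (h _ ((stab c).inv_mem hw))
    ?_ ?_ ?_ <;> intros <;> simp

theorem perm_mul_polySeries {ι : Type*} [LinearOrder ι] {c : Fin r → ι} (hc : Monotone c)
    {f : PowerSeries (MvPolynomial (Fin r) k)} (hf : SeriesInvariant k c f)
    {w : Equiv.Perm (Fin r)} (hw : w ∈ stab c) :
    PowerSeries.C (AH.perm w : AH k r) * polySeries f = polySeries f * PowerSeries.C (AH.perm w) := by
  ext d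
  rw [PowerSeries.coeff_C_mul, PowerSeries.coeff_mul_C, polySeries, PowerSeries.coeff_map]
  exact AH.perm_comm_of_invariant hc (hf.coeff d) w hw

end Commutation

/-! ### Replacing one label of a block -/

section Jump
variable {k : Type*} [CommRing k] {n r : ℕ}

/-- The coefficients of the series `v_i ⊗ h`, for a power series `h` with coefficients in `AH_r`. -/
noncomputable def btenSeries (i : Fin r → Fin n) :
    PowerSeries (AH k r) →+ (ℕ → InducedTensor k n r) where
  toFun h d := bten i (PowerSeries.coeff d h)
  map_zero' := by funext d; simp [bten, ten]
  map_add' f g := by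
    funext d
    simp only [bten, ten, map_add, Pi.single_add, Pi.add_apply]

theorem btenSeries_apply (i : Fin r → Fin n) (h : PowerSeries (AH k r)) (d : ℕ) :
    btenSeries i h d = bten i (PowerSeries.coeff d h) := rfl

theorem btenSeries_comp (i : Fin r → Fin n) (w : Equiv.Perm (Fin r)) (h : PowerSeries (AH k r)) :
    btenSeries (i ∘ w) h = btenSeries i (PowerSeries.C (AH.perm w) * h) := by
  funext d
  rw [btenSeries_apply, btenSeries_apply, bten_comp, PowerSeries.coeff_C_mul]

theorem btenSeries_perm_mul {i : Fin r → Fin n} {w : Equiv.Perm (Fin r)} (hw : w ∈ stab i)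
    (h : PowerSeries (AH k r)) :
    btenSeries i (PowerSeries.C (AH.perm w) * h) = btenSeries i h := by
  rw [← btenSeries_comp, mem_stab'.1 hw]

theorem swapAt_comm {a b c d : ℕ} (hac : a ≠ c) (had : a ≠ d) (hbc : b ≠ c) (hbd : b ≠ d) :
    swapAt r a b * swapAt r c d = swapAt r c d * swapAt r a b := by
  refine Equiv.Perm.Disjoint.commute fun p => ?_
  by_cases h1 : (p : ℕ) = a
  · exact Or.inr (swapAt_of_ne (by omega) (by omega))
  by_cases h2 : (p : ℕ) = b
  · exact Or.inr (swapAt_of_ne (by omega) (by omega))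
  exact Or.inl (swapAt_of_ne h1 h2)

theorem posSeries_mul_swapAt {a : ℕ} (ha : a + 1 < r) :
    polySeries (posSeries k r a) * PowerSeries.C (AH.perm (swapAt r a (a + 1)))
      = PowerSeries.C (AH.perm (swapAt r a (a + 1))) * polySeries (posSeries k r (a + 1))
        + polySeries (posSeries k r a) * polySeries (posSeries k r (a + 1)) := by
  have e0 := polySeries_posSeries (k := k) (⟨a, by omega⟩ : Fin r)
  have e1 := polySeries_posSeries (k := k) (⟨a + 1, by omega⟩ : Fin r)
  simp only at e0 e1
  rw [e0, e1, swapAt, dif_pos ⟨by omega, ha⟩]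
  exact s_invSub_neg (AH.x_s rfl)

theorem polySeries_mul_swapAt {f : PowerSeries (MvPolynomial (Fin r) k)} {e : AH k r} {a : ℕ}
    (hf : polySeries f = invSub e)
    (he : e * AH.perm (swapAt r a (a + 1)) = AH.perm (swapAt r a (a + 1)) * e) :
    polySeries f * PowerSeries.C (AH.perm (swapAt r a (a + 1)))
      = PowerSeries.C (AH.perm (swapAt r a (a + 1))) * polySeries f := by
  rw [hf]
  exact invSub_C_comm he

theorem x_mul_swapAt {q : Fin r} {a : ℕ} (hq : (q : ℕ) ≠ a) (hq' : (q : ℕ) ≠ a + 1) :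
    (AH.x q * AH.perm (swapAt r a (a + 1)) : AH k r) = AH.perm (swapAt r a (a + 1)) * AH.x q := by
  rw [swapAt]
  split_ifs with h
  · exact AH.far rfl (by rwa [Ne, Fin.ext_iff]) (by rwa [Ne, Fin.ext_iff])
  · rw [map_one, mul_one, one_mul]

variable (k r) in
/-- The expansion of `1 / (u - x + 1)` for the variable `x` at position `q`, counted from `0`. It is
the quotient of `1 / (u - x)` by `1 + 1 / (u - x)`. -/
noncomputable def shiftSeries (q : ℕ) : PowerSeries (MvPolynomial (Fin r) k) :=
  invSub (xv k r (q + 1) - 1)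

theorem invSub_resolvent {R : Type*} [CommRing R] (x : R) :
    invSub (x - 1) * (1 + invSub x) = invSub x := by
  have e1 := invSub_eq x
  have e2 := invSub_eq (x - 1)
  rw [map_sub, map_one] at e2
  generalize invSub x = y at *
  generalize invSub (x - 1) = z at *
  have h : PowerSeries.X * (z * (1 + y)) = PowerSeries.X * y := by
    linear_combination y * e2 - z * e1
  exact PowerSeries.X_mul_cancel h

theorem shiftSeries_mul (q : ℕ) :
    shiftSeries k r q * (1 + posSeries k r q) = posSeries k r q := invSub_resolvent _

theorem one_sub_shiftSeries_mul (q : ℕ) :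
    (1 - shiftSeries k r q) * (1 + posSeries k r q) = 1 := by
  rw [sub_mul, shiftSeries_mul]; ring

theorem polySeries_shiftSeries (p : Fin r) :
    polySeries (shiftSeries k r p) = invSub (AH.x p - 1) := by
  rw [polySeries, shiftSeries, map_invSub, xv_succ]
  congr 1
  rw [map_sub, map_one]
  congr 1
  exact AH.poly_X p

theorem swapAt_mul_shiftSeries {a : ℕ} (ha : a + 1 < r) :
    PowerSeries.C (AH.perm (swapAt r a (a + 1))) * polySeries (shiftSeries k r a)
      = polySeries (shiftSeries k r (a + 1)) * PowerSeries.C (AH.perm (swapAt r a (a + 1)))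
        + polySeries (shiftSeries k r (a + 1)) * polySeries (shiftSeries k r a) := by
  have e0 := polySeries_shiftSeries (k := k) (⟨a, by omega⟩ : Fin r)
  have e1 := polySeries_shiftSeries (k := k) (⟨a + 1, by omega⟩ : Fin r)
  simp only at e0 e1
  rw [e0, e1, swapAt, dif_pos ⟨by omega, ha⟩]
  refine s_invSub ?_
  rw [mul_sub, AH.s_x rfl]
  noncomm_ring

theorem swapAt_symm (a b : ℕ) : swapAt r a b = swapAt r b a := by
  rw [swapAt, swapAt]
  by_cases h : a < r ∧ b < r
  · rw [dif_pos h, dif_pos h.symm, Equiv.swap_comm]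
  · rw [dif_neg h, dif_neg fun h' => h h'.symm]

variable (k r) in
/-- The factor `1/(u-x_p) ⋅ ∏_{q > p} (1 + 1/(u-x_q))`, where `p` is the position number `l`,
counted from `0`, in the block with label `j`, and `q` runs over the first `L` positions of this
block. -/
noncomputable def tailSeries (μ : Fin n → ℕ) (j : Fin n) (L l : ℕ) :
    PowerSeries (MvPolynomial (Fin r) k) :=
  posSeries k r (offset μ j + l) * ∏ l' ∈ Finset.Ico (l + 1) L, (1 + posSeries k r (offset μ j + l'))

variable (k r) in
/-- The factor in `chainSeries` that comes from the block with label `j`, if a label in this block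
is replaced by `x ≠ j`. -/
noncomputable def jumpSeries (μ : Fin n → ℕ) (x j : Fin n) :
    PowerSeries (MvPolynomial (Fin r) k) :=
  if x < j then invSub (xv k r (blockStart μ j))
  else (∏ p ∈ Finset.Ico (blockStart μ j) (blockEnd μ j), (1 + invSub (xv k r p)))
    * invSub (xv k r (blockEnd μ j))

theorem prod_Ico_blockStart (μ : Fin n → ℕ) (j : Fin n) (e : ℕ) :
    ∏ p ∈ Finset.Ico (blockStart μ j) (blockStart μ j + e), (1 + invSub (xv k r p))
      = ∏ l ∈ Finset.range e, (1 + posSeries k r (offset μ j + l)) := by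
  rw [Finset.prod_Ico_eq_prod_range, Nat.add_sub_cancel_left]
  refine Finset.prod_congr rfl fun l _ => ?_
  rw [posSeries, blockStart_eq]
  congr 3
  omega

theorem jumpSeries_of_gt {μ : Fin n → ℕ} {x j : Fin n} (hx : j < x) (hj : 0 < μ j) :
    jumpSeries k r μ x j = shiftSeries k r (offset μ j + μ j - 1)
      * ∏ l ∈ Finset.range (μ j), (1 + posSeries k r (offset μ j + l)) := by
  rw [jumpSeries, if_neg hx.not_gt, show blockEnd μ j = blockStart μ j + (μ j - 1) by
    rw [blockEnd_eq, blockStart_eq]; omega, prod_Ico_blockStart,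
    show blockStart μ j + (μ j - 1) = offset μ j + (μ j - 1) + 1 by rw [blockStart_eq]; omega]
  change (∏ l ∈ Finset.range (μ j - 1), (1 + posSeries k r (offset μ j + l))) *
    posSeries k r (offset μ j + (μ j - 1)) = _
  have e3 := shiftSeries_mul (k := k) (r := r) (offset μ j + (μ j - 1))
  have hprod : ∏ l ∈ Finset.range (μ j), (1 + posSeries k r (offset μ j + l))
      = (∏ l ∈ Finset.range (μ j - 1), (1 + posSeries k r (offset μ j + l)))
        * (1 + posSeries k r (offset μ j + (μ j - 1))) := by
    rw [← Finset.prod_range_succ (fun l => 1 + posSeries k r (offset μ j + l)),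
      show μ j - 1 + 1 = μ j by omega]
  rw [hprod, show offset μ j + μ j - 1 = offset μ j + (μ j - 1) by omega]
  linear_combination (-∏ l ∈ Finset.range (μ j - 1), (1 + posSeries k r (offset μ j + l))) * e3

variable (k r) in
/-- The sum of the block cycles, in `AH_r`. -/
noncomputable def jumpSum (μ : Fin n → ℕ) (x j : Fin n) : AH k r :=
  ∑ l ∈ Finset.range (μ j), AH.perm (blockCyc r μ x j l)

variable (k) in
/-- The product of the `1 + 1/(u-x_p)` over a block is invariant under the Young subgroup. -/
theorem seriesInvariant_block {μ : Fin n → ℕ} (hμ : ∑ a, μ a = r) (j : Fin n) :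
    SeriesInvariant k (blockLabel μ hμ)
      (∏ l ∈ Finset.range (μ j), (1 + posSeries k r (offset μ j + l))) := by
  have h : ∏ l ∈ Finset.range (μ j), (1 + posSeries k r (offset μ j + l))
      = ∏ p ∈ Finset.univ.filter fun p => blockLabel μ hμ p = j,
        (1 + invSub (MvPolynomial.X p : MvPolynomial (Fin r) k)) := by
    symm
    refine Finset.prod_bij (fun p _ => (p : ℕ) - offset μ j) ?_ ?_ ?_ ?_
    · intro p hp
      rw [Finset.mem_filter, blockLabel_eq_iff] at hp
      rw [Finset.mem_range]; omega
    · intro p hp q hq hpq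
      rw [Finset.mem_filter, blockLabel_eq_iff] at hp hq
      exact Fin.ext (by omega)
    · intro l hl
      rw [Finset.mem_range] at hl
      have := offset_add_le hμ j
      refine ⟨⟨offset μ j + l, by omega⟩, ?_, by simp⟩
      rw [Finset.mem_filter, blockLabel_eq_iff]
      exact ⟨Finset.mem_univ _, by simp, by simpa using hl⟩
    · intro p hp
      rw [Finset.mem_filter, blockLabel_eq_iff] at hp
      rw [posSeries, Nat.add_sub_cancel' hp.2.1, xv_succ]
  rw [h]
  refine seriesInvariant_prod fun w hw p hp => ?_
  simpa [mem_stab.1 hw p] using hp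

/-- The sum over all ways to replace one label of a block by a smaller one. -/
theorem sum_setAt_of_lt {μ : Fin n → ℕ} (hμ : ∑ a, μ a = r) {x j : Fin n} (hx : x < j)
    {ρ : Fin r → Fin n} (hρ : ∀ p, blockLabel μ hμ p = j → ρ p = j) (h : PowerSeries (AH k r)) :
    ∑ l ∈ Finset.range (μ j), btenSeries (setAt (offset μ j + l) x ρ)
        (polySeries (tailSeries k r μ j (μ j) l) * h)
      = btenSeries (upd μ x j ρ)
        (polySeries (jumpSeries k r μ x j) * PowerSeries.C (jumpSum k r μ x j) * h) := by
  have hr := offset_add_le hμ j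
  have hpos : ∀ l, pos μ x j l = offset μ j + l := fun l => by rw [pos, if_pos hx]
  have main := sum_cycle_mul (polySeries (k := k) (r := r)) (btenSeries (upd μ x j ρ)) (μ j)
    (fun l => posSeries k r (offset μ j + l))
    (fun l => PowerSeries.C (AH.perm (swapAt r (offset μ j + l) (offset μ j + l + 1))))
    (fun l => PowerSeries.C (AH.perm (blockCyc r μ x j l)))
    (by simp [blockCyc, cyc])
    (by intro l; simp only [blockCyc, cyc, map_mul, hpos, add_assoc])
    (by intro l hl; exact posSeries_mul_swapAt (by omega))
    (by
      intro l l' hll hl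
      have hlr : offset μ j + l < r := by omega
      exact polySeries_mul_swapAt (polySeries_posSeries ⟨offset μ j + l, hlr⟩)
        (x_mul_swapAt (by simp only []; omega) (by simp only []; omega)))
    (by
      intro l l' hll hl
      rw [← map_mul, ← map_mul, ← map_mul, ← map_mul,
        swapAt_comm (by omega) (by omega) (by omega) (by omega)])
    (by
      intro l hl0 hl h
      refine btenSeries_perm_mul (swapAt_mem_stab fun p q hp hq => ?_) h
      have e1 : upd μ x j ρ p = ρ p := by
        rw [upd, if_neg]; rw [hpos]; omega
      have e2 : upd μ x j ρ q = ρ q := by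
        rw [upd, if_neg]; rw [hpos]; omega
      rw [e1, e2, hρ p ((blockLabel_eq_iff hμ p j).2 (by omega)),
        hρ q ((blockLabel_eq_iff hμ q j).2 (by omega))])
    h
  rw [jumpSeries, if_pos hx, jumpSum, map_sum, Finset.mul_sum, Finset.sum_mul, map_sum]
  refine Eq.trans (Finset.sum_congr rfl fun l hl => ?_) main
  rw [← hpos l, setAt_pos_eq hμ hx.ne hρ (Finset.mem_range.1 hl), btenSeries_comp, tailSeries,
    mul_assoc, hpos]

/-- The sum over all ways to replace one label of a block by a larger one. This is the mirror image
of `sum_setAt_of_lt`, after division by the product of the `1 + 1/(u-x_p)` over the block. -/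
theorem sum_setAt_of_gt {μ : Fin n → ℕ} (hμ : ∑ a, μ a = r) {x j : Fin n} (hx : j < x)
    {ρ : Fin r → Fin n} (hρ : ∀ p, blockLabel μ hμ p = j → ρ p = j) (h : PowerSeries (AH k r)) :
    ∑ l ∈ Finset.range (μ j), btenSeries (setAt (offset μ j + l) x ρ)
        (polySeries (tailSeries k r μ j (μ j) l) * h)
      = btenSeries (upd μ x j ρ)
        (polySeries (jumpSeries k r μ x j) * PowerSeries.C (jumpSum k r μ x j) * h) := by
  have hr := offset_add_le hμ j
  have hpos : ∀ l, pos μ x j l = offset μ j + μ j - 1 - l := fun l => by rw [pos, if_neg hx.not_gt]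
  have hswap : ∀ l, l + 1 < μ j → swapAt r (pos μ x j l) (pos μ x j (l + 1))
      = swapAt r (offset μ j + μ j - 1 - (l + 1)) (offset μ j + μ j - 1 - (l + 1) + 1) := by
    intro l hl
    rw [swapAt_symm, hpos, hpos]
    congr 1
    omega
  set α := offset μ j with hα
  set Q : PowerSeries (MvPolynomial (Fin r) k) :=
    ∏ l ∈ Finset.range (μ j), (1 + posSeries k r (α + l)) with hQ
  have main := sum_cycle_mul (polySeries (k := k) (r := r)) (btenSeries (upd μ x j ρ)) (μ j)
    (fun l => -shiftSeries k r (α + μ j - 1 - l))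
    (fun l => PowerSeries.C (AH.perm (swapAt r (pos μ x j l) (pos μ x j (l + 1)))))
    (fun l => PowerSeries.C (AH.perm (blockCyc r μ x j l)))
    (by simp [blockCyc, cyc])
    (by intro l; simp only [blockCyc, cyc, map_mul])
    (by
      intro l hl
      have e : α + μ j - 1 - (l + 1) + 1 = α + μ j - 1 - l := by omega
      have := swapAt_mul_shiftSeries (k := k) (r := r) (a := α + μ j - 1 - (l + 1)) (by omega)
      simp only [hswap l hl, map_neg, mul_neg, neg_mul, neg_neg]
      rw [this, e]
      abel)
    (by
      intro l l' hll hl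
      rw [hswap l' hl, map_neg, neg_mul, mul_neg]
      congr 1
      have hlr : α + μ j - 1 - l < r := by omega
      refine polySeries_mul_swapAt (polySeries_shiftSeries ⟨α + μ j - 1 - l, hlr⟩) ?_
      rw [sub_mul, mul_sub,
        x_mul_swapAt (by simp only []; omega) (by simp only []; omega), one_mul, mul_one])
    (by
      intro l l' hll hl
      rw [← map_mul, ← map_mul, ← map_mul, ← map_mul, hpos, hpos, hpos, hpos,
        swapAt_comm (by omega) (by omega) (by omega) (by omega)])
    (by
      intro l hl0 hl h
      refine btenSeries_perm_mul (swapAt_mem_stab fun p q hp hq => ?_) h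
      rw [hpos] at hp hq
      have e1 : upd μ x j ρ p = ρ p := by
        rw [upd, if_neg]; rw [hpos]; omega
      have e2 : upd μ x j ρ q = ρ q := by
        rw [upd, if_neg]; rw [hpos]; omega
      rw [e1, e2, hρ p ((blockLabel_eq_iff hμ p j).2 (by omega)),
        hρ q ((blockLabel_eq_iff hμ q j).2 (by omega))])
    (polySeries Q * h)
  have hQr : Q = ∏ l ∈ Finset.range (μ j), (1 + posSeries k r (α + μ j - 1 - l)) := by
    rw [hQ, ← Finset.prod_range_reflect]
    refine Finset.prod_congr rfl fun l hl => ?_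
    rw [Finset.mem_range] at hl
    rw [show α + (μ j - 1 - l) = α + μ j - 1 - l by omega]
  -- the left hand side, term by term
  have hleft : ∀ l < μ j,
      (-shiftSeries k r (α + μ j - 1 - l) * ∏ l' ∈ Finset.Ico (l + 1) (μ j),
        (1 + -shiftSeries k r (α + μ j - 1 - l'))) * Q = -tailSeries k r μ j (μ j) (μ j - 1 - l) := by
    intro l hl
    have e1 : (∏ l' ∈ Finset.Ico (l + 1) (μ j), (1 + -shiftSeries k r (α + μ j - 1 - l')))
        * ∏ l' ∈ Finset.Ico (l + 1) (μ j), (1 + posSeries k r (α + μ j - 1 - l')) = 1 := by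
      rw [← Finset.prod_mul_distrib]
      refine Finset.prod_eq_one fun l' _ => ?_
      rw [← sub_eq_add_neg, one_sub_shiftSeries_mul]
    have e2 : ∏ l' ∈ Finset.Ico (μ j - 1 - l + 1) (μ j), (1 + posSeries k r (α + l'))
        = ∏ l' ∈ Finset.range l, (1 + posSeries k r (α + μ j - 1 - l')) := by
      refine Finset.prod_nbij' (fun l' => μ j - 1 - l') (fun l' => μ j - 1 - l') ?_ ?_ ?_ ?_ ?_
      · intro a ha; simp only [Finset.mem_Ico, Finset.mem_range] at ha ⊢; omega
      · intro a ha; simp only [Finset.mem_Ico, Finset.mem_range] at ha ⊢; omega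
      · intro a ha; simp only [Finset.mem_Ico] at ha ⊢; omega
      · intro a ha; simp only [Finset.mem_range] at ha ⊢; omega
      · intro a ha
        simp only [Finset.mem_Ico] at ha
        rw [show α + μ j - 1 - (μ j - 1 - a) = α + a by omega]
    rw [hQr, ← Finset.prod_range_mul_prod_Ico _ (show l + 1 ≤ μ j by omega),
      Finset.prod_range_succ, tailSeries, ← hα, e2, show α + (μ j - 1 - l) = α + μ j - 1 - l by omega]
    have e3 := shiftSeries_mul (k := k) (r := r) (α + μ j - 1 - l)
    linear_combination (-(∏ l' ∈ Finset.range l, (1 + posSeries k r (α + μ j - 1 - l'))) *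
      shiftSeries k r (α + μ j - 1 - l) * (1 + posSeries k r (α + μ j - 1 - l))) * e1
      - (∏ l' ∈ Finset.range l, (1 + posSeries k r (α + μ j - 1 - l'))) * e3
  rcases Nat.eq_zero_or_pos (μ j) with hj0 | hj0
  · rw [jumpSum, hj0]; simp
  have hright : -shiftSeries k r (α + μ j - 1) * Q = -jumpSeries k r μ x j := by
    rw [jumpSeries_of_gt hx hj0, neg_mul]
  rw [jumpSum, map_sum, Finset.mul_sum, Finset.sum_mul, map_sum, ← Finset.sum_range_reflect]
  have main' := congrArg Neg.neg main
  rw [← Finset.sum_neg_distrib, ← Finset.sum_neg_distrib] at main'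
  refine Eq.trans (Finset.sum_congr rfl fun l hl => ?_)
    (main'.trans (Finset.sum_congr rfl fun l hl => ?_))
  · rw [Finset.mem_range] at hl
    rw [show α + (μ j - 1 - l) = pos μ x j l by rw [hpos]; omega,
      setAt_pos_eq hμ hx.ne' hρ hl, btenSeries_comp]
    rw [← map_neg]
    congr 1
    rw [← mul_assoc _ (polySeries Q) h, mul_assoc _ _ (polySeries Q), ← map_mul polySeries,
      hleft l hl, map_neg]
    simp only [neg_mul, mul_neg, neg_neg, mul_assoc]
  · rw [Finset.mem_range] at hl
    have hw : blockCyc r μ x j l ∈ stab (blockLabel μ hμ) :=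
      blockCyc_mem_stab hμ x hl fun p q hp hq => by rw [hp, hq]
    have hcomm := perm_mul_polySeries (blockLabel_mono hμ) (seriesInvariant_block k hμ j) hw
    rw [← hα, ← hQ] at hcomm
    rw [← map_neg, Nat.sub_zero, mul_assoc, ← mul_assoc _ (polySeries Q) h, hcomm,
      mul_assoc (polySeries Q), ← mul_assoc (polySeries (-shiftSeries k r (α + μ j - 1))), ← map_mul,
      hright]
    simp only [map_neg, neg_mul, neg_neg, mul_assoc]

theorem sum_setAt {μ : Fin n → ℕ} (hμ : ∑ a, μ a = r) {x j : Fin n} (hx : x ≠ j)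
    {ρ : Fin r → Fin n} (hρ : ∀ p, blockLabel μ hμ p = j → ρ p = j) (h : PowerSeries (AH k r)) :
    ∑ l ∈ Finset.range (μ j), btenSeries (setAt (offset μ j + l) x ρ)
        (polySeries (tailSeries k r μ j (μ j) l) * h)
      = btenSeries (upd μ x j ρ)
        (polySeries (jumpSeries k r μ x j) * PowerSeries.C (jumpSum k r μ x j) * h) :=
  hx.lt_or_gt.elim (fun hx => sum_setAt_of_lt hμ hx hρ h) (fun hx => sum_setAt_of_gt hμ hx hρ h)

end Jump

/-! ### The action of the monodromy matrix, block by block -/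

section Monodromy
variable {k : Type*} [CommRing k] {n r : ℕ}

/-- The coefficients of the image of `v_m ⊗ 1` under a power series of operators, in the induced
tensor space. -/
noncomputable def evSeries (m : Fin r → Fin n) :
    PowerSeries (EndTensor k n r) →+ (ℕ → InducedTensor k n r) where
  toFun Φ d := (balanced k n r).mkQ (PowerSeries.coeff d Φ (ten m 1))
  map_zero' := by funext d; simp
  map_add' f g := by
    funext d
    simp only [map_add, LinearMap.add_apply, Pi.add_apply]

/-- Left multiplication by the coefficients of a power series. -/
noncomputable def lmulSeries : PowerSeries (AH k r) →+* PowerSeries (EndTensor k n r) :=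
  PowerSeries.map (lmul : AH k r →ₐ[k] EndTensor k n r).toRingHom

theorem evSeries_lmulSeries (m : Fin r → Fin n) (h : PowerSeries (AH k r)) :
    evSeries m (lmulSeries h) = btenSeries m h := by
  funext d
  change (balanced k n r).mkQ (PowerSeries.coeff d (lmulSeries h) (ten m 1)) = _
  rw [lmulSeries, PowerSeries.coeff_map, btenSeries_apply, bten]
  congr 1
  exact (lmul_ten _ _ _).trans (by rw [mul_one])

theorem evSeries_mul_C_eOp (m : Fin r → Fin n) (Φ : PowerSeries (EndTensor k n r)) (p : Fin r)
    (x l : Fin n) : evSeries m (Φ * PowerSeries.C (eOp p x l))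
      = if m p = l then evSeries (Function.update m p x) Φ else 0 := by
  funext d
  change (balanced k n r).mkQ
    (PowerSeries.coeff d (Φ * PowerSeries.C (eOp p x l : EndTensor k n r)) (ten m 1)) = _
  rw [PowerSeries.coeff_mul_C, Module.End.mul_apply, eOp_ten]
  split_ifs
  · rfl
  · rw [map_zero, map_zero]; rfl

theorem C_eOp_mul_lmulSeries (p : Fin r) (x l : Fin n) (h : PowerSeries (AH k r)) :
    PowerSeries.C (eOp p x l) * lmulSeries h = lmulSeries h * PowerSeries.C (eOp p x l) := by
  ext1 d
  rw [PowerSeries.coeff_C_mul, PowerSeries.coeff_mul_C, lmulSeries, PowerSeries.coeff_map]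
  exact (lmul_eOp _ _ _ _).symm

theorem invSub_lmul (p : Fin r) :
    (invSub (lmul (AH.x p)) : PowerSeries (EndTensor k n r))
      = lmulSeries (polySeries (posSeries k r p)) := by
  rw [polySeries_posSeries, lmulSeries, map_invSub]
  rfl

variable (k n r) in
/-- The product of the factors of the monodromy matrix for the first `q` positions. -/
noncomputable def partialMonodromy (q : ℕ) :
    Matrix (Fin n) (Fin n) (PowerSeries (EndTensor k n r)) :=
  ((List.ofFn (factor k n r)).take q).prod

theorem partialMonodromy_zero : partialMonodromy k n r 0 = 1 := by
  simp [partialMonodromy]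

theorem partialMonodromy_self : partialMonodromy k n r r = monodromy k n r := by
  rw [partialMonodromy, monodromy, List.take_of_length_le (by simp)]

theorem partialMonodromy_succ (p : Fin r) :
    partialMonodromy k n r (p + 1) = partialMonodromy k n r p * factor k n r p := by
  rw [partialMonodromy, partialMonodromy, List.prod_take_succ _ _ (by simp)]
  simp

/-- The action of one more factor. -/
theorem evSeries_partialMonodromy_succ (m : Fin r → Fin n) (p : Fin r) (i l : Fin n)
    (h : PowerSeries (AH k r)) :
    evSeries m (partialMonodromy k n r (p + 1) i l * lmulSeries h)
      = evSeries m (partialMonodromy k n r p i l * lmulSeries h)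
        + if m p = l then ∑ x, evSeries (setAt p x m)
            (partialMonodromy k n r p i x * lmulSeries (polySeries (posSeries k r p) * h)) else 0 := by
  have h1 : ∀ x, partialMonodromy k n r p i x * factor k n r p x l * lmulSeries h
      = (if x = l then partialMonodromy k n r p i x * lmulSeries h else 0)
        + partialMonodromy k n r p i x * lmulSeries (polySeries (posSeries k r p) * h)
          * PowerSeries.C (eOp p x l) := by
    intro x
    rw [factor, LOp, invSub_lmul, mul_add, add_mul]
    congr 1
    · split_ifs
      · rw [mul_one]
      · rw [mul_zero, zero_mul]
    · rw [mul_assoc, mul_assoc, ← map_mul, C_eOp_mul_lmulSeries, ← mul_assoc]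
  rw [partialMonodromy_succ, Matrix.mul_apply, Finset.sum_mul, Finset.sum_congr rfl fun x _ => h1 x,
    Finset.sum_add_distrib, map_add, Finset.sum_ite_eq', if_pos (Finset.mem_univ l), map_sum]
  simp only [evSeries_mul_C_eOp, setAt_eq_update]
  congr 1
  split_ifs
  · rfl
  · exact Finset.sum_const_zero

/-- Positions with labels other than `l` do not contribute to column `l`. -/
theorem evSeries_partialMonodromy_skip (m : Fin r → Fin n) (i l : Fin n) {q q' : ℕ} (hq : q ≤ q')
    (hr : q' ≤ r) (hm : ∀ p : Fin r, q ≤ p → (p : ℕ) < q' → m p ≠ l) (h : PowerSeries (AH k r)) :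
    evSeries m (partialMonodromy k n r q' i l * lmulSeries h)
      = evSeries m (partialMonodromy k n r q i l * lmulSeries h) := by
  induction q', hq using Nat.le_induction with
  | base => rfl
  | succ q' hq ih =>
    rw [← ih (by omega) fun p h1 h2 => hm p h1 (by omega)]
    have := evSeries_partialMonodromy_succ m ⟨q', hr⟩ i l h
    simp only [] at this
    rw [this, if_neg (hm ⟨q', hr⟩ hq (by simp)), add_zero]

theorem evSeries_partialMonodromy_of_lt (m : Fin r → Fin n) (i l : Fin n) {q : ℕ} (hr : q ≤ r)
    (hm : ∀ p : Fin r, (p : ℕ) < q → m p ≠ l) (h : PowerSeries (AH k r)) :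
    evSeries m (partialMonodromy k n r q i l * lmulSeries h)
      = if i = l then btenSeries m h else 0 := by
  rw [evSeries_partialMonodromy_skip m i l (Nat.zero_le q) hr (fun p _ => hm p),
    partialMonodromy_zero, Matrix.one_apply]
  split_ifs
  · rw [one_mul, evSeries_lmulSeries]
  · rw [zero_mul, map_zero]

/-- The action of the factors for the first `L` positions of a block whose labels are all equal
to `j`: either all labels are preserved, or the leftmost label that is affected is replaced by
some `x ≠ j`. -/
theorem evSeries_partialMonodromy_block (μ : Fin n → ℕ) (i j : Fin n) (L : ℕ)
    (hr : offset μ j + L ≤ r) (m : Fin r → Fin n)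
    (hm : ∀ p : Fin r, offset μ j ≤ p → (p : ℕ) < offset μ j + L → m p = j)
    (h : PowerSeries (AH k r)) :
    evSeries m (partialMonodromy k n r (offset μ j + L) i j * lmulSeries h)
      = evSeries m (partialMonodromy k n r (offset μ j) i j * lmulSeries
          (polySeries (∏ l ∈ Finset.range L, (1 + posSeries k r (offset μ j + l))) * h))
        + ∑ x ∈ Finset.univ.erase j, ∑ l ∈ Finset.range L,
          evSeries (setAt (offset μ j + l) x m) (partialMonodromy k n r (offset μ j) i x *
            lmulSeries (polySeries (tailSeries k r μ j L l) * h)) := by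
  induction L generalizing h with
  | zero => simp
  | succ L ih =>
    have ih' := ih (by omega) (fun p h1 h2 => hm p h1 (by omega))
    have hq : offset μ j + L < r := by omega
    have hstep := evSeries_partialMonodromy_succ m ⟨offset μ j + L, hq⟩ i j h
    simp only [] at hstep
    rw [if_pos (hm ⟨offset μ j + L, hq⟩ (by simp) (by simp)),
      ← Finset.add_sum_erase _ _ (Finset.mem_univ j)] at hstep
    have hself : setAt (offset μ j + L) j m = m := by
      funext p
      rw [setAt]
      split_ifs with hp
      · exact (hm p (by omega) (by omega)).symm
      · rfl
    have hskip : ∀ x ∈ Finset.univ.erase j,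
        evSeries (setAt (offset μ j + L) x m) (partialMonodromy k n r (offset μ j + L) i x *
            lmulSeries (polySeries (posSeries k r (offset μ j + L)) * h))
          = evSeries (setAt (offset μ j + L) x m) (partialMonodromy k n r (offset μ j) i x *
            lmulSeries (polySeries (tailSeries k r μ j (L + 1) L) * h)) := by
      intro x hx
      rw [evSeries_partialMonodromy_skip _ i x (Nat.le_add_right _ L) (by omega), tailSeries,
        Finset.Ico_self, Finset.prod_empty, mul_one]
      intro p h1 h2
      rw [setAt, if_neg (by omega), hm p h1 (by omega)]
      exact (Finset.ne_of_mem_erase hx).symm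
    rw [hself, Finset.sum_congr rfl hskip] at hstep
    have htail : ∀ l ∈ Finset.range L, tailSeries k r μ j (L + 1) l
        = tailSeries k r μ j L l * (1 + posSeries k r (offset μ j + L)) := by
      intro l hl
      rw [tailSeries, tailSeries, Finset.prod_Ico_succ_top (by rw [Finset.mem_range] at hl; omega),
        mul_assoc]
    rw [← add_assoc (offset μ j) L 1, hstep, ← add_assoc]
    simp only [Finset.sum_range_succ (n := L), Finset.sum_add_distrib, ← add_assoc]
    congr 1
    rw [← map_add, ← mul_add, ← map_add lmulSeries]
    nth_rw 1 [← one_mul h]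
    rw [← add_mul, ← map_one polySeries, ← map_add polySeries, ih', Finset.prod_range_succ,
      map_mul polySeries, mul_assoc]
    rw [add_right_inj]
    refine Finset.sum_congr rfl fun x _ => Finset.sum_congr rfl fun l hl => ?_
    rw [htail l hl, map_mul polySeries, mul_assoc (polySeries _)]

end Monodromy

/-! ### Summation over chains -/

section Chains
variable {k : Type*} [CommRing k] {n r : ℕ}

/-- The labelling obtained from `m` by the replacements that belong to a chain: one label `j_1` is
replaced by `i` (if `i ≠ j_1`) and one label `j_{l+1}` is replaced by `j_l`. -/
def chainLabel (μ : Fin n → ℕ) (i : Fin n) :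
    {s : ℕ} → (Fin (s + 1) → Fin n) → (Fin r → Fin n) → Fin r → Fin n
  | 0, c, m => upd μ i (c 0) m
  | s + 1, c, m => upd μ (c (Fin.last s).castSucc) (c (Fin.last (s + 1)))
      (chainLabel μ i (Fin.init c) m)

variable (k r) in
/-- The product of the sums of block cycles over the blocks in which a label is replaced. -/
noncomputable def chainSum (μ : Fin n → ℕ) (i : Fin n) : {s : ℕ} → (Fin (s + 1) → Fin n) → AH k r
  | 0, c => if i = c 0 then 1 else jumpSum k r μ i (c 0)
  | s + 1, c => jumpSum k r μ (c (Fin.last s).castSucc) (c (Fin.last (s + 1)))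
      * chainSum μ i (Fin.init c)

theorem sum_chains_zero {M : Type*} [AddCommMonoid M] (i j : Fin n) (F : (Fin 1 → Fin n) → M) :
    ∑ c ∈ chains i j 0, F c = if j ≤ i then F (fun _ => j) else 0 := by
  have h : chains i j 0 = if j ≤ i then {fun _ => j} else ∅ := by
    ext c
    have hc : c = (fun _ => j) ↔ c 0 = j :=
      ⟨fun h => by rw [h], fun h => funext fun l => by rw [show l = 0 from Fin.ext (by omega), h]⟩
    have hlt : ∀ l m : Fin 1, ¬ l < m := by
      intro l m h; rw [Fin.lt_def] at h; omega
    split_ifs with hij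
    · simp only [chains, Finset.mem_filter, Finset.mem_univ, true_and, Finset.mem_singleton, hc]
      constructor
      · exact fun h => h.2.1
      · exact fun h => ⟨fun l m hlm => absurd hlm (hlt l m), h, h.trans_le hij⟩
    · simp only [chains, Finset.mem_filter, Finset.mem_univ, true_and, Finset.notMem_empty,
        iff_false]
      rintro ⟨-, h1, h2⟩
      exact hij (h1 ▸ h2)
  rw [h]
  split_ifs <;> simp

/-- Removing the last entry of a chain. -/
theorem sum_chains_succ {M : Type*} [AddCommMonoid M] (i j : Fin n) (s : ℕ)
    (F : (Fin (s + 2) → Fin n) → M) :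
    ∑ c ∈ chains i j (s + 1), F c = ∑ x ∈ Finset.univ.filter (· < j), ∑ c ∈ chains i x s,
      F (Fin.snoc (α := fun _ => Fin n) c j) := by
  rw [Finset.sum_sigma']
  symm
  refine Finset.sum_bij' (fun a _ => Fin.snoc (α := fun _ => Fin n) a.2 j)
    (fun c _ => (⟨c (Fin.last s).castSucc, Fin.init c⟩ : (_ : Fin n) × (Fin (s + 1) → Fin n)))
    ?_ ?_ ?_ ?_ ?_
  · rintro ⟨x, c⟩ h
    simp only [Finset.mem_sigma, chains, Finset.mem_filter, Finset.mem_univ, true_and] at h ⊢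
    obtain ⟨hx, h1, h2, h3⟩ := h
    refine ⟨?_, Fin.snoc_last _ _, ?_⟩
    · intro l m hlm
      induction l using Fin.lastCases with
      | last => exact absurd hlm (Fin.le_last m).not_gt
      | cast l =>
        rw [Fin.snoc_castSucc]
        induction m using Fin.lastCases with
        | last =>
          rw [Fin.snoc_last]
          refine lt_of_le_of_lt ?_ hx
          rcases (Fin.le_last l).lt_or_eq with hl | hl
          · exact h2 ▸ (h1 _ _ hl).le
          · rw [hl, h2]
        | cast m =>
          rw [Fin.snoc_castSucc]
          exact h1 _ _ hlm
    · have : (0 : Fin (s + 2)) = Fin.castSucc 0 := rfl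
      rw [this, Fin.snoc_castSucc]
      exact h3
  · intro c h
    simp only [Finset.mem_sigma, chains, Finset.mem_filter, Finset.mem_univ, true_and] at h ⊢
    obtain ⟨h1, h2, h3⟩ := h
    refine ⟨h2 ▸ h1 _ _ (Fin.castSucc_lt_last _), fun l m hlm => h1 _ _ hlm, rfl, h3⟩
  · rintro ⟨x, c⟩ h
    simp only [Finset.mem_sigma, chains, Finset.mem_filter, Finset.mem_univ, true_and] at h
    simp only [Fin.init_snoc, Fin.snoc_castSucc, h.2.2.1]
  · intro c h
    simp only [chains, Finset.mem_filter, Finset.mem_univ, true_and] at h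
    simp only []
    rw [← h.2.1]
    exact Fin.snoc_init_self c
  · intros; rfl

theorem chainSeries_zero (μ : Fin n → ℕ) (i : Fin n) (c : Fin 1 → Fin n) :
    chainSeries k r i c μ = if i = c 0 then
        ∏ l ∈ Finset.range (μ (c 0)), (1 + posSeries k r (offset μ (c 0) + l))
      else (∏ p ∈ Finset.Ico (blockStart μ (c 0)) (blockEnd μ (c 0)), (1 + invSub (xv k r p)))
        * invSub (xv k r (blockEnd μ (c 0))) := by
  rw [chainSeries, Finset.univ_eq_empty, Finset.prod_empty, mul_one]
  split_ifs
  · rw [← prod_Ico_blockStart]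
    congr 1
    ext p
    rw [Finset.mem_Icc, Finset.mem_Ico, blockStart_eq, blockEnd_eq]
    omega
  · rfl

theorem chainSeries_succ (μ : Fin n → ℕ) (i : Fin n) {s : ℕ} (c : Fin (s + 2) → Fin n) :
    chainSeries k r i c μ = chainSeries k r i (Fin.init c) μ
      * posSeries k r (offset μ (c (Fin.last (s + 1)))) := by
  rw [chainSeries, Fin.prod_univ_castSucc, ← mul_assoc]
  rfl

theorem seriesInvariant_posSeries {μ : Fin n → ℕ} (hμ : ∑ a, μ a = r) {B : Finset (Fin n)}
    {j : Fin n} (hj : j ∈ B) {l : ℕ} (hl : l < μ j) :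
    SeriesInvariant k (fixLabel (blockLabel μ hμ) B) (posSeries k r (offset μ j + l)) := by
  have := offset_add_le hμ j
  have h := xv_succ (k := k) (⟨offset μ j + l, by omega⟩ : Fin r)
  simp only [] at h
  rw [posSeries, h]
  refine seriesInvariant_invSub fun w hw => (mem_stab_fixLabel.1 hw).2 _ ?_
  rwa [(blockLabel_eq_iff hμ _ j).2 (by simp only []; omega)]

theorem seriesInvariant_block_fixLabel {μ : Fin n → ℕ} (hμ : ∑ a, μ a = r) {B : Finset (Fin n)}
    {j : Fin n} (hj : j ∈ B) {t : Finset ℕ} (ht : ∀ l ∈ t, l < μ j) :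
    SeriesInvariant k (fixLabel (blockLabel μ hμ) B)
      (∏ l ∈ t, (1 + posSeries k r (offset μ j + l))) :=
  SeriesInvariant.prod fun l hl => SeriesInvariant.one.add (seriesInvariant_posSeries hμ hj (ht l hl))

theorem seriesInvariant_tailSeries {μ : Fin n → ℕ} (hμ : ∑ a, μ a = r) {B : Finset (Fin n)}
    {j : Fin n} (hj : j ∈ B) {l : ℕ} (hl : l < μ j) :
    SeriesInvariant k (fixLabel (blockLabel μ hμ) B) (tailSeries k r μ j (μ j) l) :=
  (seriesInvariant_posSeries hμ hj hl).mul
    (seriesInvariant_block_fixLabel hμ hj fun _ hl' => (Finset.mem_Ico.1 hl').2)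

theorem jumpSum_eq_zero {μ : Fin n → ℕ} {j : Fin n} (hj : μ j = 0) (x : Fin n) :
    jumpSum k r μ x j = 0 := by
  rw [jumpSum, hj, Finset.range_zero, Finset.sum_empty]

/-- If the block `c l` in which a label has to be replaced is empty for some `l`, then `chainSeries`
does not have its intended meaning, but in this case `chainSum` vanishes. -/
theorem chainSum_eq_zero_or {μ : Fin n → ℕ} (hμ : ∑ a, μ a = r) (i : Fin n) {B : Finset (Fin n)}
    {s : ℕ} (c : Fin (s + 1) → Fin n) (hc : ∀ l, c l ∈ B) :
    chainSum k r μ i c = 0 ∨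
      SeriesInvariant k (fixLabel (blockLabel μ hμ) B) (chainSeries k r i c μ) := by
  induction s with
  | zero =>
    rw [chainSum, chainSeries_zero]
    split_ifs with hi
    · exact Or.inr (seriesInvariant_block_fixLabel hμ (hc 0) fun l hl => Finset.mem_range.1 hl)
    · rcases Nat.eq_zero_or_pos (μ (c 0)) with h0 | h0
      · exact Or.inl (jumpSum_eq_zero h0 i)
      · right
        have e : blockEnd μ (c 0) = blockStart μ (c 0) + (μ (c 0) - 1) := by
          rw [blockEnd_eq, blockStart_eq]; omega
        have e' : blockEnd μ (c 0) = offset μ (c 0) + (μ (c 0) - 1) + 1 := by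
          rw [blockEnd_eq]; omega
        refine SeriesInvariant.mul ?_ ?_
        · rw [e, prod_Ico_blockStart]
          refine seriesInvariant_block_fixLabel hμ (hc 0) fun l hl => ?_
          have := Finset.mem_range.1 hl
          omega
        · rw [e']
          exact seriesInvariant_posSeries hμ (hc 0) (by omega)
  | succ s ih =>
    rw [chainSum, chainSeries_succ]
    rcases Nat.eq_zero_or_pos (μ (c (Fin.last (s + 1)))) with h0 | h0
    · left; rw [jumpSum_eq_zero h0, zero_mul]
    rcases ih (Fin.init c) fun l => hc _ with h | h
    · left; rw [h, mul_zero]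
    · have h1 := seriesInvariant_posSeries (k := k) hμ (hc (Fin.last (s + 1))) h0
      rw [add_zero] at h1
      exact Or.inr (h.mul h1)

theorem jumpSum_comm {μ : Fin n → ℕ} (hμ : ∑ a, μ a = r) {B : Finset (Fin n)} (x : Fin n)
    {j : Fin n} (hj : j ∉ B) {f : PowerSeries (MvPolynomial (Fin r) k)}
    (hf : SeriesInvariant k (fixLabel (blockLabel μ hμ) B) f) :
    PowerSeries.C (jumpSum k r μ x j) * polySeries f
      = polySeries f * PowerSeries.C (jumpSum k r μ x j) := by
  rw [jumpSum, map_sum, Finset.sum_mul, Finset.mul_sum]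
  refine Finset.sum_congr rfl fun l hl => ?_
  rw [Finset.mem_range] at hl
  refine perm_mul_polySeries (fixLabel_mono (blockLabel_mono hμ) B) hf ?_
  refine mem_stab_fixLabel.2 ⟨blockCyc_mem_stab hμ x hl fun p q hp hq => by rw [hp, hq], ?_⟩
  exact fun p hp => blockCyc_of_ne hμ x hl fun h => hj (h ▸ hp)

theorem chainSum_comm {μ : Fin n → ℕ} (hμ : ∑ a, μ a = r) {B : Finset (Fin n)} (i : Fin n)
    {s : ℕ} (c : Fin (s + 1) → Fin n) (hc : ∀ l, c l ∉ B)
    {f : PowerSeries (MvPolynomial (Fin r) k)}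
    (hf : SeriesInvariant k (fixLabel (blockLabel μ hμ) B) f) :
    PowerSeries.C (chainSum k r μ i c) * polySeries f
      = polySeries f * PowerSeries.C (chainSum k r μ i c) := by
  induction s with
  | zero =>
    rw [chainSum]
    split_ifs
    · rw [map_one, one_mul, mul_one]
    · exact jumpSum_comm hμ i (hc 0) hf
  | succ s ih =>
    rw [chainSum, map_mul, mul_assoc, ih (Fin.init c) fun l => hc _, ← mul_assoc,
      jumpSum_comm hμ _ (hc _) hf, mul_assoc]

theorem chainLabel_of_ne {μ : Fin n → ℕ} (hμ : ∑ a, μ a = r) (i : Fin n) {s : ℕ}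
    (c : Fin (s + 1) → Fin n) (m : Fin r → Fin n) {p : Fin r}
    (hp : ∀ l, blockLabel μ hμ p ≠ c l) : chainLabel μ i c m p = m p := by
  induction s with
  | zero => exact upd_of_ne hμ i m (hp 0)
  | succ s ih =>
    rw [chainLabel, upd_of_ne hμ _ _ (hp _)]
    exact ih (Fin.init c) fun l => hp _

theorem chainLabel_setAt {μ : Fin n → ℕ} (hμ : ∑ a, μ a = r) (i x : Fin n) {s : ℕ}
    (c : Fin (s + 1) → Fin n) (m : Fin r → Fin n) {q : Fin r}
    (hq : ∀ l, blockLabel μ hμ q ≠ c l) :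
    chainLabel μ i c (setAt q x m) = setAt q x (chainLabel μ i c m) := by
  have hupd : ∀ (y j : Fin n) (ρ : Fin r → Fin n), blockLabel μ hμ q ≠ j →
      upd μ y j (setAt q x ρ) = setAt q x (upd μ y j ρ) := by
    intro y j ρ hj
    funext p
    by_cases hp : p = q
    · rw [hp, upd_of_ne hμ _ _ hj, setAt, setAt, if_pos rfl, if_pos rfl]
    · have hp' : (p : ℕ) ≠ q := fun h => hp (Fin.ext h)
      rw [setAt, if_neg hp', upd, upd, setAt, if_neg hp']
  induction s with
  | zero => exact hupd _ _ _ (hq 0)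
  | succ s ih =>
    rw [chainLabel, ih (Fin.init c) fun l => hq _, hupd _ _ _ (hq _)]
    rfl

/-- The contribution of a chain `c` that ends in `x`, followed by the replacement of one label `j`
by `x`. -/
theorem sum_setAt_chain {μ : Fin n → ℕ} (hμ : ∑ a, μ a = r) (i : Fin n) {x j : Fin n} (hx : x < j)
    {s : ℕ} {c : Fin (s + 1) → Fin n} (hc : c ∈ chains i x s) {m : Fin r → Fin n}
    (hm : ∀ p, blockLabel μ hμ p = j → m p = j) (h : PowerSeries (AH k r)) :
    ∑ l ∈ Finset.range (μ j), btenSeries (chainLabel μ i c (setAt (offset μ j + l) x m))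
        (polySeries (chainSeries k r i c μ) * PowerSeries.C (chainSum k r μ i c)
          * (polySeries (tailSeries k r μ j (μ j) l) * h))
      = btenSeries (chainLabel μ i (Fin.snoc (α := fun _ => Fin n) c j) m)
        (polySeries (chainSeries k r i (Fin.snoc (α := fun _ => Fin n) c j) μ)
          * PowerSeries.C (chainSum k r μ i (Fin.snoc (α := fun _ => Fin n) c j)) * h) := by
  simp only [chains, Finset.mem_filter, Finset.mem_univ, true_and] at hc
  obtain ⟨hc1, hc2, -⟩ := hc
  have hcj : ∀ l, c l ≠ j := by
    intro l
    refine (lt_of_le_of_lt ?_ hx).ne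
    rcases (Fin.le_last l).lt_or_eq with hl | hl
    · exact hc2 ▸ (hc1 _ _ hl).le
    · rw [hl, hc2]
  rw [chainLabel, chainSum, chainSeries_succ, Fin.init_snoc, Fin.snoc_last, Fin.snoc_castSucc, hc2]
  rcases chainSum_eq_zero_or (k := k) hμ i (B := Finset.univ.erase j) c
    (fun l => Finset.mem_erase.2 ⟨hcj l, Finset.mem_univ _⟩) with h0 | hinv
  · simp only [h0, map_zero, mul_zero, zero_mul, Finset.sum_const_zero]
  have hr := offset_add_le hμ j
  have hρ : ∀ p, blockLabel μ hμ p = j → chainLabel μ i c m p = j := by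
    intro p hp
    rw [chainLabel_of_ne hμ i c m fun l => hp ▸ (hcj l).symm, hm p hp]
  have hjump : jumpSeries k r μ x j = posSeries k r (offset μ j) := by
    rw [jumpSeries, if_pos hx]; rfl
  have hcomm := jumpSum_comm hμ x (Finset.notMem_erase j _) hinv
  have main := sum_setAt hμ hx.ne hρ
    (polySeries (chainSeries k r i c μ) * PowerSeries.C (chainSum k r μ i c) * h)
  have hR : polySeries (jumpSeries k r μ x j) * PowerSeries.C (jumpSum k r μ x j)
        * (polySeries (chainSeries k r i c μ) * PowerSeries.C (chainSum k r μ i c) * h)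
      = polySeries (chainSeries k r i c μ * posSeries k r (offset μ j))
        * PowerSeries.C (jumpSum k r μ x j * chainSum k r μ i c) * h := by
    rw [hjump, mul_comm (chainSeries k r i c μ), map_mul polySeries, map_mul PowerSeries.C,
      mul_assoc (polySeries (posSeries k r (offset μ j))), ← mul_assoc (PowerSeries.C _),
      ← mul_assoc (PowerSeries.C _), hcomm]
    simp only [mul_assoc]
  rw [hR] at main
  rw [← main]
  refine Finset.sum_congr rfl fun l hl => ?_
  rw [Finset.mem_range] at hl
  have hlr : offset μ j + l < r := by omega
  have hlab : blockLabel μ hμ ⟨offset μ j + l, hlr⟩ = j :=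
    (blockLabel_eq_iff hμ _ j).2 (by simp only []; omega)
  have e := chainLabel_setAt hμ i x c m (q := ⟨offset μ j + l, hlr⟩)
    (fun l => by rw [hlab]; exact (hcj l).symm)
  simp only [] at e
  rw [e]
  congr 1
  have hc' := chainSum_comm hμ i c (B := {j}) (fun l => by simpa using hcj l)
    (seriesInvariant_tailSeries (k := k) hμ (Finset.mem_singleton_self j) hl)
  rw [← mul_assoc, mul_assoc (polySeries (chainSeries k r i c μ)), hc', ← mul_assoc, ← map_mul,
    mul_comm (chainSeries k r i c μ), map_mul]
  simp only [mul_assoc]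

end Chains

section Recursion
variable {k : Type*} [CommRing k] {n r : ℕ}

/-- The action of an entry of the monodromy matrix on a tensor, as a sum over chains. -/
theorem evSeries_eq_sum_chains {μ : Fin n → ℕ} (hμ : ∑ a, μ a = r) (i : Fin n) (N : ℕ) (j : Fin n)
    (hN : (j : ℕ) < N) (m : Fin r → Fin n)
    (hm : ∀ p, blockLabel μ hμ p ≤ j → m p = blockLabel μ hμ p) (h : PowerSeries (AH k r)) :
    evSeries m (partialMonodromy k n r (offset μ j + μ j) i j * lmulSeries h)
      = ∑ s ∈ Finset.range N, ∑ c ∈ chains i j s, btenSeries (chainLabel μ i c m)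
        (polySeries (chainSeries k r i c μ) * PowerSeries.C (chainSum k r μ i c) * h) := by
  induction N generalizing j m h with
  | zero => omega
  | succ N ih =>
    have hr := offset_add_le hμ j
    have hmj : ∀ p, blockLabel μ hμ p = j → m p = j := fun p hp => (hm p hp.le).trans hp
    have hlt : ∀ x, j ≤ x → ∀ p : Fin r, (p : ℕ) < offset μ j → m p ≠ x := by
      intro x hx p hp
      have h1 : blockLabel μ hμ p < j := by
        rw [← not_le, le_blockLabel_iff]; omega
      rw [hm p h1.le]
      exact (h1.trans_le hx).ne
    -- a label in the last block is replaced by a larger one, and the path started there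
    have hlarge : ∀ x, j < x → ∑ l ∈ Finset.range (μ j), evSeries (setAt (offset μ j + l) x m)
          (partialMonodromy k n r (offset μ j) i x *
            lmulSeries (polySeries (tailSeries k r μ j (μ j) l) * h))
        = if i = x then btenSeries (upd μ i j m) (polySeries (jumpSeries k r μ i j)
            * PowerSeries.C (jumpSum k r μ i j) * h) else 0 := by
      intro x hx
      have h1 : ∀ l ∈ Finset.range (μ j), evSeries (setAt (offset μ j + l) x m)
          (partialMonodromy k n r (offset μ j) i x *
            lmulSeries (polySeries (tailSeries k r μ j (μ j) l) * h))
          = if i = x then btenSeries (setAt (offset μ j + l) x m)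
            (polySeries (tailSeries k r μ j (μ j) l) * h) else 0 := by
        intro l _
        refine evSeries_partialMonodromy_of_lt _ i x (by omega) (fun p hp => ?_) _
        rw [setAt, if_neg (by omega)]
        exact hlt x hx.le p hp
      rw [Finset.sum_congr rfl h1]
      split_ifs with hi
      · rw [hi]
        exact sum_setAt hμ hx.ne' hmj h
      · exact Finset.sum_const_zero
    -- a label in the last block is replaced by a smaller one, and the path came from its block
    have hsmall : ∀ x, x < j → ∑ l ∈ Finset.range (μ j), evSeries (setAt (offset μ j + l) x m)
          (partialMonodromy k n r (offset μ j) i x *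
            lmulSeries (polySeries (tailSeries k r μ j (μ j) l) * h))
        = ∑ s ∈ Finset.range N, ∑ c ∈ chains i x s,
            btenSeries (chainLabel μ i (Fin.snoc (α := fun _ => Fin n) c j) m)
            (polySeries (chainSeries k r i (Fin.snoc (α := fun _ => Fin n) c j) μ)
              * PowerSeries.C (chainSum k r μ i (Fin.snoc (α := fun _ => Fin n) c j)) * h) := by
      intro x hx
      have hxj := offset_mono_of_lt μ hx
      have h1 : ∀ l ∈ Finset.range (μ j), evSeries (setAt (offset μ j + l) x m)
          (partialMonodromy k n r (offset μ j) i x *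
            lmulSeries (polySeries (tailSeries k r μ j (μ j) l) * h))
          = ∑ s ∈ Finset.range N, ∑ c ∈ chains i x s,
            btenSeries (chainLabel μ i c (setAt (offset μ j + l) x m))
              (polySeries (chainSeries k r i c μ) * PowerSeries.C (chainSum k r μ i c)
                * (polySeries (tailSeries k r μ j (μ j) l) * h)) := by
        intro l _
        have hset : ∀ p : Fin r, (p : ℕ) < offset μ j → setAt (offset μ j + l) x m p = m p :=
          fun p hp => by rw [setAt, if_neg (by omega)]
        rw [evSeries_partialMonodromy_skip _ i x hxj (by omega)]
        · refine ih x (by rw [Fin.lt_def] at hx; omega) _ (fun p hp => ?_) _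
          rw [blockLabel_le_iff'] at hp
          rw [hset p (by omega)]
          exact hm p ((blockLabel_le_iff' hμ p j).2 (by omega))
        · intro p hp1 hp2
          rw [hset p hp2, hm p ((blockLabel_le_iff' hμ p j).2 (by omega))]
          intro hpx
          have := (blockLabel_le_iff' hμ p x).1 hpx.le
          omega
      rw [Finset.sum_congr rfl h1, Finset.sum_comm]
      refine Finset.sum_congr rfl fun s _ => ?_
      rw [Finset.sum_comm]
      exact Finset.sum_congr rfl fun c hc => sum_setAt_chain hμ i hx hc hmj h
    have hsplit : (Finset.univ.erase j : Finset (Fin n))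
        = Finset.univ.filter (· < j) ∪ Finset.univ.filter (j < ·) := by
      ext x; simp
    have hdisj : Disjoint (Finset.univ.filter (· < j)) (Finset.univ.filter (j < ·)) := by
      rw [Finset.disjoint_left]
      intro x h1 h2
      simp only [Finset.mem_filter, Finset.mem_univ, true_and] at h1 h2
      exact lt_asymm h1 h2
    rw [evSeries_partialMonodromy_block μ i j (μ j) hr m
        (fun p h1 h2 => hmj p ((blockLabel_eq_iff hμ p j).2 ⟨h1, h2⟩)),
      evSeries_partialMonodromy_of_lt m i j (by omega) (hlt j le_rfl), hsplit,
      Finset.sum_union hdisj, Finset.sum_range_succ',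
      Finset.sum_congr rfl fun x hx => hsmall x (Finset.mem_filter.1 hx).2,
      Finset.sum_congr rfl fun x hx => hlarge x (Finset.mem_filter.1 hx).2, Finset.sum_comm]
    simp only [sum_chains_succ]
    rw [add_left_comm]
    refine congrArg₂ (· + ·) rfl ?_
    rw [Finset.sum_ite_eq, sum_chains_zero, chainSeries_zero, chainSum, chainLabel]
    rcases lt_trichotomy i j with hij | hij | hij
    · rw [if_neg hij.ne, if_neg (by simpa using hij.le), if_neg hij.not_ge, add_zero]
    · subst hij
      rw [if_pos rfl, if_neg (by simp), if_pos le_rfl, if_pos rfl, if_pos rfl, upd_self, map_one,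
        mul_one, add_zero]
    · rw [if_neg hij.ne', if_pos (by simpa using hij), if_pos hij.le, if_neg hij.ne', if_neg hij.ne',
        zero_add, jumpSeries, if_neg hij.not_gt]

end Recursion

/-! ### The matrix of a chain -/

section ChainMatrix
variable {k : Type*} [CommRing k] {n r : ℕ}

/-- The blocks in which a label is replaced are nonempty. -/
def ChainPos (μ : Fin n → ℕ) (i : Fin n) {s : ℕ} (c : Fin (s + 1) → Fin n) : Prop :=
  (i ≠ c 0 → 0 < μ (c 0)) ∧ ∀ l : Fin s, 0 < μ (c l.succ)

theorem ChainPos.init {μ : Fin n → ℕ} {i : Fin n} {s : ℕ} {c : Fin (s + 2) → Fin n}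
    (h : ChainPos μ i c) : ChainPos μ i (Fin.init c) :=
  ⟨h.1, fun l => h.2 l.castSucc⟩

theorem ChainPos.last {μ : Fin n → ℕ} {i : Fin n} {s : ℕ} {c : Fin (s + 2) → Fin n}
    (h : ChainPos μ i c) : 0 < μ (c (Fin.last (s + 1))) := h.2 (Fin.last s)

theorem strictMono_init {s : ℕ} {c : Fin (s + 2) → Fin n} (hc : StrictMono c) :
    StrictMono (Fin.init c) := fun _ _ h => hc h

/-- In the block of the last entry of a chain, the earlier replacements have no effect. -/
theorem chainLabel_init_of_last {μ : Fin n → ℕ} (hμ : ∑ a, μ a = r) (i : Fin n) {s : ℕ}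
    {c : Fin (s + 2) → Fin n} (hc : StrictMono c) {p : Fin r}
    (hp : blockLabel μ hμ p = c (Fin.last (s + 1))) :
    chainLabel μ i (Fin.init c) (blockLabel μ hμ) p = c (Fin.last (s + 1)) := by
  rw [chainLabel_of_ne hμ, hp]
  intro l
  rw [hp]
  exact (hc (Fin.castSucc_lt_last l)).ne'

theorem chainMatrix_zero (μ : Fin n → ℕ) (i : Fin n) (c : Fin 1 → Fin n) :
    chainMatrix i c μ = Matrix.diagonal (fun a => (μ a : ℤ))
      + (Matrix.single i (c 0) 1 - Matrix.single (c 0) (c 0) 1) := by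
  rw [chainMatrix, Finset.univ_eq_empty, Finset.sum_empty, add_zero]

theorem chainMatrix_succ (μ : Fin n → ℕ) (i : Fin n) {s : ℕ} (c : Fin (s + 2) → Fin n) :
    chainMatrix i c μ = chainMatrix i (Fin.init c) μ
      + (Matrix.single (c (Fin.last s).castSucc) (c (Fin.last (s + 1))) 1
        - Matrix.single (c (Fin.last (s + 1))) (c (Fin.last (s + 1))) 1) := by
  rw [chainMatrix, Fin.sum_univ_castSucc, ← add_assoc]
  rfl

/-- The numbers of positions with a given label and a given replacement. -/
def pairCount {α β : Type*} [DecidableEq α] [DecidableEq β] (m : Fin r → α) (ρ : Fin r → β)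
    (a : β) (b : α) : ℕ :=
  (Finset.univ.filter fun p => m p = b ∧ ρ p = a).card

theorem pairCount_upd {μ : Fin n → ℕ} (hμ : ∑ a, μ a = r) {x j : Fin n} (hj : x ≠ j → 0 < μ j)
    {ρ : Fin r → Fin n} (hρ : ∀ p, blockLabel μ hμ p = j → ρ p = j) (a b : Fin n) :
    (pairCount (blockLabel μ hμ) (upd μ x j ρ) a b : ℤ) = pairCount (blockLabel μ hμ) ρ a b
      + (Matrix.single x j 1 - Matrix.single j j 1 : Matrix (Fin n) (Fin n) ℤ) a b := by
  by_cases hx : x = j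
  · rw [hx, upd_self, sub_self]; simp
  have hj' := hj hx
  set P0 : Fin r := ⟨pos μ x j 0, pos_lt hμ x hj'⟩
  have hm0 : blockLabel μ hμ P0 = j := blockLabel_pos hμ x j hj' rfl
  have hupd : ∀ p, upd μ x j ρ p = if p = P0 then x else ρ p := by
    intro p
    rw [upd_eq_setAt hx hj', setAt]
    simp only [P0, Fin.ext_iff]
  rw [pairCount, pairCount, Finset.card_filter, Finset.card_filter]
  push_cast
  rw [← Finset.add_sum_erase _ _ (Finset.mem_univ P0),
    ← Finset.add_sum_erase (a := P0) _ (fun p => if blockLabel μ hμ p = b ∧ ρ p = a then (1 : ℤ) else 0)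
      (Finset.mem_univ P0),
    Finset.sum_congr rfl (g := fun p => if blockLabel μ hμ p = b ∧ ρ p = a then (1 : ℤ) else 0)
      fun p hp => by rw [hupd, if_neg (Finset.ne_of_mem_erase hp)],
    hupd, if_pos rfl, hm0, hρ P0 hm0, Matrix.sub_apply, Matrix.single_apply, Matrix.single_apply]
  simp only [and_comm (a := j = b)]
  ring

/-- The entries of the matrix of a chain count the positions of the tensor `m_μ` according to their
labels before and after the replacements. -/
theorem chainMatrix_apply {μ : Fin n → ℕ} (hμ : ∑ a, μ a = r) {i : Fin n} {s : ℕ}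
    {c : Fin (s + 1) → Fin n} (hc : StrictMono c) (hpos : ChainPos μ i c) (a b : Fin n) :
    chainMatrix i c μ a b
      = pairCount (blockLabel μ hμ) (chainLabel μ i c (blockLabel μ hμ)) a b := by
  induction s with
  | zero =>
    rw [chainMatrix_zero, chainLabel, pairCount_upd hμ hpos.1 (fun p hp => hp), Matrix.add_apply,
      Matrix.diagonal_apply, pairCount]
    congr 1
    split_ifs with hab
    · subst hab
      simp only [and_self, card_blockLabel]
    · rw [Finset.filter_eq_empty_iff.2, Finset.card_empty, Nat.cast_zero]
      rintro p - ⟨h1, h2⟩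
      exact hab (h2.symm.trans h1)
  | succ s ih =>
    rw [chainMatrix_succ, chainLabel, pairCount_upd hμ (fun _ => hpos.last)
      (fun p hp => chainLabel_init_of_last hμ i hc hp), Matrix.add_apply,
      ih (strictMono_init hc) hpos.init]

theorem sum_chainMatrix_row (μ : Fin n → ℕ) (i : Fin n) {s : ℕ} (c : Fin (s + 1) → Fin n)
    (a : Fin n) : ∑ b, chainMatrix i c μ a b
      = (μ a : ℤ) + (Pi.single i 1 : Fin n → ℤ) a - (Pi.single (c (Fin.last s)) 1 : Fin n → ℤ) a := by
  have hs : ∀ x y : Fin n, ∑ b, (Matrix.single x y 1 : Matrix (Fin n) (Fin n) ℤ) a b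
      = (Pi.single x 1 : Fin n → ℤ) a := by
    intro x y
    simp only [Matrix.single_apply, Pi.single_apply, eq_comm (a := x)]
    by_cases h : a = x <;> simp [h]
  induction s with
  | zero =>
    rw [chainMatrix_zero]
    simp only [Matrix.add_apply, Matrix.sub_apply, Finset.sum_add_distrib, Finset.sum_sub_distrib,
      hs, Matrix.diagonal_apply, Finset.sum_ite_eq, Finset.mem_univ, if_true]
    rw [← add_sub_assoc]
    rfl
  | succ s ih =>
    rw [chainMatrix_succ]
    simp only [Matrix.add_apply, Matrix.sub_apply, Finset.sum_add_distrib, Finset.sum_sub_distrib,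
      hs, ih]
    rw [Fin.init]
    ring

/-- Within the blocks of `m_μ`, the labels after the replacements are increasing. -/
theorem pairLabel_chainLabel_mono {μ : Fin n → ℕ} (hμ : ∑ a, μ a = r) (i : Fin n) {s : ℕ}
    {c : Fin (s + 1) → Fin n} (hc : StrictMono c) :
    Monotone (pairLabel (blockLabel μ hμ) (chainLabel μ i c (blockLabel μ hμ))) := by
  have hupd : ∀ (x j : Fin n) (ρ : Fin r → Fin n), (∀ p, blockLabel μ hμ p = j → ρ p = j) →
      (∀ p q, p ≤ q → blockLabel μ hμ p = blockLabel μ hμ q → ρ p ≤ ρ q) →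
      ∀ p q, p ≤ q → blockLabel μ hμ p = blockLabel μ hμ q → upd μ x j ρ p ≤ upd μ x j ρ q := by
    intro x j ρ hρ hmono p q hpq hlab
    by_cases hp : blockLabel μ hμ p = j
    · have hq : blockLabel μ hμ q = j := hlab ▸ hp
      rw [upd, upd, hρ p hp, hρ q hq]
      rw [blockLabel_eq_iff] at hp hq
      rw [Fin.le_def] at hpq
      rcases lt_trichotomy x j with hx | hx | hx
      · rw [pos, if_pos hx]
        split_ifs with h1 h2 h2
        · exact le_rfl
        · exact hx.le
        · exact absurd ⟨h2.1, h2.2.1, by omega⟩ h1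
        · exact le_rfl
      · simp [hx]
      · rw [pos, if_neg hx.not_gt]
        split_ifs with h1 h2 h2
        · exact le_rfl
        · exact absurd ⟨h1.1, h1.2.1, by omega⟩ h2
        · exact hx.le
        · exact le_rfl
    · rw [upd_of_ne hμ x ρ hp, upd_of_ne hμ x ρ (hlab ▸ hp)]
      exact hmono p q hpq hlab
  have key : ∀ p q, p ≤ q → blockLabel μ hμ p = blockLabel μ hμ q →
      chainLabel μ i c (blockLabel μ hμ) p ≤ chainLabel μ i c (blockLabel μ hμ) q := by
    induction s with
    | zero => exact hupd _ _ _ (fun p hp => hp) fun p q _ h => h.le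
    | succ s ih =>
      exact hupd _ _ _ (fun p hp => chainLabel_init_of_last hμ i hc hp) (ih (strictMono_init hc))
  intro p q hpq
  rw [pairLabel, pairLabel, Prod.Lex.toLex_le_toLex]
  rcases (blockLabel_mono hμ hpq).lt_or_eq with h | h
  · exact Or.inl h
  · exact Or.inr ⟨h, key p q hpq h⟩

variable {μ : Fin n → ℕ} (hμ : ∑ a, μ a = r) {i : Fin n} {s : ℕ} {c : Fin (s + 1) → Fin n}

theorem chainMatrix_toNat (hc : StrictMono c) (hpos : ChainPos μ i c) (a b : Fin n) :
    (chainMatrix i c μ).map Int.toNat a b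
      = pairCount (blockLabel μ hμ) (chainLabel μ i c (blockLabel μ hμ)) a b := by
  rw [Matrix.map_apply, chainMatrix_apply hμ hc hpos, Int.toNat_natCast]

theorem sum_pairCount {m ρ : Fin r → Fin n} (b : Fin n) :
    ∑ a, pairCount m ρ a b = (Finset.univ.filter fun p => m p = b).card := by
  rw [Finset.card_eq_sum_card_fiberwise (f := ρ) (t := Finset.univ) (by intro p _; simp)]
  refine Finset.sum_congr rfl fun a _ => ?_
  rw [pairCount, Finset.filter_filter]

theorem colSum_chainMatrix (hμ : ∑ a, μ a = r) (hc : StrictMono c) (hpos : ChainPos μ i c) :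
    colSum ((chainMatrix i c μ).map Int.toNat) = μ := by
  funext b
  rw [colSum]
  simp only [chainMatrix_toNat hμ hc hpos]
  rw [sum_pairCount, card_blockLabel]

theorem sum_chainMatrix (hμ : ∑ a, μ a = r) (hc : StrictMono c) (hpos : ChainPos μ i c) :
    ∑ a, ∑ b, (chainMatrix i c μ).map Int.toNat a b = r := by
  refine Finset.sum_comm.trans (Eq.trans ?_ hμ)
  exact Finset.sum_congr rfl fun b _ => congrFun (colSum_chainMatrix hμ hc hpos) b

theorem colBlock_chainMatrix (hc : StrictMono c) (hpos : ChainPos μ i c)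
    (hA : ∑ a, ∑ b, (chainMatrix i c μ).map Int.toNat a b = r) :
    colBlock ((chainMatrix i c μ).map Int.toNat) hA
      = pairLabel (blockLabel μ hμ) (chainLabel μ i c (blockLabel μ hμ)) := by
  symm
  refine eq_blockLabel (sum_entries hA) (pairLabel_chainLabel_mono hμ i hc) fun x => ?_
  rw [chainMatrix_toNat hμ hc hpos, pairCount]
  congr 1
  ext p
  simp only [Finset.mem_filter, Finset.mem_univ, true_and]
  rw [pairLabel, ← ofLex_inj, Prod.ext_iff]
  rfl

/-! ### Invariance of the series of a chain -/

theorem stab_pairLabel_le {α β : Type*} (m : Fin r → α) (ρ : Fin r → β) :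
    stab (pairLabel m ρ) ≤ stab m := fun _ hw p => (mem_stab_pairLabel.1 hw p).1

theorem apply_mark {x j : Fin n} (hx : x ≠ j) (hj : 0 < μ j) {ρ : Fin r → Fin n}
    (hρ : ∀ p, blockLabel μ hμ p = j → ρ p = j) {w : Equiv.Perm (Fin r)}
    (hw : w ∈ stab (pairLabel (blockLabel μ hμ) (upd μ x j ρ))) {p : Fin r}
    (hp : (p : ℕ) = pos μ x j 0) : w p = p := by
  have h := mem_stab_pairLabel.1 hw p
  rw [upd_eq_setAt hx hj, setAt, setAt, if_pos hp, blockLabel_pos hμ x j hj hp] at h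
  by_contra hne
  rw [if_neg (fun h' => hne (Fin.ext (h'.trans hp.symm))), hρ _ h.1] at h
  exact hx h.2.symm

variable (k)

theorem seriesInvariant_chainSeries (hc : StrictMono c) (hc0 : c 0 ≤ i) (hpos : ChainPos μ i c) :
    SeriesInvariant k (pairLabel (blockLabel μ hμ) (chainLabel μ i c (blockLabel μ hμ)))
      (chainSeries k r i c μ) := by
  induction s with
  | zero =>
    rw [chainSeries_zero, chainLabel]
    split_ifs with hi
    · exact (seriesInvariant_block k hμ (c 0)).mono (stab_pairLabel_le _ _)
    · have hlt : c 0 < i := lt_of_le_of_ne hc0 (Ne.symm hi)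
      have h0 := hpos.1 hi
      have hjump := jumpSeries_of_gt (k := k) (r := r) hlt h0
      rw [jumpSeries, if_neg hlt.not_gt] at hjump
      rw [hjump]
      refine SeriesInvariant.mul (fun w hw => ?_)
        ((seriesInvariant_block k hμ (c 0)).mono (stab_pairLabel_le _ _))
      have hpr := pos_lt hμ i h0
      have hp : pos μ i (c 0) 0 = offset μ (c 0) + μ (c 0) - 1 := by
        rw [pos, if_neg hlt.not_gt, Nat.sub_zero]
      have hfix := apply_mark hμ hi h0 (fun p hp => hp) hw (p := ⟨pos μ i (c 0) 0, hpr⟩) rfl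
      have hX := xv_succ (k := k) (⟨pos μ i (c 0) 0, hpr⟩ : Fin r)
      simp only [] at hX
      rw [shiftSeries, ← hp, hX, map_invSub, map_sub, map_one]
      congr 2
      exact (MvPolynomial.rename_X _ _).trans (by rw [hfix])
  | succ s ih =>
    have hlast := fun p => chainLabel_init_of_last hμ i hc (p := p)
    rw [chainSeries_succ, chainLabel]
    refine ((ih (strictMono_init hc) hc0 hpos.init).mono (stab_pairLabel_upd_le hμ _ _ hlast)).mul ?_
    have hlt : c (Fin.last s).castSucc < c (Fin.last (s + 1)) := hc (Fin.castSucc_lt_last _)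
    have hpr := pos_lt hμ (c (Fin.last s).castSucc) hpos.last
    have hp : pos μ (c (Fin.last s).castSucc) (c (Fin.last (s + 1))) 0
        = offset μ (c (Fin.last (s + 1))) := by rw [pos, if_pos hlt, add_zero]
    have hX := xv_succ (k := k) (⟨_, hpr⟩ : Fin r)
    simp only [] at hX
    rw [← hp, posSeries, hX]
    exact seriesInvariant_invSub fun w hw => apply_mark hμ hlt.ne hpos.last hlast hw rfl

/-! ### The elements `ξ_{A,f}` of a chain -/

theorem stab_pairLabel_self {α : Type*} (m : Fin r → α) : stab (pairLabel m m) = stab m := by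
  ext w
  rw [mem_stab_pairLabel, mem_stab]
  simp only [and_self]

theorem isTransversal_one {α : Type*} [Group α] (G : Subgroup α) : IsTransversal G G {1} := by
  refine ⟨fun y hy => ?_, fun g hg => ⟨1, ⟨Finset.mem_singleton_self 1, by simpa⟩, ?_⟩⟩
  · rw [Finset.mem_singleton.1 hy]; exact G.one_mem
  · exact fun y hy => Finset.mem_singleton.1 hy.1

theorem jumpSum_eq_sum_image (hμ : ∑ a, μ a = r) (x j : Fin n) :
    jumpSum k r μ x j = ∑ y ∈ (Finset.range (μ j)).image (blockCyc r μ x j), AH.perm y := by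
  rw [Finset.sum_image (blockCyc_injOn hμ x j), jumpSum]

theorem exists_transversal (hc : StrictMono c) (hpos : ChainPos μ i c) :
    ∃ Y : Finset (Equiv.Perm (Fin r)),
      IsTransversal (stab (pairLabel (blockLabel μ hμ) (chainLabel μ i c (blockLabel μ hμ))))
        (stab (blockLabel μ hμ)) Y ∧ chainSum k r μ i c = ∑ y ∈ Y, AH.perm y := by
  classical
  induction s with
  | zero =>
    rw [chainSum, chainLabel]
    split_ifs with hi
    · refine ⟨{1}, ?_, by rw [Finset.sum_singleton, map_one]⟩
      rw [← hi, upd_self, stab_pairLabel_self]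
      exact isTransversal_one _
    · refine ⟨_, ?_, jumpSum_eq_sum_image k hμ i (c 0)⟩
      have := isTransversal_blockCyc hμ hi (hpos.1 hi) (ρ := blockLabel μ hμ) (fun p hp => hp)
      rwa [stab_pairLabel_self] at this
  | succ s ih =>
    obtain ⟨Z, hZ, hsum⟩ := ih (strictMono_init hc) hpos.init
    have hlast := fun p => chainLabel_init_of_last hμ i hc (p := p)
    have hY := isTransversal_blockCyc hμ (hc (Fin.castSucc_lt_last (Fin.last s))).ne hpos.last hlast
    rw [chainLabel]
    refine ⟨_, hY.mul (stab_pairLabel_upd_le hμ _ _ hlast) (stab_pairLabel_le _ _) hZ, ?_⟩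
    rw [hY.sum_mul hZ, chainSum, hsum, jumpSum_eq_sum_image k hμ, Finset.sum_mul_sum]
    simp only [map_mul]

variable {k}

/-- The value of the summand of a chain at `m_μ ⊗ 1`. -/
theorem xiImage_chain (hc : StrictMono c) (hc0 : c 0 ≤ i) (hpos : ChainPos μ i c)
    (hA : ∑ a, ∑ b, (chainMatrix i c μ).map Int.toNat a b = r) (d : ℕ) :
    xiImage ((chainMatrix i c μ).map Int.toNat) hA (PowerSeries.coeff d (chainSeries k r i c μ))
      = btenSeries (chainLabel μ i c (blockLabel μ hμ))
        (polySeries (chainSeries k r i c μ) * PowerSeries.C (chainSum k r μ i c)) d := by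
  have hcb := colBlock_chainMatrix hμ hc hpos hA
  have hcol : blockLabel (colSum ((chainMatrix i c μ).map Int.toNat)) (sum_colSum hA)
      = blockLabel μ hμ := by
    rw [← col_colBlock _ hA, hcb]; rfl
  have hrow : blockLabel (rowSum ((chainMatrix i c μ).map Int.toNat)) (sum_rowSum hA)
      ∘ dA ((chainMatrix i c μ).map Int.toNat) hA = chainLabel μ i c (blockLabel μ hμ) := by
    funext p
    rw [Function.comp_apply, row_dA, hcb]
    rfl
  have hinv := (seriesInvariant_chainSeries k hμ hc hc0 hpos).coeff d
  have hmono := pairLabel_chainLabel_mono hμ i hc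
  obtain ⟨Y, hY, hsum⟩ := exists_transversal k hμ hc hpos
  rw [xiImage, hcol, hcb, btenSeries_apply, PowerSeries.coeff_mul_C, hsum, polySeries,
    PowerSeries.coeff_map]
  simp only [mul_assoc]
  simp only [← bten_comp, hrow]
  rw [(isTransversal_minReps hmono (stab_pairLabel_le _ _)).sum_eq hY]
  · change _ = (balanced k n r).mkQ (Pi.single _ (AH.poly _ * _))
    rw [Finset.mul_sum]
    simp only [bten, ten]
    rw [← map_sum]
    congr 1
    exact (map_sum (LinearMap.single (AH k r) (fun _ : Fin r → Fin n => AH k r) _) _ _).symm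
  · intro w hw y
    rw [map_mul, ← mul_assoc, ← AH.perm_comm_of_invariant hmono hinv w hw, mul_assoc, ← bten_comp]
    congr 1
    funext p
    exact (mem_stab_pairLabel.1 hw p).2

end ChainMatrix

/-! ### Comparison of endomorphisms -/

section Comparison
variable {k : Type*} [CommRing k] {n r : ℕ}

/-- The vectors `m_μ ⊗ 1` generate the induced tensor space. -/
theorem AS_ext {f g : AS k n r}
    (h : ∀ (ν : Fin n → ℕ) (hν : ∑ a, ν a = r),
      f (bten (blockLabel ν hν) 1) = g (bten (blockLabel ν hν) 1)) : f = g := by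
  have key : ∀ (i : Fin r → Fin n) (a : AH k r), f (bten i a) = g (bten i a) := by
    intro i a
    set ν : Fin n → ℕ := fun b => (Finset.univ.filter fun p => (i ∘ Tuple.sort i) p = b).card
    have hν : ∑ b, ν b = r := by
      have := Finset.card_eq_sum_card_fiberwise (f := i ∘ Tuple.sort i) (s := Finset.univ)
        (t := Finset.univ) (by intro p _; simp)
      rw [← this, Finset.card_univ, Fintype.card_fin]
    have h1 : i ∘ Tuple.sort i = blockLabel ν hν :=
      eq_blockLabel hν (Tuple.monotone_sort i) fun _ => rfl
    have h2 : i = blockLabel ν hν ∘ ((Tuple.sort i)⁻¹ : Equiv.Perm (Fin r)) := by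
      rw [← h1]
      funext p
      simp only [Function.comp_apply, perm_apply_inv]
    have h3 : bten i a = MulOpposite.op (AH.perm (Tuple.sort i)⁻¹ * a)
        • bten (k := k) (blockLabel ν hν) 1 := by
      rw [op_smul_bten, one_mul, ← bten_comp, ← h2]
    rw [h3, map_smul, map_smul, h ν hν]
  refine Submodule.linearMap_qext _ (LinearMap.pi_ext fun i a => ?_)
  exact key i a

theorem drinfeld_T_bten (i j : Fin n) (d : ℕ) (m : Fin r → Fin n) :
    drinfeld k n r (Yangian.T k i j d) (bten m 1) = evSeries m (monodromy k n r i j) d := by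
  have h : drinfeldTilde k n r (Yangian.T k i j d) = coeffs (monodromy k n r) d i j :=
    Yangian.lift_T _ _ _ _ _
  change (balanced k n r).mkQ (drinfeldTilde k n r (Yangian.T k i j d) (ten m 1)) = _
  rw [h]
  rfl

/-- The action of `T_{i,j}(u)` on `m_μ ⊗ 1` as a sum over chains. -/
theorem evSeries_monodromy {μ : Fin n → ℕ} (hμ : ∑ a, μ a = r) (i j : Fin n) :
    evSeries (blockLabel μ hμ) (monodromy k n r i j)
      = ∑ s ∈ Finset.range n, ∑ c ∈ chains i j s,
        btenSeries (chainLabel μ i c (blockLabel μ hμ))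
          (polySeries (chainSeries k r i c μ) * PowerSeries.C (chainSum k r μ i c)) := by
  have h1 := evSeries_eq_sum_chains (k := k) hμ i n j j.2 _ (fun _ _ => rfl) 1
  have h2 := evSeries_partialMonodromy_skip (k := k) (blockLabel μ hμ) i j (offset_add_le hμ j) le_rfl
    (fun p hp _ h => by have := ((blockLabel_eq_iff hμ p j).1 h).2; omega) 1
  rw [partialMonodromy_self, h1, map_one, mul_one] at h2
  simpa only [mul_one] using h2

theorem chainSum_eq_zero {μ : Fin n → ℕ} {i : Fin n} {s : ℕ} {c : Fin (s + 1) → Fin n}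
    (h : ¬ ChainPos μ i c) : chainSum k r μ i c = 0 := by
  induction s with
  | zero =>
    have h0 : ¬ (i ≠ c 0 → 0 < μ (c 0)) := fun h' => h ⟨h', fun l => l.elim0⟩
    push Not at h0
    rw [chainSum, if_neg h0.1, jumpSum_eq_zero (by omega)]
  | succ s ih =>
    rw [chainSum]
    by_cases hl : 0 < μ (c (Fin.last (s + 1)))
    · rw [ih, mul_zero]
      refine fun h' => h ⟨h'.1, fun l => ?_⟩
      induction l using Fin.lastCases with
      | last => exact hl
      | cast l => exact h'.2 l
    · rw [jumpSum_eq_zero (by omega), zero_mul]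

theorem mem_admissible {μ : Fin n → ℕ} {i : Fin n} {s : ℕ} {c : Fin (s + 1) → Fin n} :
    μ ∈ admissible r i c ↔ ∑ a, μ a = r ∧ ChainPos μ i c := by
  rw [admissible, Finset.mem_filter, Finset.mem_piAntidiag]
  simp only [Finset.mem_univ, implies_true, and_true]
  rfl

theorem mem_chains {i j : Fin n} {s : ℕ} {c : Fin (s + 1) → Fin n} :
    c ∈ chains i j s ↔ StrictMono c ∧ c (Fin.last s) = j ∧ c 0 ≤ i := by
  rw [chains, Finset.mem_filter]
  simp only [Finset.mem_univ, true_and]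
  rfl

theorem isInvariant_chainSeries {μ : Fin n → ℕ} (hμ : ∑ a, μ a = r) {i : Fin n} {s : ℕ}
    {c : Fin (s + 1) → Fin n} (hc : StrictMono c) (hc0 : c 0 ≤ i) (hpos : ChainPos μ i c)
    (hA : ∑ a, ∑ b, (chainMatrix i c μ).map Int.toNat a b = r) (d : ℕ) :
    IsInvariant ((chainMatrix i c μ).map Int.toNat) hA
      (PowerSeries.coeff d (chainSeries k r i c μ)) := by
  rw [IsInvariant, colBlock_chainMatrix hμ hc hpos hA]
  exact (seriesInvariant_chainSeries k hμ hc hc0 hpos).coeff d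

/-- The value of `ξ_{A,f}` at `m_ν ⊗ 1` for the matrix and the series of a chain. -/
theorem xi_chain_bten {μ ν : Fin n → ℕ} (hμ : ∑ a, μ a = r) (hν : ∑ a, ν a = r) {i : Fin n} {s : ℕ}
    {c : Fin (s + 1) → Fin n} (hc : StrictMono c) (hc0 : c 0 ≤ i) (hpos : ChainPos μ i c) (d : ℕ) :
    xi ((chainMatrix i c μ).map Int.toNat) (PowerSeries.coeff d (chainSeries k r i c μ))
        (bten (blockLabel ν hν) 1)
      = if ν = μ then btenSeries (chainLabel μ i c (blockLabel μ hμ))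
          (polySeries (chainSeries k r i c μ) * PowerSeries.C (chainSum k r μ i c)) d else 0 := by
  have hA := sum_chainMatrix hμ hc hpos
  have hf := isInvariant_chainSeries (k := k) hμ hc hc0 hpos hA d
  rw [xi, dif_pos ⟨hA, hf⟩, xiHom_bten, colSum_chainMatrix hμ hc hpos,
    xiImage_chain hμ hc hc0 hpos hA]

end Comparison
end DrinfeldSchur

theorem theorem8p3 {k : Type*} [CommRing k] (n r : ℕ) (i j : Fin n) :
    (∀ (s : ℕ), ∀ c ∈ chains i j s, ∀ μ ∈ admissible r i c,
      (∀ a b, 0 ≤ chainMatrix i c μ a b) ∧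
      (∀ b, ∑ a, chainMatrix i c μ a b = μ b) ∧
      (∀ a, ∑ b, chainMatrix i c μ a b =
        (μ a : ℤ) + (Pi.single i 1 : Fin n → ℤ) a - (Pi.single j 1 : Fin n → ℤ) a) ∧
      ∃ hA : ∑ a, ∑ b, ((chainMatrix i c μ).map Int.toNat) a b = r,
        ∀ d : ℕ, IsInvariant ((chainMatrix i c μ).map Int.toNat) hA
          (PowerSeries.coeff d (chainSeries k r i c μ))) ∧
    PowerSeries.map (drinfeld k n r : Yangian k n →+* AS k n r) (TSeries k i j) =
      ∑ s ∈ Finset.range n, ∑ c ∈ chains i j s, ∑ μ ∈ admissible r i c,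
        xiSeries ((chainMatrix i c μ).map Int.toNat) (chainSeries k r i c μ) := by
  constructor
  · intro s c hc μ hμ'
    obtain ⟨hc, hcj, hc0⟩ := mem_chains.1 hc
    obtain ⟨hμ, hpos⟩ := mem_admissible.1 hμ'
    have hA := sum_chainMatrix hμ hc hpos
    refine ⟨fun a b => ?_, fun b => ?_, fun a => ?_, hA,
      isInvariant_chainSeries hμ hc hc0 hpos hA⟩
    · rw [chainMatrix_apply hμ hc hpos]
      exact Int.natCast_nonneg _
    · simp only [chainMatrix_apply hμ hc hpos]
      rw [← Nat.cast_sum, sum_pairCount, card_blockLabel]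
    · rw [sum_chainMatrix_row, hcj]
  · ext1 d
    refine AS_ext fun ν hν => ?_
    have hL : PowerSeries.coeff d (PowerSeries.map (drinfeld k n r : Yangian k n →+* AS k n r)
        (TSeries k i j)) = drinfeld k n r (Yangian.T k i j d) := by
      rw [PowerSeries.coeff_map, TSeries, PowerSeries.coeff_mk]
      rfl
    rw [hL, drinfeld_T_bten, evSeries_monodromy hν]
    simp only [map_sum, LinearMap.sum_apply, Finset.sum_apply]
    refine Finset.sum_congr rfl fun s _ => Finset.sum_congr rfl fun c hc => ?_
    obtain ⟨hc, -, hc0⟩ := mem_chains.1 hc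
    have hterm : ∀ μ ∈ admissible r i c, PowerSeries.coeff d
          (xiSeries ((chainMatrix i c μ).map Int.toNat) (chainSeries k r i c μ))
            (bten (blockLabel ν hν) 1)
        = if ν = μ then btenSeries (chainLabel ν i c (blockLabel ν hν))
          (polySeries (chainSeries k r i c ν) * PowerSeries.C (chainSum k r ν i c)) d else 0 := by
      intro μ hμ'
      obtain ⟨hμ, hpos⟩ := mem_admissible.1 hμ'
      rw [xiSeries, PowerSeries.coeff_mk, xi_chain_bten hμ hν hc hc0 hpos]
      split_ifs with h
      · subst h; rfl
      · rfl
    rw [Finset.sum_congr rfl hterm, Finset.sum_ite_eq]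
    split_ifs with hmem
    · rfl
    · -- a composition that is not admissible contributes zero
      rw [chainSum_eq_zero fun h => hmem (mem_admissible.2 ⟨hν, h⟩), map_zero, mul_zero, map_zero]
      rfl
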